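/- Let $n\ge 2$ and $1<q<p<\infty$. Let $\Omega\subset\mathbb{R}^n$ be a bounded domain with Lipschitz boundary, let $A\subset\subset\Omega$ be an open set with Lipschitz boundary and finitely many connected components, and assume that $B:=\Omega\setminus\overline A$ is a domain. Let $Q_B:B\times[0,\infty)\to\mathbb{R}$ and $Q_A:A\times[0,\infty)\to\mathbb{R}$ satisfy: (A1) $Q_B$ and $Q_A$ are Carathéodory functions (measurable in $x$ for every $E\ge 0$, continuous in $E$ for a.e. $x$). (A2) For a.e. $x$ in $B$ (resp. $A$) the function $E\mapsto Q_B(x,E)$ (resp. $Q_A(x,E)$) is nonnegative, $C^1$ and strictly convex on $[0,\infty)$ and vanishes at $E=0$. (A3) There are constants $0<\underline Q\le\overline Q$ and $E_0>0$ such that, for all $E\ge0$, $\underline Q[(E/E_0)^p-1]\le Q_B(x,E)\le\overline Q[(E/E_0)^p+1]$ for a.e. $x\in B$ and $\underline Q[(E/E_0)^q-1]\le Q_A(x,E)\le\overline Q[(E/E_0)^q+1]$ for a.e. $x\in A$. (A4) There is a function $\beta$ with $\lim_{E\to+\infty}Q_B(x,E)/E^p=\beta(x)$ for a.e. $x\in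 B$. Let $f\in W^{1,p}(\Omega)$ (it prescribes the Dirichlet datum on $\partial\Omega$). For $v\in W^{1,q}(\Omega)$, "$v=f$ on $\partial\Omega$" means $v-f\in W^{1,q}_0(\Omega)$; for $v\in W^{1,p}(B)$ it means that $v-f|_B$ lies in $W^{1,p}_{\partial\Omega}(B)$, the closure in $W^{1,p}(B)$ of the restrictions to $B$ of functions in $C^1_c(\Omega)$ (nothing is prescribed on $\partial A$). For each $\lambda>0$ let $v^\lambda$ be the minimizer of $$\mathbb{G}^\lambda(v)=\frac1{\lambda^p}\left(\int_B Q_B(x,\lambda|\nabla v|)\,dx+\int_A Q_A(x,\lambda|\nabla v|)\,dx\right)\in[0,\infty]$$ over all $v\in W^{1,q}(\Omega)$ with $v=f$ on $\partial\Omega$. Then the problem $$\min\left\{\int_B\beta(x)|\nabla v(x)|^p\,dx\ :\ v\in W^{1,p}(B),\ v=f\text{ on }\partial\Omega\right\}$$ has a unique solution $v_B$; the restriction of $v^\lambda$ to $B$ belongs to $W^{1,p}(B)$ for every $\lambda>0$, and $$v^\lambda\rightharpoonup v_B\quad\text{weakly in }W^{1,p}(B)\text{ as }\lambda\to+\infty.$$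 Moreover $v_B$ is a weak solution of $\operatorname{div}(\beta|\nabla v_B|^{p-2}\nabla v_B)=0$ in $B$, $\beta|\nabla v_B|^{p-2}\partial_\nu v_B=0$ on $\partial A$, $v_B=f$ on $\partial\Omega$: for every $\varphi\in W^{1,p}_{\partial\Omega}(B)$, $$\int_B\beta|\nabla v_B|^{p-2}\nabla v_B\cdot\nabla\varphi\,dx=0 .$$ -/

import Mathlib

open MeasureTheory Filter Topology Set
open scoped ENNReal NNReal ContDiff

noncomputable section

/-- `ℝⁿ` with its Euclidean norm. -/
abbrev Euc (n : ℕ) : Type := EuclideanSpace ℝ (Fin n)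

/-- `G` is the weak gradient of `u` on the open set `U`, for functions `u`, `G` that are locally
integrable on `U`: integration by parts holds in every direction `e` against every
test function in `C_c^∞(U)`. -/
def IsWeakGradient {n : ℕ} (U : Set (Euc n)) (u : Euc n → ℝ) (G : Euc n → Euc n) : Prop :=
  ∀ φ : Euc n → ℝ, ContDiff ℝ ∞ φ → HasCompactSupport φ → tsupport φ ⊆ U → ∀ e : Euc n,
    ∫ x in U, u x * fderiv ℝ φ x e = - ∫ x in U, inner ℝ (G x) e * φ x

instance factOneLeOfReal (p : ℝ) [h : Fact (1 < p)] : Fact (1 ≤ ENNReal.ofReal p) :=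
  ⟨by simpa using ENNReal.ofReal_le_ofReal h.out.le⟩

/-- A product of an `L^p` function on `U` with a continuous compactly supported function is
integrable on `U`. -/
theorem integrable_mul_test {n : ℕ} {U : Set (Euc n)} {p : ℝ} [hp : Fact (1 < p)]
    {g φ : Euc n → ℝ} (hg : MemLp g (ENNReal.ofReal p) (volume.restrict U))
    (hφ : Continuous φ) (hc : HasCompactSupport φ) :
    Integrable (fun x => g x * φ x) (volume.restrict U) := by
  have hloc : LocallyIntegrable g (volume.restrict U) :=
    hg.locallyIntegrable (Fact.out : 1 ≤ ENNReal.ofReal p)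
  have h := hloc.integrable_smul_left_of_hasCompactSupport hφ hc
  refine h.congr (Eventually.of_forall fun x => ?_)
  simp [mul_comm]

/-- The Sobolev space `W^{1,p}(U)`, `1 < p < ∞`: the pairs `(u, ∇u)` of (classes of) `L^p` functions
on `U` such that `∇u` is the weak gradient of `u`. It carries the norm
`max(‖u‖_{L^p(U)}, ‖∇u‖_{L^p(U)})`, which is equivalent to the usual one. -/
def W1 {n : ℕ} (U : Set (Euc n)) (p : ℝ) [Fact (1 < p)] :
    Submodule ℝ (Lp ℝ (ENNReal.ofReal p) (volume.restrict U) ×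
      Lp (Euc n) (ENNReal.ofReal p) (volume.restrict U)) where
  carrier := {w | IsWeakGradient U w.1 w.2}
  zero_mem' := by
    intro φ _ _ _ e
    have h1 : ∫ x in U, ((0 : Lp ℝ (ENNReal.ofReal p) (volume.restrict U)) : Euc n → ℝ) x
        * fderiv ℝ φ x e = ∫ x in U, (0 : ℝ) := by
      refine integral_congr_ae ?_
      filter_upwards [Lp.coeFn_zero ℝ (ENNReal.ofReal p) (volume.restrict U)] with x hx
      simp only [hx, Pi.zero_apply, zero_mul]
    have h2 : ∫ x in U, inner ℝ (((0 : Lp (Euc n) (ENNReal.ofReal p) (volume.restrict U)) :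
        Euc n → Euc n) x) e * φ x = ∫ x in U, (0 : ℝ) := by
      refine integral_congr_ae ?_
      filter_upwards [Lp.coeFn_zero (Euc n) (ENNReal.ofReal p) (volume.restrict U)] with x hx
      simp only [hx, Pi.zero_apply, inner_zero_left, zero_mul]
    simp only [Prod.fst_zero, Prod.snd_zero]
    rw [h1, h2]
    simp
  add_mem' := by
    intro a b ha hb φ hφ hc hs e
    have hd : Continuous fun x => fderiv ℝ φ x e :=
      (hφ.continuous_fderiv (by simp)).clm_apply continuous_const
    have hdc : HasCompactSupport fun x => fderiv ℝ φ x e := hc.fderiv_apply (𝕜 := ℝ) e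
    have hin : ∀ g : Lp (Euc n) (ENNReal.ofReal p) (volume.restrict U),
        MemLp (fun x => inner ℝ (g x) e) (ENNReal.ofReal p) (volume.restrict U) := fun g =>
      (Lp.memLp g).inner_const e
    have h1 : ∫ x in U, (a + b).1 x * fderiv ℝ φ x e =
        (∫ x in U, a.1 x * fderiv ℝ φ x e) + ∫ x in U, b.1 x * fderiv ℝ φ x e := by
      rw [← integral_add (integrable_mul_test (Lp.memLp a.1) hd hdc)
        (integrable_mul_test (Lp.memLp b.1) hd hdc)]
      refine integral_congr_ae ?_
      filter_upwards [Lp.coeFn_add a.1 b.1] with x hx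
      simp only [Prod.fst_add, hx, Pi.add_apply, add_mul]
    have h2 : ∫ x in U, inner ℝ ((a + b).2 x) e * φ x =
        (∫ x in U, inner ℝ (a.2 x) e * φ x) + ∫ x in U, inner ℝ (b.2 x) e * φ x := by
      rw [← integral_add (integrable_mul_test (hin a.2) hφ.continuous hc)
        (integrable_mul_test (hin b.2) hφ.continuous hc)]
      refine integral_congr_ae ?_
      filter_upwards [Lp.coeFn_add a.2 b.2] with x hx
      simp only [Prod.snd_add, hx, Pi.add_apply, inner_add_left, add_mul]
    rw [h1, h2, ha φ hφ hc hs e, hb φ hφ hc hs e]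
    ring
  smul_mem' := by
    intro c a ha φ hφ hc hs e
    have h1 : ∫ x in U, (c • a).1 x * fderiv ℝ φ x e =
        c * ∫ x in U, a.1 x * fderiv ℝ φ x e := by
      rw [← integral_const_mul]
      refine integral_congr_ae ?_
      filter_upwards [Lp.coeFn_smul c a.1] with x hx
      simp [hx, mul_assoc]
    have h2 : ∫ x in U, inner ℝ ((c • a).2 x) e * φ x =
        c * ∫ x in U, inner ℝ (a.2 x) e * φ x := by
      rw [← integral_const_mul]
      refine integral_congr_ae ?_
      filter_upwards [Lp.coeFn_smul c a.2] with x hx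
      simp [hx, real_inner_smul_left, mul_assoc]
    rw [h1, h2, ha φ hφ hc hs e]
    ring

/-- A representative of the Sobolev function (determined a.e. on `U`). -/
def sobFun {n : ℕ} {U : Set (Euc n)} {p : ℝ} [Fact (1 < p)] (u : W1 U p) : Euc n → ℝ := u.1.1

/-- A representative of the weak gradient of a Sobolev function (determined a.e. on `U`). -/
def sobGrad {n : ℕ} {U : Set (Euc n)} {p : ℝ} [Fact (1 < p)] (u : W1 U p) : Euc n → Euc n := u.1.2

/-- The functions of `W^{1,p}(U)`, `U ⊆ Ω`, that vanish on `∂Ω`: the closure in `W^{1,p}(U)` of the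
restrictions to `U` of the functions in `C^1_c(Ω)`. For `U = Ω` this is `W_0^{1,p}(Ω)`. For
`U = Ω \ closure A` with `A` compactly contained in `Ω` nothing is prescribed on `∂A`. -/
def vanishingOn {n : ℕ} (U Ω : Set (Euc n)) (p : ℝ) [Fact (1 < p)] : Set (W1 U p) :=
  closure {w | ∃ φ : Euc n → ℝ, ContDiff ℝ 1 φ ∧ HasCompactSupport φ ∧ tsupport φ ⊆ Ω ∧
    sobFun w =ᵐ[volume.restrict U] φ}

/-- `v = f` on `∂Ω` for `v ∈ W^{1,p}(U)`: the difference `v - f` (on `U`) vanishes on `∂Ω`. -/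
def EqOnBoundary {n : ℕ} {U : Set (Euc n)} {p : ℝ} [Fact (1 < p)] (Ω : Set (Euc n))
    (v : W1 U p) (f : Euc n → ℝ) : Prop :=
  ∃ w ∈ vanishingOn U Ω p, ∀ᵐ x ∂(volume.restrict U), sobFun v x - f x = sobFun w x

/-- `U` has Lipschitz boundary: near each boundary point `U` is, in the direction of some
unit vector `e`, the strict epigraph of a Lipschitz function `γ` of the component
orthogonal to `e`. -/
def HasLipschitzBoundary {n : ℕ} (U : Set (Euc n)) : Prop :=
  ∀ x ∈ frontier U, ∃ (e : Euc n) (K : ℝ≥0) (γ : Euc n → ℝ) (r : ℝ),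
    ‖e‖ = 1 ∧ LipschitzWith K γ ∧ 0 < r ∧
    ∀ y ∈ Metric.ball x r, y ∈ U ↔ γ (y - inner ℝ e y • e) < inner ℝ e y

/-- The geometric setting: `Ω ⊆ ℝⁿ` is a bounded domain with Lipschitz boundary, `A ⊂⊂ Ω` is open
with Lipschitz boundary and finitely many connected components, and `Ω \ closure A` is a
domain. -/
structure IsAdmissibleGeometry {n : ℕ} (Ω A : Set (Euc n)) : Prop where
  isOpen : IsOpen Ω
  isConnected : IsConnected Ω
  isBounded : Bornology.IsBounded Ω
  lipschitz : HasLipschitzBoundary Ω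
  isOpen_inner : IsOpen A
  lipschitz_inner : HasLipschitzBoundary A
  finite_components : Finite (ConnectedComponents A)
  closure_subset : closure A ⊆ Ω
  isConnected_outer : IsConnected (Ω \ closure A)

/-- Carathéodory functions `Q : U × [0,∞) → ℝ`. -/
def IsCaratheodory {n : ℕ} (U : Set (Euc n)) (Q : Euc n → ℝ → ℝ) : Prop :=
  (∀ E : ℝ, 0 ≤ E → AEMeasurable (fun x => Q x E) (volume.restrict U)) ∧
  ∀ᵐ x ∂(volume.restrict U), ContinuousOn (Q x) (Ici 0)

/-- For a.e. `x ∈ U` the function `Q x` is nonnegative, `C¹` and strictly convex on `[0,∞)` and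
vanishes at `0`. -/
def IsConvexDensity {n : ℕ} (U : Set (Euc n)) (Q : Euc n → ℝ → ℝ) : Prop :=
  ∀ᵐ x ∂(volume.restrict U), (∀ E : ℝ, 0 ≤ E → 0 ≤ Q x E) ∧ ContDiffOn ℝ 1 (Q x) (Ici 0) ∧
    StrictConvexOn ℝ (Ici 0) (Q x) ∧ Q x 0 = 0

/-- Two-sided growth of order `r` on `U`, with constants `c ≤ C` and `E₀`. -/
def HasGrowth {n : ℕ} (U : Set (Euc n)) (Q : Euc n → ℝ → ℝ) (r c C E₀ : ℝ) : Prop :=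
  ∀ᵐ x ∂(volume.restrict U), ∀ E : ℝ, 0 ≤ E →
    c * ((E / E₀) ^ r - 1) ≤ Q x E ∧ Q x E ≤ C * ((E / E₀) ^ r + 1)

/-- The normalized Dirichlet energy
`G^t(v) = t^{-p} (∫_{Ω \ closure A} Q_B(x, t|∇v|) dx + ∫_A Q_A(x, t|∇v|) dx)`, with values in
`[0,∞]`, for `v ∈ W^{1,q}(Ω)`. -/
def normalizedEnergy {n : ℕ} {Ω : Set (Euc n)} {q : ℝ} [Fact (1 < q)] (A : Set (Euc n))
    (QB QA : Euc n → ℝ → ℝ) (p t : ℝ) (v : W1 Ω q) : ℝ≥0∞ :=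
  ENNReal.ofReal (1 / t ^ p) *
    ((∫⁻ x in Ω \ closure A, ENNReal.ofReal (QB x (t * ‖sobGrad v x‖))) +
      ∫⁻ x in A, ENNReal.ofReal (QA x (t * ‖sobGrad v x‖)))

/-- `v` is a normalized solution: it minimizes `G^t` among all functions in `W^{1,q}(Ω)` that are
equal to `f` on `∂Ω`. -/
def IsNormalizedSolution {n : ℕ} {Ω : Set (Euc n)} {q : ℝ} [Fact (1 < q)] (A : Set (Euc n))
    (QB QA : Euc n → ℝ → ℝ) (p t : ℝ) (f : Euc n → ℝ) (v : W1 Ω q) : Prop :=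
  EqOnBoundary Ω v f ∧ ∀ w : W1 Ω q, EqOnBoundary Ω w f →
    normalizedEnergy A QB QA p t v ≤ normalizedEnergy A QB QA p t w

/-- The weighted `p`-energy `∫_B β |∇v|^p dx`, for `v ∈ W^{1,p}(B)`. -/
def weightedEnergy {n : ℕ} {B : Set (Euc n)} {p : ℝ} [Fact (1 < p)] (β : Euc n → ℝ)
    (v : W1 B p) : ℝ≥0∞ :=
  ∫⁻ x in B, ENNReal.ofReal (β x * ‖sobGrad v x‖ ^ p)

/-- `v` minimizes `∫_B β |∇v|^p dx` among all functions in `W^{1,p}(B)` equal to `f` on `∂Ω`. -/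
def IsWeightedMinimizer {n : ℕ} {B : Set (Euc n)} {p : ℝ} [Fact (1 < p)] (Ω : Set (Euc n))
    (β f : Euc n → ℝ) (v : W1 B p) : Prop :=
  EqOnBoundary Ω v f ∧ ∀ w : W1 B p, EqOnBoundary Ω w f → weightedEnergy β v ≤ weightedEnergy β w

/-- `v ∈ W^{1,p}(B)` is a weak solution of `div (β |∇v|^{p-2} ∇v) = 0` in `B`, with `v = f` on `∂Ω`
and the natural condition `β |∇v|^{p-2} ∂_ν v = 0` on the rest of `∂B`: the test functions are
those of `W^{1,p}(B)` that vanish on `∂Ω` and are unrestricted elsewhere. -/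
def IsWeakNeumannSolution {n : ℕ} {B : Set (Euc n)} {p : ℝ} [Fact (1 < p)] (Ω : Set (Euc n))
    (β f : Euc n → ℝ) (v : W1 B p) : Prop :=
  EqOnBoundary Ω v f ∧ ∀ φ ∈ vanishingOn B Ω p,
    Integrable (fun x => β x * ‖sobGrad v x‖ ^ (p - 2) * inner ℝ (sobGrad v x) (sobGrad φ x))
      (volume.restrict B) ∧
    ∫ x in B, β x * ‖sobGrad v x‖ ^ (p - 2) * inner ℝ (sobGrad v x) (sobGrad φ x) = 0

end

section SobolevBasics

variable {n : ℕ} {U V : Set (Euc n)} {p : ℝ} {u u' : Euc n → ℝ} {G G' : Euc n → Euc n}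

theorem fderiv_apply_eq_zero_of_notMem_tsupport {φ : Euc n → ℝ} {x : Euc n} (hx : x ∉ tsupport φ)
    (e : Euc n) : fderiv ℝ φ x e = 0 := by
  have h : fderiv ℝ φ x = 0 := by
    by_contra hne
    exact hx (support_fderiv_subset ℝ (f := φ) hne)
  simp [h]

theorem IsWeakGradient.congr (hu : u =ᵐ[volume.restrict U] u') (hG : G =ᵐ[volume.restrict U] G')
    (h : IsWeakGradient U u G) : IsWeakGradient U u' G' := by
  intro φ hφ hc hs e
  have h1 : ∫ x in U, u' x * fderiv ℝ φ x e = ∫ x in U, u x * fderiv ℝ φ x e :=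
    integral_congr_ae (by filter_upwards [hu] with x hx; rw [hx])
  have h2 : ∫ x in U, inner ℝ (G' x) e * φ x = ∫ x in U, inner ℝ (G x) e * φ x :=
    integral_congr_ae (by filter_upwards [hG] with x hx; rw [hx])
  rw [h1, h2, h φ hφ hc hs e]

theorem IsWeakGradient.mono (hVU : V ⊆ U) (hU : MeasurableSet U) (h : IsWeakGradient U u G) :
    IsWeakGradient V u G := by
  intro φ hφ hc hs e
  have h1 := setIntegral_eq_of_subset_of_forall_sdiff_eq_zero (μ := volume)
    (f := fun x => u x * fderiv ℝ φ x e) hU hVU (fun x hx => by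
      rw [fderiv_apply_eq_zero_of_notMem_tsupport (fun hx' => hx.2 (hs hx')), mul_zero])
  have h2 := setIntegral_eq_of_subset_of_forall_sdiff_eq_zero (μ := volume)
    (f := fun x => inner ℝ (G x) e * φ x) hU hVU (fun x hx => by
      rw [image_eq_zero_of_notMem_tsupport (fun hx' => hx.2 (hs hx')), mul_zero])
  rw [← h1, ← h2]
  exact h φ hφ hc (hs.trans hVU) e

/-- Weak gradients are unique. -/
theorem IsWeakGradient.ae_eq (hU : IsOpen U) (hu : u =ᵐ[volume.restrict U] u')
    (h : IsWeakGradient U u G) (h' : IsWeakGradient U u' G')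
    (hG : LocallyIntegrable G (volume.restrict U))
    (hG' : LocallyIntegrable G' (volume.restrict U)) : G =ᵐ[volume.restrict U] G' := by
  have key : ∀ e : Euc n, ∀ᵐ x ∂(volume.restrict U), inner ℝ (G x - G' x) e = (0 : ℝ) := by
    intro e
    rw [ae_restrict_iff' hU.measurableSet]
    have hin : ∀ F : Euc n → Euc n, LocallyIntegrable F (volume.restrict U) →
        LocallyIntegrable (fun x => (inner ℝ (F x) e : ℝ)) (volume.restrict U) := by
      intro F hF x
      obtain ⟨s, hs, hi⟩ := hF x
      exact ⟨s, hs, hi.inner_const e⟩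
    have hd : LocallyIntegrable (fun x => (inner ℝ (G x - G' x) e : ℝ)) (volume.restrict U) := by
      simp only [inner_sub_left]
      exact (hin G hG).sub (hin G' hG')
    refine hU.ae_eq_zero_of_integral_contDiff_smul_eq_zero
      (locallyIntegrableOn_of_locallyIntegrable_restrict hd) ?_
    intro φ hφ hc hs
    have h0 : ∫ x, φ x • (inner ℝ (G x - G' x) e : ℝ) =
        ∫ x in U, φ x • (inner ℝ (G x - G' x) e : ℝ) := by
      refine (setIntegral_eq_integral_of_forall_compl_eq_zero fun x hx => ?_).symm
      rw [image_eq_zero_of_notMem_tsupport (fun hx' => hx (hs hx')), zero_smul]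
    have i1 := (hin G hG).integrable_smul_left_of_hasCompactSupport hφ.continuous hc
    have i2 := (hin G' hG').integrable_smul_left_of_hasCompactSupport hφ.continuous hc
    have e1 := h φ hφ hc hs e
    have e2 := h'.congr hu.symm (EventuallyEq.refl _ G') φ hφ hc hs e
    rw [h0]
    simp only [inner_sub_left, smul_sub]
    rw [integral_sub i1 i2]
    simp only [smul_eq_mul]
    simp only [mul_comm (φ _)]
    linarith
  have hall : ∀ᵐ x ∂(volume.restrict U), ∀ i : Fin n,
      (inner ℝ (G x - G' x) (EuclideanSpace.single i (1 : ℝ)) : ℝ) = 0 :=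
    ae_all_iff.2 fun i => key _
  filter_upwards [hall] with x hx
  rw [← sub_eq_zero]
  ext i
  simpa [EuclideanSpace.inner_single_right] using hx i

variable [Fact (1 < p)]

/-- The element of `W^{1,p}(U)` given by functions representing it and its weak gradient. -/
noncomputable def W1.of (hu : MemLp u (ENNReal.ofReal p) (volume.restrict U))
    (hG : MemLp G (ENNReal.ofReal p) (volume.restrict U)) (h : IsWeakGradient U u G) : W1 U p :=
  ⟨(hu.toLp u, hG.toLp G), h.congr hu.coeFn_toLp.symm hG.coeFn_toLp.symm⟩

theorem W1.sobFun_of (hu : MemLp u (ENNReal.ofReal p) (volume.restrict U))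
    (hG : MemLp G (ENNReal.ofReal p) (volume.restrict U)) (h : IsWeakGradient U u G) :
    sobFun (W1.of hu hG h) =ᵐ[volume.restrict U] u := hu.coeFn_toLp

theorem W1.sobGrad_of (hu : MemLp u (ENNReal.ofReal p) (volume.restrict U))
    (hG : MemLp G (ENNReal.ofReal p) (volume.restrict U)) (h : IsWeakGradient U u G) :
    sobGrad (W1.of hu hG h) =ᵐ[volume.restrict U] G := hG.coeFn_toLp

theorem memLp_sobFun (w : W1 U p) : MemLp (sobFun w) (ENNReal.ofReal p) (volume.restrict U) :=
  Lp.memLp w.1.1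

theorem memLp_sobGrad (w : W1 U p) : MemLp (sobGrad w) (ENNReal.ofReal p) (volume.restrict U) :=
  Lp.memLp w.1.2

theorem isWeakGradient_sobGrad (w : W1 U p) : IsWeakGradient U (sobFun w) (sobGrad w) := w.2

theorem sobFun_add (v w : W1 U p) :
    sobFun (v + w) =ᵐ[volume.restrict U] fun x => sobFun v x + sobFun w x :=
  Lp.coeFn_add v.1.1 w.1.1

theorem sobFun_sub (v w : W1 U p) :
    sobFun (v - w) =ᵐ[volume.restrict U] fun x => sobFun v x - sobFun w x :=
  Lp.coeFn_sub v.1.1 w.1.1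

theorem sobFun_smul (c : ℝ) (w : W1 U p) :
    sobFun (c • w) =ᵐ[volume.restrict U] fun x => c * sobFun w x :=
  Lp.coeFn_smul c w.1.1

theorem sobGrad_add (v w : W1 U p) :
    sobGrad (v + w) =ᵐ[volume.restrict U] fun x => sobGrad v x + sobGrad w x :=
  Lp.coeFn_add v.1.2 w.1.2

theorem sobGrad_sub (v w : W1 U p) :
    sobGrad (v - w) =ᵐ[volume.restrict U] fun x => sobGrad v x - sobGrad w x :=
  Lp.coeFn_sub v.1.2 w.1.2

theorem sobGrad_smul (c : ℝ) (w : W1 U p) :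
    sobGrad (c • w) =ᵐ[volume.restrict U] fun x => c • sobGrad w x :=
  Lp.coeFn_smul c w.1.2

theorem locallyIntegrable_sobGrad (w : W1 U p) :
    LocallyIntegrable (sobGrad w) (volume.restrict U) :=
  (memLp_sobGrad w).locallyIntegrable Fact.out

theorem sobGrad_ae_eq {q : ℝ} [Fact (1 < q)] (hU : IsOpen U) (v : W1 U p) (w : W1 U q)
    (h : sobFun v =ᵐ[volume.restrict U] sobFun w) :
    sobGrad v =ᵐ[volume.restrict U] sobGrad w :=
  (isWeakGradient_sobGrad v).ae_eq hU h (isWeakGradient_sobGrad w)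
    (locallyIntegrable_sobGrad v) (locallyIntegrable_sobGrad w)

theorem W1.ext_of_ae (hU : IsOpen U) {v w : W1 U p}
    (h : sobFun v =ᵐ[volume.restrict U] sobFun w) : v = w :=
  Subtype.ext (Prod.ext (Lp.ext h) (Lp.ext (sobGrad_ae_eq hU v w h)))

theorem isClosed_W1 :
    IsClosed (W1 U p : Set (Lp ℝ (ENNReal.ofReal p) (volume.restrict U) ×
      Lp (Euc n) (ENNReal.ofReal p) (volume.restrict U))) := by
  have hpq := Real.HolderConjugate.conjExponent (Fact.out : 1 < p)
  set q := p.conjExponent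
  have : ENNReal.HolderConjugate (ENNReal.ofReal p) (ENNReal.ofReal q) := hpq.ennrealOfReal
  have : Fact (1 < q) := ⟨hpq.symm.lt⟩
  have hset : (W1 U p : Set (Lp ℝ (ENNReal.ofReal p) (volume.restrict U) ×
      Lp (Euc n) (ENNReal.ofReal p) (volume.restrict U))) =
      ⋂ (φ : Euc n → ℝ) (_ : ContDiff ℝ ∞ φ) (_ : HasCompactSupport φ) (_ : tsupport φ ⊆ U)
        (e : Euc n), {w | ∫ x in U, w.1 x * fderiv ℝ φ x e = - ∫ x in U, inner ℝ (w.2 x) e * φ x} := by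
    ext w
    simp only [mem_iInter]
    rfl
  rw [hset]
  refine isClosed_iInter fun φ => isClosed_iInter fun hφ => isClosed_iInter fun hc =>
    isClosed_iInter fun hs => isClosed_iInter fun e => ?_
  have hd : Continuous fun x => fderiv ℝ φ x e :=
    (hφ.continuous_fderiv (by simp)).clm_apply continuous_const
  have hdc : HasCompactSupport fun x => fderiv ℝ φ x e := hc.fderiv_apply (𝕜 := ℝ) e
  have m1 : MemLp (fun x => fderiv ℝ φ x e) (ENNReal.ofReal q) (volume.restrict U) :=
    hd.memLp_of_hasCompactSupport hdc
  have m2 : MemLp (fun x => φ x • e) (ENNReal.ofReal q) (volume.restrict U) :=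
    (hφ.continuous.smul continuous_const).memLp_of_hasCompactSupport hc.smul_right
  refine isClosed_eq ?_ (Continuous.neg ?_)
  · have := (((ContinuousLinearMap.mul ℝ ℝ).lpPairing (volume.restrict U) (ENNReal.ofReal p)
      (ENNReal.ofReal q)).flip (m1.toLp _)).continuous.comp
      (continuous_fst (X := Lp ℝ (ENNReal.ofReal p) (volume.restrict U))
        (Y := Lp (Euc n) (ENNReal.ofReal p) (volume.restrict U)))
    refine this.congr fun w => ?_
    simp only [Function.comp, ContinuousLinearMap.flip_apply,
      ContinuousLinearMap.lpPairing_eq_integral]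
    refine integral_congr_ae ?_
    filter_upwards [m1.coeFn_toLp] with x hx
    simp [hx]
  · have := (((innerSL ℝ (E := Euc n)).lpPairing (volume.restrict U) (ENNReal.ofReal p)
      (ENNReal.ofReal q)).flip (m2.toLp _)).continuous.comp
      (continuous_snd (X := Lp ℝ (ENNReal.ofReal p) (volume.restrict U))
        (Y := Lp (Euc n) (ENNReal.ofReal p) (volume.restrict U)))
    refine this.congr fun w => ?_
    simp only [Function.comp, ContinuousLinearMap.flip_apply,
      ContinuousLinearMap.lpPairing_eq_integral]
    refine integral_congr_ae ?_
    filter_upwards [m2.coeFn_toLp] with x hx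
    rw [hx, innerSL_apply_apply, real_inner_smul_right, mul_comm]

instance completeSpace_W1 : CompleteSpace (W1 U p) :=
  isClosed_W1.completeSpace_coe

theorem continuous_gradient {φ : Euc n → ℝ} (hφ : ContDiff ℝ 1 φ) : Continuous (gradient φ) :=
  (InnerProductSpace.toDual ℝ (Euc n)).symm.continuous.comp (hφ.continuous_fderiv one_ne_zero)

theorem hasCompactSupport_gradient {φ : Euc n → ℝ} (hc : HasCompactSupport φ) :
    HasCompactSupport (gradient φ) :=
  (hc.fderiv ℝ).comp_left (g := (InnerProductSpace.toDual ℝ (Euc n)).symm) (map_zero _)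

theorem gradient_eq_zero_of_notMem_tsupport {φ : Euc n → ℝ} {x : Euc n} (hx : x ∉ tsupport φ) :
    gradient φ x = 0 := by
  refine ext_inner_right ℝ fun e => ?_
  rw [inner_gradient_left, fderiv_apply_eq_zero_of_notMem_tsupport hx, inner_zero_left]

theorem isWeakGradient_gradient {φ : Euc n → ℝ} (hφ : ContDiff ℝ 1 φ) :
    IsWeakGradient univ φ (gradient φ) := by
  intro ψ hψ hc _ e
  simp only [Measure.restrict_univ, inner_gradient_left]
  have hψ1 : ContDiff ℝ 1 ψ := hψ.of_le (by simp)
  have hd : ∀ {f : Euc n → ℝ}, ContDiff ℝ 1 f → Continuous fun x => fderiv ℝ f x e := fun hf =>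
    (hf.continuous_fderiv one_ne_zero).clm_apply continuous_const
  refine integral_mul_fderiv_eq_neg_fderiv_mul_of_integrable ?_ ?_ ?_
    (fun x _ => hφ.differentiable one_ne_zero x) (fun x _ => hψ1.differentiable one_ne_zero x)
  · exact ((hd hφ).mul hψ.continuous).integrable_of_hasCompactSupport hc.mul_left
  · exact (hφ.continuous.mul (hd hψ1)).integrable_of_hasCompactSupport
      (hc.fderiv_apply (𝕜 := ℝ) e).mul_left
  · exact (hφ.continuous.mul hψ.continuous).integrable_of_hasCompactSupport hc.mul_left

/-- The restriction to `U` of a compactly supported `C¹` function. -/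
noncomputable def W1.ofTest (U : Set (Euc n)) (p : ℝ) [Fact (1 < p)] {φ : Euc n → ℝ}
    (hφ : ContDiff ℝ 1 φ) (hc : HasCompactSupport φ) : W1 U p :=
  W1.of (u := φ) (G := gradient φ) (hφ.continuous.memLp_of_hasCompactSupport hc)
    ((continuous_gradient hφ).memLp_of_hasCompactSupport (hasCompactSupport_gradient hc))
    ((isWeakGradient_gradient hφ).mono (subset_univ U) MeasurableSet.univ)

theorem W1.sobFun_ofTest {φ : Euc n → ℝ} (hφ : ContDiff ℝ 1 φ) (hc : HasCompactSupport φ) :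
    sobFun (W1.ofTest U p hφ hc) =ᵐ[volume.restrict U] φ := W1.sobFun_of _ _ _

theorem W1.sobGrad_ofTest {φ : Euc n → ℝ} (hφ : ContDiff ℝ 1 φ) (hc : HasCompactSupport φ) :
    sobGrad (W1.ofTest U p hφ hc) =ᵐ[volume.restrict U] gradient φ := W1.sobGrad_of _ _ _

/-- The subspace of `W^{1,p}(U)` of the restrictions of functions in `C^1_c(Ω)`. -/
def testSubmodule (U Ω : Set (Euc n)) (p : ℝ) [Fact (1 < p)] : Submodule ℝ (W1 U p) where
  carrier := {w | ∃ φ : Euc n → ℝ, ContDiff ℝ 1 φ ∧ HasCompactSupport φ ∧ tsupport φ ⊆ Ω ∧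
    sobFun w =ᵐ[volume.restrict U] φ}
  zero_mem' := ⟨0, contDiff_const, HasCompactSupport.zero, by simp [tsupport],
    Lp.coeFn_zero ℝ (ENNReal.ofReal p) (volume.restrict U)⟩
  add_mem' := by
    rintro v w ⟨φ, h1, h2, h3, h4⟩ ⟨ψ, k1, k2, k3, k4⟩
    refine ⟨φ + ψ, h1.add k1, h2.add k2, (tsupport_add φ ψ).trans (union_subset h3 k3), ?_⟩
    filter_upwards [sobFun_add v w, h4, k4] with x hx hx1 hx2
    rw [hx, hx1, hx2, Pi.add_apply]
  smul_mem' := by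
    rintro c w ⟨φ, h1, h2, h3, h4⟩
    refine ⟨fun x => c * φ x, contDiff_const.mul h1, h2.mul_left,
      (closure_mono (Function.support_mul_subset_right _ _)).trans h3, ?_⟩
    filter_upwards [sobFun_smul c w, h4] with x hx hx1
    rw [hx, hx1]

theorem add_mem_vanishingOn {Ω : Set (Euc n)} {v w : W1 U p} (hv : v ∈ vanishingOn U Ω p)
    (hw : w ∈ vanishingOn U Ω p) : v + w ∈ vanishingOn U Ω p :=
  (testSubmodule U Ω p).topologicalClosure.add_mem hv hw

theorem sub_mem_vanishingOn {Ω : Set (Euc n)} {v w : W1 U p} (hv : v ∈ vanishingOn U Ω p)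
    (hw : w ∈ vanishingOn U Ω p) : v - w ∈ vanishingOn U Ω p :=
  (testSubmodule U Ω p).topologicalClosure.sub_mem hv hw

theorem smul_mem_vanishingOn {Ω : Set (Euc n)} {w : W1 U p} (c : ℝ)
    (hw : w ∈ vanishingOn U Ω p) : c • w ∈ vanishingOn U Ω p :=
  (testSubmodule U Ω p).topologicalClosure.smul_mem c hw

theorem zero_mem_vanishingOn {Ω : Set (Euc n)} : (0 : W1 U p) ∈ vanishingOn U Ω p :=
  (testSubmodule U Ω p).topologicalClosure.zero_mem

theorem isClosed_vanishingOn {Ω : Set (Euc n)} : IsClosed (vanishingOn U Ω p) := isClosed_closure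

theorem ofTest_mem_vanishingOn {Ω : Set (Euc n)} {φ : Euc n → ℝ} (hφ : ContDiff ℝ 1 φ)
    (hc : HasCompactSupport φ) (hs : tsupport φ ⊆ Ω) :
    W1.ofTest U p hφ hc ∈ vanishingOn U Ω p :=
  subset_closure ⟨φ, hφ, hc, hs, W1.sobFun_ofTest hφ hc⟩

/-- Elements of `vanishingOn U Ω p` are approximated by restrictions of functions in
`C^1_c(Ω)`. -/
theorem exists_test_dist_lt {Ω : Set (Euc n)} (hU : IsOpen U) {w : W1 U p}
    (hw : w ∈ vanishingOn U Ω p) {ε : ℝ} (hε : 0 < ε) :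
    ∃ (φ : Euc n → ℝ) (hφ : ContDiff ℝ 1 φ) (hc : HasCompactSupport φ), tsupport φ ⊆ Ω ∧
      dist w (W1.ofTest U p hφ hc) < ε := by
  obtain ⟨v, ⟨φ, hφ, hc, hs, hv⟩, hd⟩ := Metric.mem_closure_iff.1 hw ε hε
  refine ⟨φ, hφ, hc, hs, ?_⟩
  rwa [← W1.ext_of_ae hU (hv.trans (W1.sobFun_ofTest hφ hc).symm)]

theorem norm_W1 (w : W1 U p) : ‖w‖ = max ‖w.1.1‖ ‖w.1.2‖ := rfl

theorem eLpNorm_sobFun_le (w : W1 U p) :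
    eLpNorm (sobFun w) (ENNReal.ofReal p) (volume.restrict U) ≤ ENNReal.ofReal ‖w‖ := by
  rw [norm_W1, ← ENNReal.ofReal_toReal (memLp_sobFun w).2.ne]
  exact ENNReal.ofReal_le_ofReal (le_max_left _ _)

theorem eLpNorm_sobGrad_le (w : W1 U p) :
    eLpNorm (sobGrad w) (ENNReal.ofReal p) (volume.restrict U) ≤ ENNReal.ofReal ‖w‖ := by
  rw [norm_W1, ← ENNReal.ofReal_toReal (memLp_sobGrad w).2.ne]
  exact ENNReal.ofReal_le_ofReal (le_max_right _ _)

theorem norm_W1_lt {w : W1 U p} {ε : ℝ}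
    (h1 : eLpNorm (sobFun w) (ENNReal.ofReal p) (volume.restrict U) < ENNReal.ofReal ε)
    (h2 : eLpNorm (sobGrad w) (ENNReal.ofReal p) (volume.restrict U) < ENNReal.ofReal ε) :
    ‖w‖ < ε := by
  rw [norm_W1]
  refine max_lt ?_ ?_
  · rw [Lp.norm_def]
    exact (ENNReal.lt_ofReal_iff_toReal_lt h1.ne_top).1 h1
  · rw [Lp.norm_def]
    exact (ENNReal.lt_ofReal_iff_toReal_lt h2.ne_top).1 h2

end SobolevBasics

section LineBounds

variable {n : ℕ} {Ω : Set (Euc n)} {w : Euc n → ℝ} {G : Euc n → Euc n}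

/-- Jensen's inequality for powers on a probability space. -/
theorem rpow_lintegral_le_lintegral_rpow {α : Type*} [MeasurableSpace α] {μ : Measure α}
    [IsProbabilityMeasure μ] {p : ℝ} (hp : 1 < p) {f : α → ℝ≥0∞} (hf : AEMeasurable f μ) :
    (∫⁻ a, f a ∂μ) ^ p ≤ ∫⁻ a, f a ^ p ∂μ := by
  have h := ENNReal.lintegral_mul_le_Lp_mul_Lq μ (Real.HolderConjugate.conjExponent hp) hf
    (aemeasurable_const (b := (1 : ℝ≥0∞)))
  simp only [Pi.mul_apply, mul_one, ENNReal.one_rpow, lintegral_one, measure_univ] at h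
  calc (∫⁻ a, f a ∂μ) ^ p ≤ ((∫⁻ a, f a ^ p ∂μ) ^ (1 / p)) ^ p := by gcongr
    _ = ∫⁻ a, f a ^ p ∂μ := by
      rw [← ENNReal.rpow_mul, one_div_mul_cancel (by linarith), ENNReal.rpow_one]

instance isProbabilityMeasure_restrict_Ioc :
    IsProbabilityMeasure (volume.restrict (Ioc (0 : ℝ) 1)) := ⟨by simp⟩

/-- The increments of `w` are bounded by the integral of `G` along segments. -/
def LineBound (w : Euc n → ℝ) (G : Euc n → Euc n) : Prop :=
  ∀ h : Euc n, ∀ᵐ x, ‖w (x + h) - w x‖ₑ ≤ ‖h‖ₑ * ∫⁻ t in Ioc (0 : ℝ) 1, ‖G (x + t • h)‖ₑ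

theorem enorm_sub_le_lintegral_gradient {φ : Euc n → ℝ} (hφ : ContDiff ℝ 1 φ) (x h : Euc n) :
    ‖φ (x + h) - φ x‖ₑ ≤ ‖h‖ₑ * ∫⁻ t in Ioc (0 : ℝ) 1, ‖gradient φ (x + t • h)‖ₑ := by
  have hc : Continuous fun t : ℝ => fderiv ℝ φ (x + t • h) h :=
    ((hφ.continuous_fderiv one_ne_zero).comp (by fun_prop)).clm_apply continuous_const
  have h1 : ∫ t in (0 : ℝ)..1, fderiv ℝ φ (x + t • h) h = φ (x + h) - φ x := by
    have hd : ∀ t ∈ uIcc (0 : ℝ) 1,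
        HasDerivAt (fun t : ℝ => φ (x + t • h)) (fderiv ℝ φ (x + t • h) h) t := by
      intro t _
      have hl : HasDerivAt (fun t : ℝ => x + t • h) h t := by
        simpa using ((hasDerivAt_id t).smul_const h).const_add x
      exact ((hφ.differentiable one_ne_zero (x + t • h)).hasFDerivAt).comp_hasDerivAt t hl
    have := intervalIntegral.integral_eq_sub_of_hasDerivAt hd (hc.intervalIntegrable 0 1)
    simpa using this
  rw [← h1, intervalIntegral.integral_of_le zero_le_one]
  refine (enorm_integral_le_lintegral_enorm _).trans ?_
  rw [← lintegral_const_mul' _ _ enorm_ne_top]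
  refine lintegral_mono fun t => ?_
  rw [← inner_gradient_left (𝕜 := ℝ), mul_comm, ← ofReal_norm, ← ofReal_norm (gradient φ _),
    ← ofReal_norm h, ← ENNReal.ofReal_mul (norm_nonneg _)]
  exact ENNReal.ofReal_le_ofReal (norm_inner_le_norm _ _)

/-- `(w, G)` is an `L¹` limit of pairs `(φ, ∇φ)` with `φ ∈ C^1_c(Ω)`. -/
def IsTestLimit (Ω : Set (Euc n)) (w : Euc n → ℝ) (G : Euc n → Euc n) : Prop :=
  ∀ ε : ℝ≥0∞, 0 < ε → ∃ φ : Euc n → ℝ, ContDiff ℝ 1 φ ∧ HasCompactSupport φ ∧ tsupport φ ⊆ Ω ∧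
    ∫⁻ x, ‖w x - φ x‖ₑ ≤ ε ∧ ∫⁻ x, ‖G x - gradient φ x‖ₑ ≤ ε

theorem ENNReal.eq_zero_of_forall_le_mul {a c : ℝ≥0∞} (hc : c ≠ ⊤)
    (h : ∀ ε : ℝ≥0∞, 0 < ε → a ≤ c * ε) : a = 0 := by
  have ht : Tendsto (fun k : ℕ => c * ((k : ℝ≥0∞))⁻¹) atTop (𝓝 (c * 0)) :=
    ENNReal.Tendsto.const_mul ENNReal.tendsto_inv_nat_nhds_zero (Or.inr hc)
  rw [mul_zero] at ht
  exact le_antisymm (ge_of_tendsto' ht fun k =>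
    h _ (ENNReal.inv_pos.2 (ENNReal.natCast_ne_top k))) bot_le

theorem measurable_lintegral_segment {f : Euc n → ℝ≥0∞} (hf : Measurable f) (h : Euc n) :
    Measurable fun x : Euc n => ∫⁻ t in Ioc (0 : ℝ) 1, f (x + t • h) :=
  Measurable.lintegral_prod_right' (f := fun z : Euc n × ℝ => f (z.1 + z.2 • h))
    (hf.comp (by fun_prop))

theorem lintegral_lintegral_segment {f : Euc n → ℝ≥0∞} (hf : Measurable f) (h : Euc n) :
    ∫⁻ x : Euc n, ∫⁻ t in Ioc (0 : ℝ) 1, f (x + t • h) = ∫⁻ x, f x := by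
  have hm : Measurable (Function.uncurry fun (x : Euc n) (t : ℝ) => f (x + t • h)) :=
    hf.comp (g := f) (f := fun z : Euc n × ℝ => z.1 + z.2 • h) (by fun_prop)
  rw [lintegral_lintegral_swap hm.aemeasurable]
  simp only [lintegral_add_right_eq_self]
  simp

theorem IsTestLimit.lineBound (hw : Measurable w) (hG : Measurable G) (hlim : IsTestLimit Ω w G) :
    LineBound w G := by
  intro h
  set D : Euc n → ℝ≥0∞ := fun x =>
    ‖w (x + h) - w x‖ₑ - ‖h‖ₑ * ∫⁻ t in Ioc (0 : ℝ) 1, ‖G (x + t • h)‖ₑ with hD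
  have hDm : Measurable D :=
    (((hw.comp (measurable_add_const h)).sub hw).enorm).sub
      ((measurable_lintegral_segment hG.enorm h).const_mul _)
  have hint : ∫⁻ x, D x = 0 := by
    refine ENNReal.eq_zero_of_forall_le_mul (c := 2 + ‖h‖ₑ) (by finiteness) fun ε hε => ?_
    obtain ⟨φ, hφ, -, -, h1, h2⟩ := hlim ε hε
    have m1 : Measurable fun x => ‖w x - φ x‖ₑ := (hw.sub hφ.continuous.measurable).enorm
    have m2 : Measurable fun x => ‖G x - gradient φ x‖ₑ :=
      (hG.sub (continuous_gradient hφ).measurable).enorm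
    have hb : ∀ x, D x ≤ (‖w (x + h) - φ (x + h)‖ₑ + ‖w x - φ x‖ₑ) +
        ‖h‖ₑ * ∫⁻ t in Ioc (0 : ℝ) 1, ‖G (x + t • h) - gradient φ (x + t • h)‖ₑ := by
      intro x
      rw [hD]
      refine tsub_le_iff_right.2 ?_
      have e1 : w (x + h) - w x =
          ((w (x + h) - φ (x + h)) - (w x - φ x)) + (φ (x + h) - φ x) := by ring
      have e2 : ∫⁻ t in Ioc (0 : ℝ) 1, ‖gradient φ (x + t • h)‖ₑ ≤
          (∫⁻ t in Ioc (0 : ℝ) 1, ‖G (x + t • h) - gradient φ (x + t • h)‖ₑ) +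
            ∫⁻ t in Ioc (0 : ℝ) 1, ‖G (x + t • h)‖ₑ := by
        have m3 : Measurable fun t : ℝ => ‖G (x + t • h) - gradient φ (x + t • h)‖ₑ :=
          m2.comp (f := fun t : ℝ => x + t • h) (by fun_prop)
        rw [← lintegral_add_left m3]
        refine lintegral_mono fun t => ?_
        have : gradient φ (x + t • h) =
            -(G (x + t • h) - gradient φ (x + t • h)) + G (x + t • h) := by abel
        calc ‖gradient φ (x + t • h)‖ₑ = _ := congrArg _ this
          _ ≤ _ := enorm_add_le _ _
          _ = _ := by rw [enorm_neg]
      calc ‖w (x + h) - w x‖ₑ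
          ≤ ‖(w (x + h) - φ (x + h)) - (w x - φ x)‖ₑ + ‖φ (x + h) - φ x‖ₑ := by
            rw [e1]; exact enorm_add_le _ _
        _ ≤ (‖w (x + h) - φ (x + h)‖ₑ + ‖w x - φ x‖ₑ) +
            ‖h‖ₑ * ∫⁻ t in Ioc (0 : ℝ) 1, ‖gradient φ (x + t • h)‖ₑ :=
            add_le_add enorm_sub_le (enorm_sub_le_lintegral_gradient hφ x h)
        _ ≤ _ := by
            rw [add_assoc _ (‖h‖ₑ * _), ← mul_add]
            gcongr
    calc ∫⁻ x, D x ≤ _ := lintegral_mono hb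
      _ = (∫⁻ x, ‖w x - φ x‖ₑ) + (∫⁻ x, ‖w x - φ x‖ₑ) +
          ‖h‖ₑ * ∫⁻ x, ‖G x - gradient φ x‖ₑ := by
        have m4 : Measurable fun x => ‖w (x + h) - φ (x + h)‖ₑ :=
          m1.comp (measurable_add_const h)
        have m5 : Measurable fun x => ‖w (x + h) - φ (x + h)‖ₑ + ‖w x - φ x‖ₑ := m4.add m1
        rw [lintegral_add_left m5, lintegral_add_right _ m1, lintegral_add_right_eq_self (fun x => ‖w x - φ x‖ₑ) h,
          lintegral_const_mul' _ _ enorm_ne_top, lintegral_lintegral_segment m2]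
      _ ≤ ε + ε + ‖h‖ₑ * ε := by gcongr
      _ = (2 + ‖h‖ₑ) * ε := by ring
  filter_upwards [(lintegral_eq_zero_iff hDm).1 hint] with x hx
  exact tsub_eq_zero_iff_le.1 hx

theorem IsTestLimit.isWeakGradient (hw : Integrable w) (hG : Integrable G)
    (hlim : IsTestLimit Ω w G) : IsWeakGradient univ w G := by
  intro ψ hψ hc hs e
  simp only [Measure.restrict_univ]
  have hd : Continuous fun x => fderiv ℝ ψ x e :=
    (hψ.continuous_fderiv (by simp)).clm_apply continuous_const
  obtain ⟨M, hM⟩ := hd.bounded_above_of_compact_support (hc.fderiv_apply (𝕜 := ℝ) e)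
  obtain ⟨N, hN⟩ := hψ.continuous.bounded_above_of_compact_support hc
  have iw : ∀ {v : Euc n → ℝ}, Integrable v → Integrable fun x => v x * fderiv ℝ ψ x e :=
    fun hv => hv.mul_bdd (c := M) hd.aestronglyMeasurable (Eventually.of_forall hM)
  have iG : ∀ {F : Euc n → Euc n}, Integrable F → Integrable fun x => inner ℝ (F x) e * ψ x :=
    fun hF => (hF.inner_const e).mul_bdd (c := N) hψ.continuous.aestronglyMeasurable
      (Eventually.of_forall hN)
  rw [← add_eq_zero_iff_eq_neg, ← enorm_eq_zero]
  refine ENNReal.eq_zero_of_forall_le_mul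
    (c := ENNReal.ofReal M + ‖e‖ₑ * ENNReal.ofReal N) (by finiteness) fun ε hε => ?_
  obtain ⟨φ, hφ, hφc, -, h1, h2⟩ := hlim ε hε
  have hφi := hφ.continuous.integrable_of_hasCompactSupport (μ := volume) hφc
  have hgi := (continuous_gradient hφ).integrable_of_hasCompactSupport (μ := volume)
    (hasCompactSupport_gradient hφc)
  have hφw := isWeakGradient_gradient hφ ψ hψ hc hs e
  simp only [Measure.restrict_univ] at hφw
  have e1 : (∫ x, w x * fderiv ℝ ψ x e) + ∫ x, inner ℝ (G x) e * ψ x =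
      (∫ x, (w x - φ x) * fderiv ℝ ψ x e) + ∫ x, inner ℝ (G x - gradient φ x) e * ψ x := by
    simp only [sub_mul, inner_sub_left]
    rw [integral_sub (iw hw) (iw hφi), integral_sub (iG hG) (iG hgi), hφw]
    ring
  have b1 : ‖∫ x, (w x - φ x) * fderiv ℝ ψ x e‖ₑ ≤ ENNReal.ofReal M * ε := by
    refine (enorm_integral_le_lintegral_enorm _).trans ?_
    calc _ ≤ ∫⁻ x, ENNReal.ofReal M * ‖w x - φ x‖ₑ := lintegral_mono fun x => by
          rw [enorm_mul, mul_comm, ← ofReal_norm (fderiv ℝ ψ x e)]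
          gcongr
          exact hM x
      _ ≤ _ := by rw [lintegral_const_mul' _ _ (by finiteness)]; gcongr
  have b2 : ‖∫ x, inner ℝ (G x - gradient φ x) e * ψ x‖ₑ ≤ ‖e‖ₑ * ENNReal.ofReal N * ε := by
    refine (enorm_integral_le_lintegral_enorm _).trans ?_
    calc _ ≤ ∫⁻ x, ‖e‖ₑ * ENNReal.ofReal N * ‖G x - gradient φ x‖ₑ := lintegral_mono fun x => by
          rw [enorm_mul, mul_right_comm, ← ofReal_norm (ψ x)]
          gcongr
          · rw [← ofReal_norm, ← ofReal_norm e, ← ofReal_norm (G x - _),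
              ← ENNReal.ofReal_mul (norm_nonneg _), mul_comm]
            exact ENNReal.ofReal_le_ofReal (norm_inner_le_norm _ _)
          · exact hN x
      _ ≤ _ := by rw [lintegral_const_mul' _ _ (by finiteness)]; gcongr
  rw [e1]
  calc _ ≤ _ := enorm_add_le _ _
    _ ≤ _ := add_le_add b1 b2
    _ = _ := by ring

/-- The extension by zero of a function in `W_0^{1,q}(Ω)`, `Ω` bounded, is an `L¹` limit of test
functions. -/
theorem isTestLimit_indicator {q : ℝ} [Fact (1 < q)] (hΩ : IsOpen Ω)
    (hb : Bornology.IsBounded Ω) {w : W1 Ω q} (hw : w ∈ vanishingOn Ω Ω q) :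
    IsTestLimit Ω (Ω.indicator (sobFun w)) (Ω.indicator (sobGrad w)) := by
  intro ε hε
  have hfin : volume Ω ≠ ⊤ := hb.measure_lt_top.ne
  set c : ℝ≥0∞ := (volume.restrict Ω) univ ^ (1 / (1 : ℝ≥0∞).toReal - 1 / (ENNReal.ofReal q).toReal)
  have hq : 1 < q := Fact.out
  have hc : c ≠ ⊤ := by
    refine ENNReal.rpow_ne_top_of_nonneg ?_ (by simpa using hfin)
    rw [ENNReal.toReal_one, ENNReal.toReal_ofReal (by linarith)]
    have : 1 / q ≤ 1 := by rw [div_le_one (by linarith)]; exact hq.le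
    linarith
  obtain ⟨δ, hδ, hδε⟩ : ∃ δ : ℝ, 0 < δ ∧ ENNReal.ofReal δ * c ≤ ε := by
    have ht : Tendsto (fun k : ℕ => c * ((k : ℝ≥0∞))⁻¹) atTop (𝓝 (c * 0)) :=
      ENNReal.Tendsto.const_mul ENNReal.tendsto_inv_nat_nhds_zero (Or.inr hc)
    rw [mul_zero] at ht
    obtain ⟨k, hk, hk1⟩ := ((ht.eventually (gt_mem_nhds hε)).and (eventually_ge_atTop 1)).exists
    have hkpos : (0 : ℝ) < k := by exact_mod_cast hk1
    refine ⟨(k : ℝ)⁻¹, inv_pos.2 hkpos, ?_⟩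
    rw [ENNReal.ofReal_inv_of_pos hkpos, ENNReal.ofReal_natCast, mul_comm]
    exact hk.le
  obtain ⟨φ, hφ, hφc, hφs, hd⟩ := exists_test_dist_lt hΩ hw hδ
  refine ⟨φ, hφ, hφc, hφs, ?_, ?_⟩
  · have h1 : ∀ x, ‖Ω.indicator (sobFun w) x - φ x‖ₑ = Ω.indicator (fun x => ‖sobFun w x - φ x‖ₑ) x := by
      intro x
      by_cases hx : x ∈ Ω
      · simp [hx]
      · simp [hx, image_eq_zero_of_notMem_tsupport (fun h => hx (hφs h))]
    simp only [h1]
    rw [lintegral_indicator hΩ.measurableSet]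
    calc ∫⁻ x in Ω, ‖sobFun w x - φ x‖ₑ
        = eLpNorm (sobFun (w - W1.ofTest Ω q hφ hφc)) 1 (volume.restrict Ω) := by
          rw [eLpNorm_one_eq_lintegral_enorm]
          refine lintegral_congr_ae ?_
          filter_upwards [sobFun_sub w (W1.ofTest Ω q hφ hφc), W1.sobFun_ofTest (p := q) hφ hφc]
            with x hx hx1
          rw [hx, hx1]
      _ ≤ _ := eLpNorm_le_eLpNorm_mul_rpow_measure_univ (q := ENNReal.ofReal q) Fact.out
          (memLp_sobFun _).1
      _ ≤ ENNReal.ofReal δ * c := by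
          gcongr
          refine (eLpNorm_sobFun_le _).trans (ENNReal.ofReal_le_ofReal ?_)
          rw [← dist_eq_norm]
          exact hd.le
      _ ≤ ε := hδε
  · have h1 : ∀ x, ‖Ω.indicator (sobGrad w) x - gradient φ x‖ₑ =
        Ω.indicator (fun x => ‖sobGrad w x - gradient φ x‖ₑ) x := by
      intro x
      by_cases hx : x ∈ Ω
      · simp [hx]
      · simp [hx, gradient_eq_zero_of_notMem_tsupport (fun h => hx (hφs h))]
    simp only [h1]
    rw [lintegral_indicator hΩ.measurableSet]
    calc ∫⁻ x in Ω, ‖sobGrad w x - gradient φ x‖ₑ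
        = eLpNorm (sobGrad (w - W1.ofTest Ω q hφ hφc)) 1 (volume.restrict Ω) := by
          rw [eLpNorm_one_eq_lintegral_enorm]
          refine lintegral_congr_ae ?_
          filter_upwards [sobGrad_sub w (W1.ofTest Ω q hφ hφc), W1.sobGrad_ofTest (p := q) hφ hφc]
            with x hx hx1
          rw [hx, hx1]
      _ ≤ _ := eLpNorm_le_eLpNorm_mul_rpow_measure_univ (q := ENNReal.ofReal q) Fact.out
          (memLp_sobGrad _).1
      _ ≤ ENNReal.ofReal δ * c := by
          gcongr
          refine (eLpNorm_sobGrad_le _).trans (ENNReal.ofReal_le_ofReal ?_)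
          rw [← dist_eq_norm]
          exact hd.le
      _ ≤ ε := hδε

end LineBounds

section LipschitzShift

variable {n : ℕ} {Ω A U : Set (Euc n)}

/-- Near a point of the boundary of a Lipschitz set, a quantitative translation maps the complement
of the set into the complement of its closure. -/
theorem HasLipschitzBoundary.exists_shift (hU : HasLipschitzBoundary U) {x₀ : Euc n}
    (hx₀ : x₀ ∈ frontier U) :
    ∃ (e : Euc n) (r κ : ℝ), ‖e‖ ≤ 1 ∧ 0 < r ∧ 0 < κ ∧ κ ≤ 1 ∧
      ∀ x ∈ Metric.ball x₀ r, ∀ s ∈ Ioo 0 r, ∀ z ∈ Metric.ball (s • e) (κ * s),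
        x ∉ U → x - z ∉ closure U := by
  obtain ⟨e, K, γ, R, he, hγ, hR, hgraph⟩ := hU x₀ hx₀
  have hK : (0 : ℝ) ≤ K := K.2
  refine ⟨e, R / 4, 1 / (2 * (1 + 2 * K)), he.le, by positivity, by positivity, ?_, ?_⟩
  · rw [div_le_one (by positivity)]; linarith
  set κ : ℝ := 1 / (2 * (1 + 2 * K)) with hκ
  have hκ1 : κ * (1 + 2 * K) = 1 / 2 := by rw [hκ]; field_simp
  have hκ0 : 0 < κ := by positivity
  intro x hx s hs z hz hxU hcl
  have hz' : ‖z - s • e‖ < κ * s := by rwa [mem_ball_iff_norm] at hz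
  have hx' : ‖x - x₀‖ < R / 4 := by rwa [mem_ball_iff_norm] at hx
  have hκ2 : κ ≤ 1 := by nlinarith
  have hzs : ‖z‖ ≤ κ * s + s := by
    calc ‖z‖ = ‖(z - s • e) + s • e‖ := by rw [sub_add_cancel]
      _ ≤ ‖z - s • e‖ + ‖s • e‖ := norm_add_le _ _
      _ ≤ κ * s + s := by
        rw [norm_smul, he, mul_one, Real.norm_of_nonneg hs.1.le]; linarith
  have hxz : x - z ∈ Metric.ball x₀ R := by
    rw [mem_ball_iff_norm]
    calc ‖x - z - x₀‖ = ‖(x - x₀) - z‖ := by congr 1; abel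
      _ ≤ ‖x - x₀‖ + ‖z‖ := norm_sub_le _ _
      _ < R := by nlinarith [hs.1, hs.2]
  have hxR : x ∈ Metric.ball x₀ R := by
    rw [mem_ball_iff_norm]; linarith
  have hxγ : inner ℝ e x ≤ γ (x - inner ℝ e x • e) := by
    by_contra hlt
    exact hxU ((hgraph x hxR).2 (not_le.1 hlt))
  -- the complement of the closed epigraph is open
  set g : Euc n → ℝ := fun y => γ (y - inner ℝ e y • e) - inner ℝ e y with hg
  have hgc : Continuous g := by
    have := hγ.continuous
    fun_prop
  have hgz : 0 < g (x - z) := by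
    have hee : inner ℝ e e = (1 : ℝ) := by rw [real_inner_self_eq_norm_sq, he]; norm_num
    have hin : |inner ℝ e (z - s • e)| < κ * s := by
      calc |inner ℝ e (z - s • e)| ≤ ‖e‖ * ‖z - s • e‖ := abs_real_inner_le_norm _ _
        _ < κ * s := by rw [he, one_mul]; exact hz'
    have hez : inner ℝ e z = s + inner ℝ e (z - s • e) := by
      rw [inner_sub_right, real_inner_smul_right, hee]; ring
    have hlip : |γ (x - inner ℝ e x • e) - γ (x - z - inner ℝ e (x - z) • e)| ≤
        K * (2 * (κ * s)) := by
      have h1 := hγ.dist_le_mul (x - inner ℝ e x • e) (x - z - inner ℝ e (x - z) • e)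
      rw [Real.dist_eq, dist_eq_norm] at h1
      refine h1.trans (mul_le_mul_of_nonneg_left ?_ hK)
      have h2 : x - inner ℝ e x • e - (x - z - inner ℝ e (x - z) • e) =
          (z - s • e) - inner ℝ e (z - s • e) • e := by
        simp only [inner_sub_right, real_inner_smul_right, hee, sub_smul, mul_one]; abel
      rw [h2]
      calc _ ≤ ‖z - s • e‖ + ‖inner ℝ e (z - s • e) • e‖ := norm_sub_le _ _
        _ ≤ _ := by
          rw [norm_smul, he, mul_one, Real.norm_eq_abs]; linarith
    have h3 := (abs_le.1 hlip).2
    have h4 := (abs_lt.1 hin).1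
    have h5 : κ * s * (1 + 2 * K) = s / 2 := by rw [mul_right_comm, hκ1]; ring
    simp only [hg]
    rw [inner_sub_right (𝕜 := ℝ) e x z, hez] at *
    nlinarith [hs.1]
  have hopen : IsOpen (Metric.ball x₀ R ∩ {y | 0 < g y}) :=
    Metric.isOpen_ball.inter (isOpen_lt continuous_const hgc)
  obtain ⟨y, hy1, hy2⟩ := mem_closure_iff.1 hcl _ hopen ⟨hxz, hgz⟩
  have h6 := (hgraph y hy1.1).1 hy2
  have h7 : 0 < γ (y - inner ℝ e y • e) - inner ℝ e y := hy1.2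
  linarith

/-- In the admissible geometry, near every point outside `A` a quantitative translation moves the
complements of `A` and of `Ω` off the closures of these sets. -/
theorem IsAdmissibleGeometry.exists_shift (h : IsAdmissibleGeometry Ω A) {x₀ : Euc n}
    (hx₀ : x₀ ∉ A) :
    ∃ (e : Euc n) (r κ : ℝ), ‖e‖ ≤ 1 ∧ 0 < r ∧ 0 < κ ∧ κ ≤ 1 ∧
      ∀ x ∈ Metric.ball x₀ r, ∀ s ∈ Ioo 0 r, ∀ z ∈ Metric.ball (s • e) (κ * s),
        (x ∉ A → x - z ∉ closure A) ∧ (x ∉ Ω → x - z ∉ closure Ω) := by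
  have hball : ∀ {V : Set (Euc n)} {e : Euc n} {r κ : ℝ}, IsOpen V → x₀ ∈ V → ‖e‖ ≤ 1 → κ ≤ 1 →
      ∃ ρ : ℝ, 0 < ρ ∧ Metric.ball x₀ ρ ⊆ V ∧ ∀ x ∈ Metric.ball x₀ ρ, ∀ s ∈ Ioo 0 ρ,
        ∀ z ∈ Metric.ball (s • e) (κ * s), x - z ∈ V := by
    intro V e r κ hV hxV he hκ
    obtain ⟨ρ, hρ, hsub⟩ := Metric.isOpen_iff.1 hV x₀ hxV
    refine ⟨ρ / 3, by positivity, (Metric.ball_subset_ball (by linarith)).trans hsub, ?_⟩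
    intro x hx s hs z hz
    rw [mem_ball_iff_norm] at hx hz
    refine hsub (mem_ball_iff_norm.2 ?_)
    have h1 : ‖z‖ ≤ ‖z - s • e‖ + ‖s • e‖ := by
      simpa using norm_add_le (z - s • e) (s • e)
    have h2 : ‖s • e‖ ≤ s := by
      rw [norm_smul, Real.norm_of_nonneg hs.1.le]
      exact mul_le_of_le_one_right hs.1.le he
    have h3 : κ * s ≤ s := mul_le_of_le_one_left hs.1.le hκ
    calc ‖x - z - x₀‖ = ‖(x - x₀) - z‖ := by congr 1; abel
      _ ≤ ‖x - x₀‖ + ‖z‖ := norm_sub_le _ _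
      _ < ρ := by linarith [hs.2]
  have hAΩ : A ⊆ Ω := subset_closure.trans h.closure_subset
  by_cases hcl : x₀ ∈ closure A
  · have hfr : x₀ ∈ frontier A := by
      rw [h.isOpen_inner.frontier_eq]; exact ⟨hcl, hx₀⟩
    obtain ⟨e, r, κ, he, hr, hκ, hκ1, H⟩ := h.lipschitz_inner.exists_shift hfr
    obtain ⟨ρ, hρ, hρ1, -⟩ := hball (r := r) h.isOpen (h.closure_subset hcl) he hκ1
    refine ⟨e, min r ρ, κ, he, lt_min hr hρ, hκ, hκ1, fun x hx s hs z hz => ⟨fun hxA => ?_,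
      fun hxΩ => ?_⟩⟩
    · exact H x (Metric.ball_subset_ball (min_le_left _ _) hx) s
        ⟨hs.1, hs.2.trans_le (min_le_left _ _)⟩ z hz hxA
    · exact absurd (hρ1 (Metric.ball_subset_ball (min_le_right _ _) hx)) hxΩ
  · by_cases hfr : x₀ ∈ frontier Ω
    · obtain ⟨e, r, κ, he, hr, hκ, hκ1, H⟩ := h.lipschitz.exists_shift hfr
      obtain ⟨ρ, hρ, -, hρ1⟩ := hball (r := r) (isClosed_closure (s := A)).isOpen_compl hcl he hκ1
      refine ⟨e, min r ρ, κ, he, lt_min hr hρ, hκ, hκ1, fun x hx s hs z hz => ⟨fun hxA => ?_,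
        fun hxΩ => ?_⟩⟩
      · exact hρ1 x (Metric.ball_subset_ball (min_le_right _ _) hx) s
          ⟨hs.1, hs.2.trans_le (min_le_right _ _)⟩ z hz
      · exact H x (Metric.ball_subset_ball (min_le_left _ _) hx) s
          ⟨hs.1, hs.2.trans_le (min_le_left _ _)⟩ z hz hxΩ
    · obtain ⟨ρ, hρ, -, hρ1⟩ := hball (r := 1) (e := 0) (κ := 1)
        (isClosed_closure (s := A)).isOpen_compl hcl (by simp) le_rfl
      have hV : IsOpen (Ω ∪ (closure Ω)ᶜ) := h.isOpen.union isClosed_closure.isOpen_compl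
      have hxV : x₀ ∈ Ω ∪ (closure Ω)ᶜ := by
        by_contra hc
        rw [mem_union, not_or, mem_compl_iff, not_not] at hc
        exact hfr (by rw [h.isOpen.frontier_eq]; exact ⟨hc.2, hc.1⟩)
      rcases hxV with hxV | hxV
      · obtain ⟨ρ', hρ', hρ2, -⟩ := hball (r := 1) (e := 0) (κ := 1) h.isOpen hxV (by simp) le_rfl
        refine ⟨0, min ρ ρ', 1, by simp, lt_min hρ hρ', one_pos, le_rfl,
          fun x hx s hs z hz => ⟨fun _ => ?_, fun hxΩ => ?_⟩⟩
        · exact hρ1 x (Metric.ball_subset_ball (min_le_left _ _) hx) s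
            ⟨hs.1, hs.2.trans_le (min_le_left _ _)⟩ z hz
        · exact absurd (hρ2 (Metric.ball_subset_ball (min_le_right _ _) hx)) hxΩ
      · obtain ⟨ρ', hρ', -, hρ2⟩ := hball (r := 1) (e := 0) (κ := 1)
          (isClosed_closure (s := Ω)).isOpen_compl hxV (by simp) le_rfl
        refine ⟨0, min ρ ρ', 1, by simp, lt_min hρ hρ', one_pos, le_rfl,
          fun x hx s hs z hz => ⟨fun _ => ?_, fun _ => ?_⟩⟩
        · exact hρ1 x (Metric.ball_subset_ball (min_le_left _ _) hx) s
            ⟨hs.1, hs.2.trans_le (min_le_left _ _)⟩ z hz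
        · exact hρ2 x (Metric.ball_subset_ball (min_le_right _ _) hx) s
            ⟨hs.1, hs.2.trans_le (min_le_right _ _)⟩ z hz

end LipschitzShift

section Poincare

variable {n : ℕ} {Ω A D S T : Set (Euc n)} {p : ℝ}

theorem lintegral_rpow_le_of_lineBound (hp : 1 < p) {w : Euc n → ℝ} {G : Euc n → Euc n}
    (hw : Measurable w) (hG : Measurable G) (hl : LineBound w G) {K : Set (Euc n)}
    (hK : MeasurableSet K) (hD : MeasurableSet D) {h : Euc n}
    (hKD : ∀ x ∈ K, ∀ t ∈ Ioc (0 : ℝ) 1, x + t • h ∈ D) :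
    ∫⁻ x in K, ‖w x‖ₑ ^ p ≤ 2 ^ (p - 1) * ((∫⁻ x in K, ‖w (x + h)‖ₑ ^ p) +
      ‖h‖ₑ ^ p * ∫⁻ x in D, ‖G x‖ₑ ^ p) := by
  have hp0 : 0 ≤ p := by linarith
  set F : Euc n → ℝ≥0∞ := D.indicator fun x => ‖G x‖ₑ ^ p with hF
  have hFm : Measurable F := (hG.enorm.pow_const p).indicator hD
  have hb : ∀ᵐ x ∂(volume.restrict K), ‖w x‖ₑ ^ p ≤ 2 ^ (p - 1) * (‖w (x + h)‖ₑ ^ p +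
      ‖h‖ₑ ^ p * ∫⁻ t in Ioc (0 : ℝ) 1, F (x + t • h)) := by
    filter_upwards [ae_restrict_of_ae (hl h), ae_restrict_mem hK] with x hx hxK
    set I := ∫⁻ t in Ioc (0 : ℝ) 1, ‖G (x + t • h)‖ₑ
    have hI : I ^ p ≤ ∫⁻ t in Ioc (0 : ℝ) 1, F (x + t • h) := by
      have hm : Measurable fun t : ℝ => ‖G (x + t • h)‖ₑ :=
        hG.enorm.comp (f := fun t : ℝ => x + t • h) (by fun_prop)
      refine (rpow_lintegral_le_lintegral_rpow hp hm.aemeasurable).trans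
        (setLIntegral_mono' measurableSet_Ioc fun t ht => ?_)
      rw [hF, indicator_of_mem (hKD x hxK t ht)]
    have h1 : ‖w x‖ₑ ≤ ‖w (x + h)‖ₑ + ‖h‖ₑ * I := by
      calc ‖w x‖ₑ = ‖w (x + h) - (w (x + h) - w x)‖ₑ := by rw [sub_sub_cancel]
        _ ≤ _ := enorm_sub_le
        _ ≤ _ := by gcongr
    calc ‖w x‖ₑ ^ p ≤ (‖w (x + h)‖ₑ + ‖h‖ₑ * I) ^ p := by gcongr
      _ ≤ _ := ENNReal.rpow_add_le_mul_rpow_add_rpow _ _ hp.le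
      _ ≤ _ := by rw [ENNReal.mul_rpow_of_nonneg _ _ hp0]; gcongr
  have hm1 : Measurable fun x => ‖w (x + h)‖ₑ ^ p :=
    (hw.enorm.pow_const p).comp (measurable_add_const h)
  have hm2 : Measurable fun x => ‖h‖ₑ ^ p * ∫⁻ t in Ioc (0 : ℝ) 1, F (x + t • h) :=
    (measurable_lintegral_segment hFm h).const_mul _
  refine (lintegral_mono_ae hb).trans ?_
  rw [lintegral_const_mul' _ _ (by finiteness), lintegral_add_left hm1,
    lintegral_const_mul _ (measurable_lintegral_segment hFm h)]
  refine mul_le_mul' le_rfl (add_le_add le_rfl (mul_le_mul' le_rfl ?_))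
  calc ∫⁻ x in K, ∫⁻ t in Ioc (0 : ℝ) 1, F (x + t • h)
      ≤ ∫⁻ x, ∫⁻ t in Ioc (0 : ℝ) 1, F (x + t • h) := setLIntegral_le_lintegral _ _
    _ = ∫⁻ x, F x := lintegral_lintegral_segment hFm h
    _ = _ := lintegral_indicator hD _

/-- A Poincaré inequality on `S ∩ D`, with the gradient taken on `D`, for functions that vanish
outside `Ω`. -/
def LocalPoincare (Ω D : Set (Euc n)) (p : ℝ) (S : Set (Euc n)) : Prop :=
  ∃ C : ℝ≥0, ∀ (w : Euc n → ℝ) (G : Euc n → Euc n), Measurable w → Measurable G →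
    (∀ x ∉ Ω, w x = 0) → LineBound w G →
      ∫⁻ x in S ∩ D, ‖w x‖ₑ ^ p ≤ C * ∫⁻ x in D, ‖G x‖ₑ ^ p

theorem LocalPoincare.mono (hST : S ⊆ T) (h : LocalPoincare Ω D p T) : LocalPoincare Ω D p S := by
  obtain ⟨C, hC⟩ := h
  exact ⟨C, fun w G hw hG h0 hl => (lintegral_mono_set (inter_subset_inter_left D hST)).trans
    (hC w G hw hG h0 hl)⟩

theorem LocalPoincare.union (hS : LocalPoincare Ω D p S) (hT : LocalPoincare Ω D p T) :
    LocalPoincare Ω D p (S ∪ T) := by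
  obtain ⟨C, hC⟩ := hS
  obtain ⟨C', hC'⟩ := hT
  refine ⟨C + C', fun w G hw hG h0 hl => ?_⟩
  rw [union_inter_distrib_right, ENNReal.coe_add, add_mul]
  exact (lintegral_union_le _ _ _).trans
    (add_le_add (hC w G hw hG h0 hl) (hC' w G hw hG h0 hl))

theorem LocalPoincare.of_disjoint (hp : 0 < p) (hS : S ⊆ Ωᶜ) (hSD : MeasurableSet (S ∩ D)) :
    LocalPoincare Ω D p S := by
  refine ⟨0, fun w G hw hG h0 hl => ?_⟩
  rw [setLIntegral_congr_fun (g := fun _ => 0) hSD fun x hx => by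
    simp [h0 x (hS hx.1), hp]]
  simp

theorem LocalPoincare.of_shift (hp : 1 < p) (hS : MeasurableSet S) (hT : MeasurableSet T)
    (hD : MeasurableSet D) (h : Euc n) (hseg : ∀ x ∈ S ∩ D, ∀ t ∈ Ioc (0 : ℝ) 1, x + t • h ∈ D)
    (hmap : ∀ x ∈ S ∩ D, x + h ∈ T) (hP : LocalPoincare Ω D p T) : LocalPoincare Ω D p S := by
  obtain ⟨C, hC⟩ := hP
  refine ⟨(2 : ℝ≥0) ^ (p - 1) * (C + ‖h‖₊ ^ p), fun w G hw hG h0 hl => ?_⟩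
  refine (lintegral_rpow_le_of_lineBound hp hw hG hl (hS.inter hD) hD hseg).trans ?_
  have h1 : ∫⁻ x in S ∩ D, ‖w (x + h)‖ₑ ^ p ≤ C * ∫⁻ x in D, ‖G x‖ₑ ^ p := by
    refine le_trans ?_ (hC w G hw hG h0 hl)
    rw [← lintegral_indicator (hT.inter hD), ← lintegral_indicator (hS.inter hD),
      ← lintegral_add_right_eq_self ((T ∩ D).indicator _) h]
    refine lintegral_mono fun x => ?_
    by_cases hx : x ∈ S ∩ D
    · have hx1 : x + h ∈ T ∩ D := ⟨hmap x hx, by simpa using hseg x hx 1 (by simp)⟩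
      rw [indicator_of_mem hx, indicator_of_mem hx1]
    · rw [indicator_of_notMem hx]; exact zero_le
  rw [ENNReal.coe_mul, ENNReal.coe_add, ENNReal.coe_rpow_of_nonneg _ (by linarith),
    ENNReal.coe_rpow_of_nonneg _ (by linarith), mul_assoc, add_mul]
  gcongr
  · simp
  · rfl

/-- The Poincaré inequality holds near `x`. -/
def LocalPoincareAt (Ω D : Set (Euc n)) (p : ℝ) (x : Euc n) : Prop :=
  ∃ r : ℝ, 0 < r ∧ LocalPoincare Ω D p (Metric.ball x r)

theorem eventually_localPoincareAt_iff (hp : 1 < p) (hD : IsOpen D) {x : Euc n} (hx : x ∈ D) :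
    ∀ᶠ y in 𝓝 x, (LocalPoincareAt Ω D p x ↔ LocalPoincareAt Ω D p y) := by
  have hmain : ∀ (a b : Euc n) (R : ℝ), 0 < R → Metric.ball a R ⊆ D → b ∈ Metric.ball a (R / 2) →
      LocalPoincareAt Ω D p b → LocalPoincareAt Ω D p a := by
    rintro a b R hR hsub hb ⟨r, hr, hP⟩
    refine ⟨min r (R / 2), lt_min hr (by positivity), ?_⟩
    refine (hP.mono (Metric.ball_subset_ball (min_le_left r (R / 2)))).of_shift hp
      measurableSet_ball measurableSet_ball hD.measurableSet (b - a) ?_ ?_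
    · intro y hy t ht
      apply hsub
      rw [mem_ball_iff_norm] at hb ⊢
      have hy1 := hy.1
      rw [mem_ball_iff_norm] at hy1
      calc ‖y + t • (b - a) - a‖ = ‖(y - a) + t • (b - a)‖ := by congr 1; abel
        _ ≤ ‖y - a‖ + ‖t • (b - a)‖ := norm_add_le _ _
        _ ≤ ‖y - a‖ + ‖b - a‖ := by
          rw [norm_smul, Real.norm_of_nonneg ht.1.le]
          gcongr
          exact mul_le_of_le_one_left (norm_nonneg _) ht.2
        _ < R := by linarith [hy1.trans_le (min_le_right r (R / 2))]
    · intro y hy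
      have hy1 := hy.1
      rw [mem_ball_iff_norm] at hy1 ⊢
      calc ‖y + (b - a) - b‖ = ‖y - a‖ := by congr 1; abel
        _ < _ := hy1
  obtain ⟨R, hR, hsub⟩ := Metric.isOpen_iff.1 hD x hx
  filter_upwards [Metric.ball_mem_nhds x (show 0 < R / 3 by positivity)] with y hy
  constructor
  · refine hmain y x (2 * R / 3) (by positivity) (fun z hz => hsub ?_) ?_
    · rw [Metric.mem_ball] at *
      linarith [dist_triangle z y x]
    · rw [Metric.mem_ball, dist_comm] at *
      rw [dist_comm]
      linarith
  · exact hmain x y R hR hsub (Metric.ball_subset_ball (by linarith) hy)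

theorem IsAdmissibleGeometry.localPoincareAt [Nonempty (Fin n)]
    (h : IsAdmissibleGeometry Ω A) (hp : 1 < p) {x : Euc n}
    (hx : x ∈ closure (Ω \ closure A)) : LocalPoincareAt Ω (closure A)ᶜ p x := by
  have hDo : IsOpen (closure A)ᶜ := isClosed_closure.isOpen_compl
  have hBo : IsOpen (Ω \ closure A) := h.isOpen.sdiff isClosed_closure
  have hext : ∀ y ∉ closure Ω, LocalPoincareAt Ω (closure A)ᶜ p y := by
    intro y hy
    obtain ⟨r, hr, hsub⟩ := Metric.isOpen_iff.1 (isClosed_closure (s := Ω)).isOpen_compl y hy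
    exact ⟨r, hr, LocalPoincare.of_disjoint (by linarith)
      (hsub.trans (compl_subset_compl.2 subset_closure))
      (measurableSet_ball.inter hDo.measurableSet)⟩
  have hfrB : ∀ y ∈ frontier Ω, y ∉ A ∧ y ∈ (closure A)ᶜ := by
    intro y hy
    rw [h.isOpen.frontier_eq] at hy
    exact ⟨fun hyA => hy.2 (h.closure_subset (subset_closure hyA)),
      fun hyA => hy.2 (h.closure_subset hyA)⟩
  -- a small inward translate of the complement
  have hstep : ∀ {y : Euc n} {V : Set (Euc n)}, y ∉ A → V ∈ 𝓝 y → ∃ (e : Euc n) (r κ s : ℝ),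
      ‖e‖ ≤ 1 ∧ 0 < r ∧ 0 < κ ∧ (∀ x ∈ Metric.ball y r, ∀ s ∈ Ioo 0 r,
        ∀ z ∈ Metric.ball (s • e) (κ * s), (x ∉ A → x - z ∉ closure A) ∧
          (x ∉ Ω → x - z ∉ closure Ω)) ∧ s ∈ Ioo 0 r ∧ y - s • e ∈ V := by
    intro y V hy hV
    obtain ⟨e, r, κ, he, hr, hκ, -, H⟩ := h.exists_shift hy
    obtain ⟨ρ, hρ, hρV⟩ := Metric.mem_nhds_iff.1 hV
    refine ⟨e, r, κ, min r ρ / 2, he, hr, hκ, H, ⟨by positivity, ?_⟩, hρV ?_⟩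
    · linarith [min_le_left r ρ]
    · rw [mem_ball_iff_norm]
      calc ‖y - (min r ρ / 2) • e - y‖ = ‖(min r ρ / 2) • e‖ := by
            rw [sub_sub_cancel_left, norm_neg]
        _ ≤ min r ρ / 2 := by
            rw [norm_smul, Real.norm_of_nonneg (by positivity)]
            exact mul_le_of_le_one_right (by positivity) he
        _ < ρ := by linarith [min_le_right r ρ, lt_min hr hρ]
  -- starting point
  have hstart : ∃ b ∈ Ω \ closure A, LocalPoincareAt Ω (closure A)ᶜ p b := by
    have hne : (frontier Ω).Nonempty := by
      refine nonempty_frontier_iff.2 ⟨h.isConnected.nonempty, fun hu => ?_⟩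
      have := h.isBounded
      rw [hu] at this
      exact NormedSpace.unbounded_univ ℝ (Euc n) this
    obtain ⟨y, hy⟩ := hne
    have hev := eventually_localPoincareAt_iff (Ω := Ω) hp hDo (hfrB y hy).2
    obtain ⟨e, r, κ, s, he, hr, hκ, H, hs, hsV⟩ := hstep (hfrB y hy).1 hev
    have hy1 : y ∉ Ω := by rw [h.isOpen.frontier_eq] at hy; exact hy.2
    have hPy : LocalPoincareAt Ω (closure A)ᶜ p y := by
      refine hsV.2 (hext _ ((H y (Metric.mem_ball_self hr) s hs (s • e)
        (Metric.mem_ball_self (mul_pos hκ hs.1))).2 hy1))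
    have hycl : y ∈ closure Ω := frontier_subset_closure hy
    obtain ⟨b, hb, hbΩ⟩ := mem_closure_iff_nhds.1 hycl _ (inter_mem hev (hDo.mem_nhds (hfrB y hy).2))
    exact ⟨b, ⟨hbΩ, hb.2⟩, hb.1.1 hPy⟩
  obtain ⟨b, hb, hPb⟩ := hstart
  have hB : ∀ y ∈ Ω \ closure A, LocalPoincareAt Ω (closure A)ᶜ p y := by
    intro y hy
    have := h.isConnected_outer.isPreconnected.induction₂
      (fun a c => (LocalPoincareAt Ω (closure A)ᶜ p a ↔ LocalPoincareAt Ω (closure A)ᶜ p c))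
      (fun a ha => nhdsWithin_le_nhds (eventually_localPoincareAt_iff hp hDo ha.2))
      (fun _ _ _ _ _ _ h1 h2 => h1.trans h2) (fun _ _ _ _ h1 => h1.symm) hb hy
    exact this.1 hPb
  by_cases hxA : x ∈ closure A
  · have hxA' : x ∉ A := by
      intro hxA'
      obtain ⟨y, hy, hyB⟩ := mem_closure_iff.1 hx A h.isOpen_inner hxA'
      exact hyB.2 (subset_closure hy)
    obtain ⟨e, r, κ, s, he, hr, hκ, H, hs, hsV⟩ :=
      hstep hxA' (h.isOpen.mem_nhds (h.closure_subset hxA))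
    have hsA := (H x (Metric.mem_ball_self hr) s hs (s • e)
      (Metric.mem_ball_self (mul_pos hκ hs.1))).1 hxA'
    obtain ⟨ρ, hρ, hP⟩ := hB (x - s • e) ⟨hsV, hsA⟩
    refine ⟨min r ρ, lt_min hr hρ, hP.of_shift hp measurableSet_ball measurableSet_ball
      hDo.measurableSet (-(s • e)) ?_ ?_⟩
    · intro y hy t ht
      have hts : t * s ∈ Ioo 0 r := ⟨mul_pos ht.1 hs.1,
        (mul_le_of_le_one_left hs.1.le ht.2).trans_lt hs.2⟩
      have := (H y (Metric.ball_subset_ball (min_le_left _ _) hy.1) (t * s) hts ((t * s) • e)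
        (Metric.mem_ball_self (mul_pos hκ hts.1))).1 (fun hyA => hy.2 (subset_closure hyA))
      rwa [smul_neg, smul_smul, ← sub_eq_add_neg]
    · intro y hy
      have hy1 := hy.1
      rw [mem_ball_iff_norm] at hy1 ⊢
      calc ‖y + -(s • e) - (x - s • e)‖ = ‖y - x‖ := by congr 1; abel
        _ < ρ := hy1.trans_le (min_le_right _ _)
  · obtain ⟨y, hy, hyB⟩ := mem_closure_iff_nhds.1 hx _
      (eventually_localPoincareAt_iff (Ω := Ω) hp hDo hxA)
    exact hy.2 (hB y hyB)

/-- **Poincaré inequality** on `Ω \ closure A` for functions that vanish outside `Ω`. -/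
theorem IsAdmissibleGeometry.poincare [Nonempty (Fin n)] (h : IsAdmissibleGeometry Ω A)
    (hp : 1 < p) :
    ∃ C : ℝ≥0, ∀ (w : Euc n → ℝ) (G : Euc n → Euc n), Measurable w → Measurable G →
      (∀ x ∉ Ω, w x = 0) → (∀ x ∉ Ω, G x = 0) → LineBound w G →
        ∫⁻ x in Ω \ closure A, ‖w x‖ₑ ^ p ≤ C * ∫⁻ x in Ω \ closure A, ‖G x‖ₑ ^ p := by
  have hcomp : IsCompact (closure (Ω \ closure A)) :=
    (h.isBounded.subset sdiff_subset).isCompact_closure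
  have hP : LocalPoincare Ω (closure A)ᶜ p (closure (Ω \ closure A)) := by
    refine hcomp.induction_on (p := LocalPoincare Ω (closure A)ᶜ p) ⟨0, by simp⟩
      (fun _ _ hst ht => ht.mono hst) (fun _ _ hs ht => hs.union ht) fun x hx => ?_
    obtain ⟨r, hr, hPr⟩ := h.localPoincareAt hp hx
    exact ⟨_, mem_nhdsWithin_of_mem_nhds (Metric.ball_mem_nhds x hr), hPr⟩
  obtain ⟨C, hC⟩ := hP
  refine ⟨C, fun w G hw hG hw0 hG0 hl => ?_⟩
  have h1 : ∫⁻ x in Ω \ closure A, ‖w x‖ₑ ^ p ≤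
      ∫⁻ x in closure (Ω \ closure A) ∩ (closure A)ᶜ, ‖w x‖ₑ ^ p :=
    lintegral_mono_set fun x hx => ⟨subset_closure hx, hx.2⟩
  have h2 : ∫⁻ x in (closure A)ᶜ, ‖G x‖ₑ ^ p = ∫⁻ x in Ω \ closure A, ‖G x‖ₑ ^ p := by
    rw [← lintegral_indicator isClosed_closure.isOpen_compl.measurableSet,
      ← lintegral_indicator (h.isOpen.sdiff isClosed_closure).measurableSet]
    congr 1
    ext x
    by_cases hx : x ∈ Ω
    · by_cases hxA : x ∈ closure A <;> simp [indicator, hx, hxA]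
    · have hp0 : 0 < p := by linarith
      simp [indicator, hx, hG0 x hx, hp0]
  exact h1.trans ((hC w G hw hG hw0 hl).trans_eq (by rw [h2]))

end Poincare

section Mollification

variable {n : ℕ} {p : ℝ} {F : Type*} [NormedAddCommGroup F]

theorem measurePreserving_sub_const (z : Euc n) :
    MeasurePreserving (fun x : Euc n => x - z) volume volume :=
  measurePreserving_sub_right volume z

/-- Continuity of translations in `L^p`. -/
theorem MeasureTheory.MemLp.exists_translate_le (hp : 1 < p) {g : Euc n → F}
    (hg : MemLp g (ENNReal.ofReal p) volume) {ε : ℝ≥0∞} (hε : 0 < ε) :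
    ∃ δ : ℝ, 0 < δ ∧ ∀ z : Euc n, ‖z‖ < δ → ∫⁻ x, ‖g (x - z) - g x‖ₑ ^ p ≤ ε := by
  have : Fact (1 < p) := ⟨hp⟩
  have hp0 : 0 < p := by linarith
  have hc : Continuous fun z : Euc n => Lp.compMeasurePreserving (fun x : Euc n => x - z)
      (measurePreserving_sub_const z) (hg.toLp g) := by
    let k : C(Euc n, C(Euc n, Euc n)) :=
      (ContinuousMap.mk (fun a : Euc n × Euc n => a.2 - a.1) (by fun_prop)).curry
    exact (continuous_const (y := hg.toLp g)).compMeasurePreservingLp (g := k) k.continuous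
      (fun z => measurePreserving_sub_const z) ENNReal.ofReal_ne_top
  have he := (EMetric.tendsto_nhds.1 (hc.tendsto 0)) (ε ^ (1 / p))
    (ENNReal.rpow_pos_of_nonneg hε (by positivity))
  obtain ⟨δ, hδ, H⟩ := Metric.eventually_nhds_iff.1 he
  refine ⟨δ, hδ, fun z hz => ?_⟩
  have h1 := H (y := z) (by simpa using hz)
  rw [Lp.edist_def] at h1
  have h2 : eLpNorm (fun x => g (x - z) - g x) (ENNReal.ofReal p) volume < ε ^ (1 / p) := by
    refine lt_of_eq_of_lt (eLpNorm_congr_ae ?_) h1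
    have e1 : ∀ y : Euc n, Lp.compMeasurePreserving (fun x : Euc n => x - y)
        (measurePreserving_sub_const y) (hg.toLp g) =ᵐ[volume] fun x => g (x - y) := by
      intro y
      refine (Lp.coeFn_compMeasurePreserving _ (measurePreserving_sub_const y)).trans ?_
      exact (measurePreserving_sub_const y).quasiMeasurePreserving.ae_eq_comp hg.coeFn_toLp
    filter_upwards [e1 z, e1 0] with x hx hx0
    rw [Pi.sub_apply, hx, hx0, sub_zero]
  rw [eLpNorm_eq_lintegral_rpow_enorm_toReal (by simpa using hp0) ENNReal.ofReal_ne_top,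
    ENNReal.toReal_ofReal hp0.le] at h2
  exact ((ENNReal.rpow_lt_rpow_iff (by positivity)).1 h2).le

/-- Averages against a kernel concentrated near the origin are close in `L^p`. -/
theorem MeasureTheory.MemLp.exists_mollify_le [NormedSpace ℝ F] [CompleteSpace F] [MeasurableSpace F] [BorelSpace F]
    [SecondCountableTopology F] (hp : 1 < p)
    {g : Euc n → F} (hgm : Measurable g) (hg : MemLp g (ENNReal.ofReal p) volume) {ε : ℝ≥0∞}
    (hε : 0 < ε) :
    ∃ δ : ℝ, 0 < δ ∧ ∀ ρ : Euc n → ℝ, Continuous ρ → HasCompactSupport ρ → (∀ z, 0 ≤ ρ z) →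
      ∫ z, ρ z = 1 → (∀ z, ρ z ≠ 0 → ‖z‖ < δ) →
        ∫⁻ x, ‖(∫ z, ρ z • g (x - z)) - g x‖ₑ ^ p ≤ ε := by
  obtain ⟨δ, hδ, H⟩ := hg.exists_translate_le hp hε
  refine ⟨δ, hδ, fun ρ hρ hρc hρ0 hρ1 hρs => ?_⟩
  have hi : Integrable ρ := hρ.integrable_of_hasCompactSupport hρc
  set r : Euc n → ℝ≥0∞ := fun z => ENNReal.ofReal (ρ z)
  have hr : Measurable r := hρ.measurable.ennreal_ofReal
  set ν : Measure (Euc n) := volume.withDensity r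
  have hr1 : ∫⁻ z, r z = 1 := by
    rw [← ofReal_integral_eq_lintegral_ofReal hi (Eventually.of_forall hρ0), hρ1,
      ENNReal.ofReal_one]
  have hν : IsProbabilityMeasure ν := ⟨by
    rw [withDensity_apply _ MeasurableSet.univ, Measure.restrict_univ, hr1]⟩
  have hloc : LocallyIntegrable g volume := by
    have : Fact (1 < p) := ⟨hp⟩
    exact hg.locallyIntegrable Fact.out
  have hm2 : Measurable fun a : Euc n × Euc n => ‖g (a.1 - a.2) - g a.1‖ₑ ^ p :=
    (((hgm.comp (measurable_fst.sub measurable_snd)).sub (hgm.comp measurable_fst)).enorm).pow_const p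
  have hb : ∀ x, ‖(∫ z, ρ z • g (x - z)) - g x‖ₑ ^ p ≤
      ∫⁻ z, r z * ‖g (x - z) - g x‖ₑ ^ p := by
    intro x
    have hix : Integrable fun z => ρ z • g (x - z) :=
      hρc.convolutionExists_left (ContinuousLinearMap.lsmul ℝ ℝ) hρ hloc x
    have e1 : (∫ z, ρ z • g (x - z)) - g x = ∫ z, ρ z • (g (x - z) - g x) := by
      simp only [smul_sub]
      rw [integral_sub hix (hi.smul_const _), integral_smul_const, hρ1, one_smul]
    have hmx : Measurable fun z => ‖g (x - z) - g x‖ₑ :=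
      ((hgm.comp (measurable_const.sub measurable_id)).sub_const _).enorm
    have e2 : ‖∫ z, ρ z • (g (x - z) - g x)‖ₑ ≤ ∫⁻ z, ‖g (x - z) - g x‖ₑ ∂ν := by
      rw [lintegral_withDensity_eq_lintegral_mul _ hr hmx]
      refine (enorm_integral_le_lintegral_enorm _).trans_eq (lintegral_congr fun z => ?_)
      rw [enorm_smul, Pi.mul_apply, Real.enorm_eq_ofReal (hρ0 z)]
    rw [e1]
    calc _ ≤ (∫⁻ z, ‖g (x - z) - g x‖ₑ ∂ν) ^ p := by gcongr
      _ ≤ ∫⁻ z, ‖g (x - z) - g x‖ₑ ^ p ∂ν := rpow_lintegral_le_lintegral_rpow hp hmx.aemeasurable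
      _ = _ := lintegral_withDensity_eq_lintegral_mul _ hr (hmx.pow_const p)
  calc _ ≤ ∫⁻ x, ∫⁻ z, r z * ‖g (x - z) - g x‖ₑ ^ p := lintegral_mono hb
    _ = ∫⁻ z, ∫⁻ x, r z * ‖g (x - z) - g x‖ₑ ^ p :=
      lintegral_lintegral_swap ((hr.comp measurable_snd).mul hm2).aemeasurable
    _ ≤ ∫⁻ z, r z * ε := by
      refine lintegral_mono fun z => ?_
      rw [lintegral_const_mul' _ _ ENNReal.ofReal_ne_top]
      by_cases hz : ρ z = 0
      · simp [r, hz]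
      · exact mul_le_mul' le_rfl (H z (hρs z hz))
    _ = ε := by rw [lintegral_mul_const _ hr, hr1, one_mul]

theorem integral_convolution_comm [NormedSpace ℝ F] (ρ : Euc n → ℝ) (g : Euc n → F) (x : Euc n) :
    ∫ z, ρ z • g (x - z) = ∫ t, ρ (x - t) • g t := by
  rw [← integral_sub_left_eq_self (fun z => ρ z • g (x - z)) volume x]
  simp

/-- The gradient of a mollified function is the mollified weak gradient. -/
theorem gradient_mollify {w : Euc n → ℝ} {G : Euc n → Euc n} (hw : LocallyIntegrable w)
    (hG : LocallyIntegrable G) (h : IsWeakGradient univ w G) {ρ : Euc n → ℝ}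
    (hρ : ContDiff ℝ ∞ ρ) (hρc : HasCompactSupport ρ) :
    ContDiff ℝ 1 (fun x => ∫ z, ρ z • w (x - z)) ∧
      ∀ x, gradient (fun x => ∫ z, ρ z • w (x - z)) x = ∫ z, ρ z • G (x - z) := by
  have hρ1 : ContDiff ℝ 1 ρ := hρ.of_le (by simp)
  have hφ : (fun x => ∫ z, ρ z • w (x - z)) =
      convolution w ρ (ContinuousLinearMap.mul ℝ ℝ) volume := by
    ext x
    rw [integral_convolution_comm, convolution_def]
    simp [mul_comm]
  refine ⟨?_, fun x => ?_⟩
  · rw [hφ]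
    exact_mod_cast hρc.contDiff_convolution_right (n := 1) _ hw hρ1
  · refine ext_inner_right ℝ fun e => ?_
    rw [inner_gradient_left, hφ, (hρc.hasFDerivAt_convolution_right _ hw hρ1 x).fderiv,
      convolution_precompR_apply _ hw (hρc.fderiv ℝ) (hρ1.continuous_fderiv one_ne_zero),
      convolution_def]
    set ψ : Euc n → ℝ := fun t => ρ (x - t) with hψ
    have hψs : ContDiff ℝ ∞ ψ := hρ.comp (contDiff_const.sub contDiff_id)
    have hψc : HasCompactSupport ψ := hρc.comp_homeomorph (Homeomorph.subLeft x)
    have hψd : ∀ t, fderiv ℝ ψ t e = - fderiv ℝ ρ (x - t) e := by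
      intro t
      have h1 : HasFDerivAt (fun t : Euc n => x - t) (-(ContinuousLinearMap.id ℝ (Euc n))) t :=
        (hasFDerivAt_id t).const_sub x
      have h2 := ((hρ1.differentiable one_ne_zero (x - t)).hasFDerivAt).comp t h1
      have h3 : HasFDerivAt ψ _ t := h2
      rw [h3.fderiv]
      simp
    have hwg := h ψ hψs hψc (subset_univ _) e
    simp only [Measure.restrict_univ, hψd, mul_neg, integral_neg, neg_inj] at hwg
    have hi : Integrable fun t => ρ (x - t) • G t :=
      hG.integrable_smul_left_of_hasCompactSupport hψs.continuous hψc
    rw [integral_convolution_comm, real_inner_comm, ← integral_inner hi e]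
    simp only [ContinuousLinearMap.mul_apply']
    rw [hwg]
    refine integral_congr_ae (Eventually.of_forall fun t => ?_)
    simp only [hψ]
    rw [real_inner_smul_right, mul_comm, real_inner_comm]

end Mollification

section WeakGradientAlgebra

variable {n : ℕ} {U : Set (Euc n)} {w v : Euc n → ℝ} {G H : Euc n → Euc n}

theorem IsWeakGradient.sub (hw : Integrable w) (hv : Integrable v) (hG : Integrable G)
    (hH : Integrable H) (h1 : IsWeakGradient univ w G) (h2 : IsWeakGradient univ v H) :
    IsWeakGradient univ (fun x => w x - v x) (fun x => G x - H x) := by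
  intro ψ hψ hc hs e
  have hd : Continuous fun x => fderiv ℝ ψ x e :=
    (hψ.continuous_fderiv (by simp)).clm_apply continuous_const
  obtain ⟨M, hM⟩ := hd.bounded_above_of_compact_support (hc.fderiv_apply (𝕜 := ℝ) e)
  obtain ⟨N, hN⟩ := hψ.continuous.bounded_above_of_compact_support hc
  have iw : ∀ {v : Euc n → ℝ}, Integrable v → Integrable fun x => v x * fderiv ℝ ψ x e :=
    fun hv => hv.mul_bdd (c := M) hd.aestronglyMeasurable (Eventually.of_forall hM)
  have iG : ∀ {F : Euc n → Euc n}, Integrable F → Integrable fun x => inner ℝ (F x) e * ψ x :=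
    fun hF => (hF.inner_const e).mul_bdd (c := N) hψ.continuous.aestronglyMeasurable
      (Eventually.of_forall hN)
  have e1 := h1 ψ hψ hc hs e
  have e2 := h2 ψ hψ hc hs e
  simp only [Measure.restrict_univ] at e1 e2
  simp only [Measure.restrict_univ, sub_mul, inner_sub_left]
  rw [integral_sub (iw hw) (iw hv), integral_sub (iG hG) (iG hH), e1, e2]
  ring

theorem IsWeakGradient.mul_smooth (hw : Integrable w) (hG : Integrable G)
    (h : IsWeakGradient univ w G) {χ : Euc n → ℝ} (hχ : ContDiff ℝ ∞ χ)
    (hχc : HasCompactSupport χ) :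
    IsWeakGradient univ (fun x => χ x * w x) (fun x => χ x • G x + w x • gradient χ x) := by
  intro ψ hψ hc hs e
  have hχ1 : ContDiff ℝ 1 χ := hχ.of_le (by simp)
  have hψ1 : ContDiff ℝ 1 ψ := hψ.of_le (by simp)
  have e1 := h (fun x => χ x * ψ x) (hχ.mul hψ) hc.mul_left (subset_univ _) e
  simp only [Measure.restrict_univ] at e1 ⊢
  have hd : ∀ x, fderiv ℝ (fun x => χ x * ψ x) x e =
      χ x * fderiv ℝ ψ x e + ψ x * fderiv ℝ χ x e := by
    intro x
    rw [fderiv_fun_mul (hχ1.differentiable one_ne_zero x) (hψ1.differentiable one_ne_zero x)]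
    simp
  have hdc : ∀ {f : Euc n → ℝ}, ContDiff ℝ 1 f → Continuous fun x => fderiv ℝ f x e := fun hf =>
    (hf.continuous_fderiv one_ne_zero).clm_apply continuous_const
  have hmul : ∀ {f k : Euc n → ℝ}, Integrable f → Continuous k → HasCompactSupport k →
      Integrable fun x => f x * k x := by
    intro f k hf hk hkc
    obtain ⟨M, hM⟩ := hk.bounded_above_of_compact_support hkc
    exact hf.mul_bdd (c := M) hk.aestronglyMeasurable (Eventually.of_forall hM)
  have i1 : Integrable fun x => w x * (χ x * fderiv ℝ ψ x e) :=
    hmul hw (hχ.continuous.mul (hdc hψ1)) hχc.mul_right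
  have i2 : Integrable fun x => w x * (ψ x * fderiv ℝ χ x e) :=
    hmul hw (hψ.continuous.mul (hdc hχ1)) hc.mul_right
  have i3 : Integrable fun x => inner ℝ (G x) e * (χ x * ψ x) :=
    hmul (hG.inner_const e) (hχ.continuous.mul hψ.continuous) hc.mul_left
  simp only [hd, mul_add] at e1
  rw [integral_add i1 i2] at e1
  have e2 : ∫ x, χ x * w x * fderiv ℝ ψ x e = ∫ x, w x * (χ x * fderiv ℝ ψ x e) :=
    integral_congr_ae (Eventually.of_forall fun x => by simp only; ring)
  have e3 : ∫ x, inner ℝ (χ x • G x + w x • gradient χ x) e * ψ x =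
      (∫ x, inner ℝ (G x) e * (χ x * ψ x)) + ∫ x, w x * (ψ x * fderiv ℝ χ x e) := by
    rw [← integral_add i3 i2]
    refine integral_congr_ae (Eventually.of_forall fun x => ?_)
    simp only [inner_add_left, real_inner_smul_left, inner_gradient_left]
    ring
  rw [e2, e3]
  linarith

end WeakGradientAlgebra

section Density

variable {n : ℕ} {Ω A D : Set (Euc n)} {p : ℝ}

/-- `(w, G)` is a pair of an integrable Sobolev function on `ℝⁿ` and its weak gradient, both vanish
outside `Ω` and belong to `L^p(D)`. -/
structure IsSobolevPair (Ω D : Set (Euc n)) (p : ℝ) (w : Euc n → ℝ) (G : Euc n → Euc n) :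
    Prop where
  measurable_fun : Measurable w
  measurable_grad : Measurable G
  fun_eq_zero : ∀ x ∉ Ω, w x = 0
  grad_eq_zero : ∀ x ∉ Ω, G x = 0
  integrable_fun : Integrable w
  integrable_grad : Integrable G
  memLp_fun : MemLp w (ENNReal.ofReal p) (volume.restrict D)
  memLp_grad : MemLp G (ENNReal.ofReal p) (volume.restrict D)
  weak : IsWeakGradient univ w G

variable {w v : Euc n → ℝ} {G H : Euc n → Euc n}

theorem IsSobolevPair.sub (h : IsSobolevPair Ω D p w G) (h' : IsSobolevPair Ω D p v H) :
    IsSobolevPair Ω D p (fun x => w x - v x) (fun x => G x - H x) where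
  measurable_fun := h.measurable_fun.sub h'.measurable_fun
  measurable_grad := h.measurable_grad.sub h'.measurable_grad
  fun_eq_zero x hx := by simp only [h.fun_eq_zero x hx, h'.fun_eq_zero x hx, sub_zero]
  grad_eq_zero x hx := by simp only [h.grad_eq_zero x hx, h'.grad_eq_zero x hx, sub_zero]
  integrable_fun := h.integrable_fun.sub h'.integrable_fun
  integrable_grad := h.integrable_grad.sub h'.integrable_grad
  memLp_fun := h.memLp_fun.sub h'.memLp_fun
  memLp_grad := h.memLp_grad.sub h'.memLp_grad
  weak := h.weak.sub h.integrable_fun h'.integrable_fun h.integrable_grad h'.integrable_grad h'.weak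

theorem IsSobolevPair.mul_smooth (h : IsSobolevPair Ω D p w G) {χ : Euc n → ℝ}
    (hχ : ContDiff ℝ ∞ χ) (hχc : HasCompactSupport χ) :
    IsSobolevPair Ω D p (fun x => χ x * w x) (fun x => χ x • G x + w x • gradient χ x) := by
  have hχ1 : ContDiff ℝ 1 χ := hχ.of_le (by simp)
  have hgc := continuous_gradient hχ1
  obtain ⟨M, hM⟩ := hχ.continuous.bounded_above_of_compact_support hχc
  obtain ⟨N, hN⟩ := hgc.bounded_above_of_compact_support (hasCompactSupport_gradient hχc)
  have hχT : ∀ {μ : Measure (Euc n)}, MemLp χ ⊤ μ :=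
    memLp_top_of_bound hχ.continuous.aestronglyMeasurable M (Eventually.of_forall hM)
  have hgT : ∀ {μ : Measure (Euc n)}, MemLp (gradient χ) ⊤ μ :=
    memLp_top_of_bound hgc.aestronglyMeasurable N (Eventually.of_forall hN)
  have hmem : ∀ {r : ℝ≥0∞} {μ : Measure (Euc n)}, MemLp w r μ → MemLp G r μ →
      MemLp (fun x => χ x * w x) r μ ∧
        MemLp (fun x => χ x • G x + w x • gradient χ x) r μ := fun hw hG =>
    ⟨hw.mul hχT, (hG.smul hχT).add (hgT.smul hw)⟩
  have h1 := hmem (memLp_one_iff_integrable.2 h.integrable_fun)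
    (memLp_one_iff_integrable.2 h.integrable_grad)
  have h2 := hmem h.memLp_fun h.memLp_grad
  exact
  { measurable_fun := hχ.continuous.measurable.mul h.measurable_fun
    measurable_grad := (hχ.continuous.measurable.smul h.measurable_grad).add
      (h.measurable_fun.smul hgc.measurable)
    fun_eq_zero := fun x hx => by simp only [h.fun_eq_zero x hx, mul_zero]
    grad_eq_zero := fun x hx => by
      simp only [h.fun_eq_zero x hx, h.grad_eq_zero x hx, smul_zero, zero_smul, add_zero]
    integrable_fun := memLp_one_iff_integrable.1 h1.1
    integrable_grad := memLp_one_iff_integrable.1 h1.2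
    memLp_fun := h2.1
    memLp_grad := h2.2
    weak := h.weak.mul_smooth h.integrable_fun h.integrable_grad hχ hχc }

theorem eLpNorm_le_of_lintegral_le {F : Type*} [NormedAddCommGroup F] (hp : 0 < p)
    {μ : Measure (Euc n)} {g : Euc n → F} {c : ℝ≥0∞} (h : ∫⁻ x, ‖g x‖ₑ ^ p ∂μ ≤ c ^ p) :
    eLpNorm g (ENNReal.ofReal p) μ ≤ c := by
  rw [eLpNorm_eq_lintegral_rpow_enorm_toReal (by simpa using hp) ENNReal.ofReal_ne_top,
    ENNReal.toReal_ofReal hp.le]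
  calc _ ≤ (c ^ p) ^ (1 / p) := by gcongr
    _ = c := by rw [← ENNReal.rpow_mul, mul_one_div_cancel hp.ne', ENNReal.rpow_one]

variable [Fact (1 < p)]

/-- The restriction of a Sobolev pair to a subset of `D`. -/
noncomputable def IsSobolevPair.toW1 (h : IsSobolevPair Ω D p w G) {U : Set (Euc n)}
    (hUD : U ⊆ D) : W1 U p :=
  W1.of (h.memLp_fun.mono_measure (Measure.restrict_mono hUD le_rfl))
    (h.memLp_grad.mono_measure (Measure.restrict_mono hUD le_rfl))
    (h.weak.mono (subset_univ U) MeasurableSet.univ)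

theorem IsSobolevPair.sobFun_toW1 (h : IsSobolevPair Ω D p w G) {U : Set (Euc n)} (hUD : U ⊆ D) :
    sobFun (h.toW1 hUD) =ᵐ[volume.restrict U] w := W1.sobFun_of _ _ _

theorem IsSobolevPair.sobGrad_toW1 (h : IsSobolevPair Ω D p w G) {U : Set (Euc n)} (hUD : U ⊆ D) :
    sobGrad (h.toW1 hUD) =ᵐ[volume.restrict U] G := W1.sobGrad_of _ _ _

open scoped Pointwise in
set_option maxHeartbeats 1000000 in
/-- Sobolev pairs with support near a point outside `A` are limits of test functions. -/
theorem IsSobolevPair.toW1_mem_of_local {D : Set (Euc n)} (hD : IsOpen D)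
    (h : IsSobolevPair Ω D p w G) {x₀ e : Euc n} {r κ : ℝ} (he : ‖e‖ ≤ 1) (hr : 0 < r)
    (hκ : 0 < κ) (hκ1 : κ ≤ 1) (hA : A ⊆ Dᶜ)
    (hshift : ∀ x ∈ Metric.ball x₀ r, ∀ s ∈ Ioo 0 r, ∀ z ∈ Metric.ball (s • e) (κ * s),
      (x ∉ A → x - z ∈ D) ∧ (x ∉ Ω → x - z ∉ closure Ω))
    (hw0 : ∀ x ∉ Metric.closedBall x₀ (r / 2), w x = 0)
    (hG0 : ∀ x ∉ Metric.closedBall x₀ (r / 2), G x = 0) {U : Set (Euc n)} (hU : MeasurableSet U)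
    (hUD : U ⊆ D) :
    h.toW1 hUD ∈ vanishingOn U Ω p := by
  have hp : 1 < p := Fact.out
  have hp0 : 0 < p := by linarith
  refine Metric.mem_closure_iff.2 fun ε hε => ?_
  have hDm := hD.measurableSet
  have hmw : MemLp (D.indicator w) (ENNReal.ofReal p) volume :=
    (memLp_indicator_iff_restrict hDm).2 h.memLp_fun
  have hmG : MemLp (D.indicator G) (ENNReal.ofReal p) volume :=
    (memLp_indicator_iff_restrict hDm).2 h.memLp_grad
  have hε' : 0 < ENNReal.ofReal (ε / 2) ^ p :=
    ENNReal.rpow_pos (by simpa using hε) ENNReal.ofReal_ne_top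
  obtain ⟨δ₁, hδ₁, H₁⟩ := hmw.exists_mollify_le hp (h.measurable_fun.indicator hDm) hε'
  obtain ⟨δ₂, hδ₂, H₂⟩ := hmG.exists_mollify_le hp (h.measurable_grad.indicator hDm) hε'
  obtain ⟨s, hs0, hsδ₁, hsδ₂, hsr⟩ : ∃ s : ℝ, 0 < s ∧ 2 * s < δ₁ ∧ 2 * s < δ₂ ∧ 2 * s < r / 2 := by
    refine ⟨min (min δ₁ δ₂) (r / 2) / 3, by positivity, ?_, ?_, ?_⟩ <;>
    linarith [min_le_left (min δ₁ δ₂) (r / 2), min_le_right (min δ₁ δ₂) (r / 2),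
      min_le_left δ₁ δ₂, min_le_right δ₁ δ₂, lt_min (lt_min hδ₁ hδ₂) (half_pos hr)]
  have hκs : 0 < κ * s := mul_pos hκ hs0
  let b : ContDiffBump (s • e) := ⟨κ * s / 4, κ * s / 2, by positivity, by linarith⟩
  set ρ : Euc n → ℝ := b.normed volume with hρ
  have hρs : ContDiff ℝ ∞ ρ := b.contDiff_normed
  have hρc : HasCompactSupport ρ := b.hasCompactSupport_normed
  have hρ0 : ∀ z, 0 ≤ ρ z := fun z => b.nonneg_normed z
  have hρ1 : ∫ z, ρ z = 1 := b.integral_normed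
  have hsupp : ∀ z, ρ z ≠ 0 → ‖z - s • e‖ < κ * s / 2 := by
    intro z hz
    have : z ∈ Function.support ρ := hz
    rw [hρ, b.support_normed_eq] at this
    exact mem_ball_iff_norm.1 this
  have hnorm : ∀ z, ‖z - s • e‖ ≤ κ * s / 2 → ‖z‖ < 2 * s := by
    intro z hz
    have h1 : ‖z‖ ≤ ‖z - s • e‖ + ‖s • e‖ := by simpa using norm_add_le (z - s • e) (s • e)
    have h2 : ‖s • e‖ ≤ s := by
      rw [norm_smul, Real.norm_of_nonneg hs0.le]
      exact mul_le_of_le_one_right hs0.le he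
    nlinarith
  have hsI : s ∈ Ioo 0 r := ⟨hs0, by linarith⟩
  have hball : ∀ z, ‖z - s • e‖ ≤ κ * s / 2 → z ∈ Metric.ball (s • e) (κ * s) := fun z hz =>
    mem_ball_iff_norm.2 (by linarith)
  have hnear : ∀ x z, ‖z - s • e‖ ≤ κ * s / 2 → x - z ∈ Metric.closedBall x₀ (r / 2) →
      x ∈ Metric.ball x₀ r := by
    intro x z hz hx
    rw [mem_closedBall_iff_norm] at hx
    rw [mem_ball_iff_norm]
    calc ‖x - x₀‖ = ‖(x - z - x₀) + z‖ := by congr 1; abel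
      _ ≤ _ := norm_add_le _ _
      _ < r := by linarith [hnorm z hz]
  obtain ⟨hφ1, hφg⟩ := gradient_mollify h.integrable_fun.locallyIntegrable
    h.integrable_grad.locallyIntegrable h.weak hρs hρc
  set φ : Euc n → ℝ := fun x => ∫ z, ρ z • w (x - z) with hφ
  -- the support of the mollified function
  set S : Set (Euc n) := Metric.closedBall (s • e) (κ * s / 2) +
    closure Ω ∩ Metric.closedBall x₀ (r / 2)
  have hScomp : IsCompact S := (isCompact_closedBall _ _).add
    ((isCompact_closedBall _ _).inter_left isClosed_closure)
  have hSsub : S ⊆ Ω := by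
    rintro x ⟨z, hz, y, hy, rfl⟩
    rw [mem_closedBall_iff_norm] at hz
    by_contra hxΩ
    have hyz : z + y - z = y := by abel
    have h1 := (hshift (z + y) (hnear _ z hz (by rw [hyz]; exact hy.2)) s hsI z (hball z hz)).2 hxΩ
    rw [hyz] at h1
    exact h1 hy.1
  have hsuppφ : Function.support φ ⊆ S := by
    intro x hx
    obtain ⟨z, hz⟩ : ∃ z, ρ z • w (x - z) ≠ 0 := by
      by_contra hcon
      push Not at hcon
      exact hx (by simp only [hφ, hcon, integral_zero])
    have hz1 : ρ z ≠ 0 := fun hz1 => hz (by simp [hz1])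
    have hz2 : w (x - z) ≠ 0 := fun hz2 => hz (by simp [hz2])
    refine ⟨z, mem_closedBall_iff_norm.2 (hsupp z hz1).le, x - z, ⟨subset_closure ?_, ?_⟩, by
      simp⟩
    · by_contra hc; exact hz2 (h.fun_eq_zero _ hc)
    · by_contra hc; exact hz2 (hw0 _ hc)
  have hφc : HasCompactSupport φ := HasCompactSupport.intro' hScomp hScomp.isClosed fun x hx => by
    by_contra hne; exact hx (hsuppφ hne)
  have hφΩ : tsupport φ ⊆ Ω := (closure_minimal hsuppφ hScomp.isClosed).trans hSsub
  -- on `U` only values on `D` matter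
  have hind : ∀ {F : Type} [NormedAddCommGroup F] [NormedSpace ℝ F] (g : Euc n → F),
      (∀ x ∉ Metric.closedBall x₀ (r / 2), g x = 0) → ∀ x ∈ U,
        ∫ z, ρ z • g (x - z) = ∫ z, ρ z • D.indicator g (x - z) := by
    intro F _ _ g hg x hx
    refine integral_congr_ae (Eventually.of_forall fun z => ?_)
    simp only
    by_cases hz : ρ z = 0
    · simp [hz]
    by_cases hxz : x - z ∈ Metric.closedBall x₀ (r / 2)
    · have hz' := (hsupp z hz).le
      have h1 := (hshift x (hnear x z hz' hxz) s hsI z (hball z hz')).1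
        (fun hxA => hA hxA (hUD hx))
      rw [indicator_of_mem h1]
    · by_cases hxD : x - z ∈ D
      · rw [indicator_of_mem hxD]
      · rw [indicator_of_notMem hxD, hg _ hxz]
  refine ⟨W1.ofTest U p hφ1 hφc, ⟨φ, hφ1, hφc, hφΩ, W1.sobFun_ofTest _ _⟩, ?_⟩
  rw [dist_eq_norm]
  have hhalf : ENNReal.ofReal (ε / 2) < ENNReal.ofReal ε :=
    (ENNReal.ofReal_lt_ofReal_iff hε).2 (by linarith)
  refine norm_W1_lt (lt_of_le_of_lt (eLpNorm_le_of_lintegral_le hp0 ?_) hhalf)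
    (lt_of_le_of_lt (eLpNorm_le_of_lintegral_le hp0 ?_) hhalf)
  · refine le_trans ?_ (H₁ ρ hρs.continuous hρc hρ0 hρ1
      fun z hz => (hnorm z (hsupp z hz).le).trans hsδ₁)
    refine le_trans (le_of_eq ?_) (setLIntegral_le_lintegral U _)
    refine lintegral_congr_ae ?_
    filter_upwards [sobFun_sub (h.toW1 hUD) (W1.ofTest U p hφ1 hφc), h.sobFun_toW1 hUD,
      W1.sobFun_ofTest (U := U) (p := p) hφ1 hφc, ae_restrict_mem hU] with x h1 h2 h3 hx
    rw [h1, h2, h3, hφ]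
    simp only
    rw [hind w hw0 x hx, ← enorm_neg, neg_sub, indicator_of_mem (hUD hx)]
  · refine le_trans ?_ (H₂ ρ hρs.continuous hρc hρ0 hρ1
      fun z hz => (hnorm z (hsupp z hz).le).trans hsδ₂)
    refine le_trans (le_of_eq ?_) (setLIntegral_le_lintegral U _)
    refine lintegral_congr_ae ?_
    filter_upwards [sobGrad_sub (h.toW1 hUD) (W1.ofTest U p hφ1 hφc), h.sobGrad_toW1 hUD,
      W1.sobGrad_ofTest (U := U) (p := p) hφ1 hφc, ae_restrict_mem hU] with x h1 h2 h3 hx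
    rw [h1, h2, h3, hφg, hind G hG0 x hx, ← enorm_neg, neg_sub, indicator_of_mem (hUD hx)]

/-- The restriction to `Ω \ closure A` of a Sobolev pair is a limit of test functions. -/
theorem IsSobolevPair.toW1_mem (hgeo : IsAdmissibleGeometry Ω A)
    (h : IsSobolevPair Ω (closure A)ᶜ p w G) (hUD : Ω \ closure A ⊆ (closure A)ᶜ) :
    h.toW1 hUD ∈ vanishingOn (Ω \ closure A) Ω p := by
  have hDo : IsOpen (closure A)ᶜ := isClosed_closure.isOpen_compl
  have hBo : IsOpen (Ω \ closure A) := hgeo.isOpen.sdiff isClosed_closure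
  have hcomp : IsCompact (closure (Ω \ closure A)) :=
    (hgeo.isBounded.subset sdiff_subset).isCompact_closure
  have hAcl : ∀ x ∈ closure (Ω \ closure A), x ∉ A := by
    intro x hx hxA
    obtain ⟨y, hy, hyB⟩ := mem_closure_iff.1 hx A hgeo.isOpen_inner hxA
    exact hyB.2 (subset_closure hy)
  -- functions vanishing off a subset of the closure, which is enlarged step by step
  let P : Set (Euc n) → Prop := fun s => ∀ (w : Euc n → ℝ) (G : Euc n → Euc n)
    (h : IsSobolevPair Ω (closure A)ᶜ p w G), (∀ x ∈ Ω \ closure A, x ∉ s → w x = 0) →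
      h.toW1 hUD ∈ vanishingOn (Ω \ closure A) Ω p
  have hPmono : ∀ {s t : Set (Euc n)}, s ⊆ t → P t → P s := fun hst ht w G h h0 =>
    ht w G h fun x hx hxt => h0 x hx fun hxs => hxt (hst hxs)
  have hPempty : P ∅ := by
    intro w G h h0
    have h1 : h.toW1 hUD = 0 := by
      refine W1.ext_of_ae hBo ((h.sobFun_toW1 hUD).trans ?_)
      have hz : sobFun (0 : W1 (Ω \ closure A) p) =ᵐ[volume.restrict (Ω \ closure A)] 0 :=
        Lp.coeFn_zero _ _ _
      filter_upwards [hz, ae_restrict_mem hBo.measurableSet] with x hx hxB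
      rw [hx, h0 x hxB (notMem_empty x), Pi.zero_apply]
    rw [h1]
    exact zero_mem_vanishingOn
  have key : ∀ T, P T → P (closure (Ω \ closure A) ∪ T) := by
    refine hcomp.induction_on (p := fun s => ∀ T, P T → P (s ∪ T)) ?_ ?_ ?_ ?_
    · intro T hT
      rwa [empty_union]
    · exact fun s t hst ht T hT => hPmono (union_subset_union_left T hst) (ht T hT)
    · intro s t hs ht T hT
      rw [union_assoc]
      exact hs _ (ht T hT)
    · intro x₀ hx₀
      obtain ⟨e, r, κ, he, hr, hκ, hκ1, hshift⟩ := hgeo.exists_shift (hAcl x₀ hx₀)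
      refine ⟨Metric.ball x₀ (r / 4),
        mem_nhdsWithin_of_mem_nhds (Metric.ball_mem_nhds x₀ (by positivity)), ?_⟩
      intro T hT w G h h0
      let b : ContDiffBump x₀ := ⟨r / 4, r / 2, by positivity, by linarith⟩
      have hb : ContDiff ℝ ∞ b := b.contDiff
      have hbt : tsupport b = Metric.closedBall x₀ (r / 2) := b.tsupport_eq
      have hloc := h.mul_smooth hb b.hasCompactSupport
      have hrest := h.sub hloc
      have m1 : hloc.toW1 hUD ∈ vanishingOn (Ω \ closure A) Ω p := by
        refine hloc.toW1_mem_of_local (A := A) hDo he hr hκ hκ1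
          (fun x hx => not_not.2 (subset_closure hx)) hshift ?_ ?_ hBo.measurableSet hUD
        · intro x hx
          rw [image_eq_zero_of_notMem_tsupport (f := b) (by rwa [hbt]), zero_mul]
        · intro x hx
          rw [image_eq_zero_of_notMem_tsupport (f := b) (by rwa [hbt]),
            gradient_eq_zero_of_notMem_tsupport (φ := b) (by rwa [hbt]), zero_smul, smul_zero, add_zero]
      have m2 : hrest.toW1 hUD ∈ vanishingOn (Ω \ closure A) Ω p := by
        refine hT _ _ hrest fun x hx hxT => ?_
        by_cases hxb : x ∈ Metric.ball x₀ (r / 4)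
        · rw [b.one_of_mem_closedBall (Metric.ball_subset_closedBall hxb), one_mul, sub_self]
        · rw [h0 x hx (by rintro (h' | h') <;> contradiction), mul_zero, sub_zero]
      have hsum : h.toW1 hUD = hloc.toW1 hUD + hrest.toW1 hUD := by
        refine W1.ext_of_ae hBo ((h.sobFun_toW1 hUD).trans ?_)
        filter_upwards [sobFun_add (hloc.toW1 hUD) (hrest.toW1 hUD), hloc.sobFun_toW1 hUD,
          hrest.sobFun_toW1 hUD] with x h1 h2 h3
        rw [h1, h2, h3]
        ring
      rw [hsum]
      exact add_mem_vanishingOn m1 m2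
  exact key ∅ hPempty w G h fun x hx hx' => absurd (Or.inl (subset_closure hx)) hx'

end Density

section Restriction

variable {n : ℕ} {Ω A U V : Set (Euc n)} {p q : ℝ} [Fact (1 < p)] [Fact (1 < q)]

theorem exists_W1_restrict (hU : MeasurableSet U) (hVU : V ⊆ U) (u : W1 U p) :
    ∃ v : W1 V p, sobFun v =ᵐ[volume.restrict V] sobFun u ∧
      sobGrad v =ᵐ[volume.restrict V] sobGrad u :=
  ⟨W1.of ((memLp_sobFun u).mono_measure (Measure.restrict_mono hVU le_rfl))
    ((memLp_sobGrad u).mono_measure (Measure.restrict_mono hVU le_rfl))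
    ((isWeakGradient_sobGrad u).mono hVU hU), W1.sobFun_of _ _ _, W1.sobGrad_of _ _ _⟩

theorem exists_W1_lower (hU : volume U ≠ ⊤) (hqp : q ≤ p) (u : W1 U p) :
    ∃ v : W1 U q, sobFun v =ᵐ[volume.restrict U] sobFun u ∧
      sobGrad v =ᵐ[volume.restrict U] sobGrad u := by
  have : IsFiniteMeasure (volume.restrict U) := ⟨by simpa using hU.lt_top⟩
  have hle : ENNReal.ofReal q ≤ ENNReal.ofReal p := ENNReal.ofReal_le_ofReal hqp
  exact ⟨W1.of ((memLp_sobFun u).mono_exponent hle) ((memLp_sobGrad u).mono_exponent hle)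
    (isWeakGradient_sobGrad u), W1.sobFun_of _ _ _, W1.sobGrad_of _ _ _⟩

theorem eqOnBoundary_iff (hU : IsOpen U) {v g : W1 U p} {f : Euc n → ℝ}
    (hg : sobFun g =ᵐ[volume.restrict U] f) :
    EqOnBoundary Ω v f ↔ v - g ∈ vanishingOn U Ω p := by
  constructor
  · rintro ⟨w, hw, hvw⟩
    have : v - g = w := by
      refine W1.ext_of_ae hU ?_
      filter_upwards [sobFun_sub v g, hg, hvw] with x h1 h2 h3
      rw [h1, h2, h3]
    rwa [this]
  · intro h
    refine ⟨v - g, h, ?_⟩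
    filter_upwards [sobFun_sub v g, hg] with x h1 h2
    rw [h1, h2]

theorem memLp_of_lintegral_rpow_ne_top {F : Type*} [NormedAddCommGroup F] {r : ℝ} (hr : 0 < r)
    {μ : Measure (Euc n)} {g : Euc n → F} (hg : AEStronglyMeasurable g μ)
    (h : ∫⁻ x, ‖g x‖ₑ ^ r ∂μ ≠ ⊤) : MemLp g (ENNReal.ofReal r) μ := by
  refine ⟨hg, ?_⟩
  rw [eLpNorm_eq_lintegral_rpow_enorm_toReal (by simpa using hr) ENNReal.ofReal_ne_top,
    ENNReal.toReal_ofReal hr.le]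
  exact ENNReal.rpow_lt_top_of_nonneg (by positivity) h

theorem lintegral_rpow_ne_top_of_memLp {F : Type*} [NormedAddCommGroup F] {r : ℝ} (hr : 0 < r)
    {μ : Measure (Euc n)} {g : Euc n → F} (h : MemLp g (ENNReal.ofReal r) μ) :
    ∫⁻ x, ‖g x‖ₑ ^ r ∂μ ≠ ⊤ := by
  have h1 := h.2
  rw [eLpNorm_lt_top_iff_lintegral_rpow_enorm_lt_top (by simpa using hr) ENNReal.ofReal_ne_top,
    ENNReal.toReal_ofReal hr.le] at h1
  exact h1.ne

/-- A function in `W_0^{1,q}(Ω)` with gradient in `L^p(Ω \ closure A)` restricts to a function in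
`W^{1,p}(Ω \ closure A)` that vanishes on `∂Ω`. -/
theorem IsAdmissibleGeometry.exists_restrict_vanishingOn [Nonempty (Fin n)]
    (hgeo : IsAdmissibleGeometry Ω A) {w : W1 Ω q} (hw : w ∈ vanishingOn Ω Ω q)
    (hG : MemLp (sobGrad w) (ENNReal.ofReal p) (volume.restrict (Ω \ closure A))) :
    ∃ u ∈ vanishingOn (Ω \ closure A) Ω p,
      sobFun u =ᵐ[volume.restrict (Ω \ closure A)] sobFun w ∧
      sobGrad u =ᵐ[volume.restrict (Ω \ closure A)] sobGrad w := by
  have hp : 1 < p := Fact.out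
  have hp0 : 0 < p := by linarith
  have hΩm := hgeo.isOpen.measurableSet
  have hBo : IsOpen (Ω \ closure A) := hgeo.isOpen.sdiff isClosed_closure
  set w₀ := Ω.indicator (sobFun w) with hw₀
  set G₀ := Ω.indicator (sobGrad w) with hG₀
  have hw₀m : Measurable w₀ :=
    (Lp.stronglyMeasurable w.1.1).measurable.indicator hΩm
  have hG₀m : Measurable G₀ :=
    (Lp.stronglyMeasurable w.1.2).measurable.indicator hΩm
  have hfin : IsFiniteMeasure (volume.restrict Ω) :=
    ⟨by simpa using hgeo.isBounded.measure_lt_top⟩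
  have hq1 : 1 ≤ ENNReal.ofReal q := Fact.out
  have hwi : Integrable w₀ :=
    (integrable_indicator_iff hΩm).2 ((memLp_sobFun w).integrable hq1)
  have hGi : Integrable G₀ :=
    (integrable_indicator_iff hΩm).2 ((memLp_sobGrad w).integrable hq1)
  have hw0 : ∀ x ∉ Ω, w₀ x = 0 := fun x hx => indicator_of_notMem hx _
  have hG0 : ∀ x ∉ Ω, G₀ x = 0 := fun x hx => indicator_of_notMem hx _
  have hlim := isTestLimit_indicator hgeo.isOpen hgeo.isBounded hw
  have hres : (volume.restrict (closure A)ᶜ).restrict Ω = volume.restrict (Ω \ closure A) := by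
    rw [Measure.restrict_restrict hΩm]; rfl
  have hgrad : MemLp G₀ (ENNReal.ofReal p) (volume.restrict (closure A)ᶜ) := by
    rwa [hG₀, memLp_indicator_iff_restrict hΩm, hres]
  have hGB : ∫⁻ x in Ω \ closure A, ‖G₀ x‖ₑ ^ p ≠ ⊤ :=
    lintegral_rpow_ne_top_of_memLp hp0
      (hgrad.mono_measure (Measure.restrict_mono (fun x hx => hx.2) le_rfl))
  obtain ⟨C, hC⟩ := hgeo.poincare hp
  have hwB := hC w₀ G₀ hw₀m hG₀m hw0 hG0 (hlim.lineBound hw₀m hG₀m)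
  have hfun : MemLp w₀ (ENNReal.ofReal p) (volume.restrict (closure A)ᶜ) := by
    rw [hw₀, memLp_indicator_iff_restrict hΩm, hres]
    refine memLp_of_lintegral_rpow_ne_top hp0
      (Lp.stronglyMeasurable w.1.1).aestronglyMeasurable ?_
    refine ne_top_of_le_ne_top (ENNReal.mul_ne_top ENNReal.coe_ne_top hGB) (le_trans (le_of_eq ?_) hwB)
    refine setLIntegral_congr_fun hBo.measurableSet fun x hx => ?_
    simp only [hw₀, indicator_of_mem hx.1]
  have hpair : IsSobolevPair Ω (closure A)ᶜ p w₀ G₀ :=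
    ⟨hw₀m, hG₀m, hw0, hG0, hwi, hGi, hfun, hgrad, hlim.isWeakGradient hwi hGi⟩
  have hUD : Ω \ closure A ⊆ (closure A)ᶜ := fun x hx => hx.2
  refine ⟨hpair.toW1 hUD, hpair.toW1_mem hgeo hUD, ?_, ?_⟩
  · filter_upwards [hpair.sobFun_toW1 hUD, ae_restrict_mem hBo.measurableSet] with x h1 hx
    rw [h1, hw₀, indicator_of_mem hx.1]
  · filter_upwards [hpair.sobGrad_toW1 hUD, ae_restrict_mem hBo.measurableSet] with x h1 hx
    rw [h1, hG₀, indicator_of_mem hx.1]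

/-- Poincaré inequality in the space of functions vanishing on `∂Ω`. -/
theorem IsAdmissibleGeometry.exists_norm_le_norm_grad [Nonempty (Fin n)]
    (hgeo : IsAdmissibleGeometry Ω A) :
    ∃ C : ℝ, 0 ≤ C ∧ ∀ u ∈ vanishingOn (Ω \ closure A) Ω p, ‖u‖ ≤ C * ‖u.1.2‖ := by
  have hp : 1 < p := Fact.out
  have hp0 : 0 < p := by linarith
  obtain ⟨C, hC⟩ := hgeo.poincare hp
  set c : ℝ≥0 := C ^ (1 / p) with hc
  have hmain : ∀ u ∈ vanishingOn (Ω \ closure A) Ω p, ‖u.1.1‖ ≤ c * ‖u.1.2‖ := by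
    intro u hu
    have hcl : IsClosed {u : W1 (Ω \ closure A) p | ‖u.1.1‖ ≤ c * ‖u.1.2‖} :=
      isClosed_le (by fun_prop) (by fun_prop)
    refine closure_minimal ?_ hcl hu
    rintro v ⟨φ, hφ, hφc, hφs, hv⟩
    have hBo : IsOpen (Ω \ closure A) := hgeo.isOpen.sdiff isClosed_closure
    obtain rfl : v = W1.ofTest _ p hφ hφc :=
      W1.ext_of_ae hBo (hv.trans (W1.sobFun_ofTest hφ hφc).symm)
    have h1 := hC φ (gradient φ) hφ.continuous.measurable (continuous_gradient hφ).measurable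
      (fun x hx => image_eq_zero_of_notMem_tsupport fun h => hx (hφs h))
      (fun x hx => gradient_eq_zero_of_notMem_tsupport fun h => hx (hφs h))
      (fun h => Eventually.of_forall fun x => enorm_sub_le_lintegral_gradient hφ x h)
    have h2 : eLpNorm φ (ENNReal.ofReal p) (volume.restrict (Ω \ closure A)) ≤
        c * eLpNorm (gradient φ) (ENNReal.ofReal p) (volume.restrict (Ω \ closure A)) := by
      refine eLpNorm_le_of_lintegral_le hp0 (h1.trans_eq ?_)
      rw [eLpNorm_eq_lintegral_rpow_enorm_toReal (by simpa using hp0) ENNReal.ofReal_ne_top,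
        ENNReal.toReal_ofReal hp0.le, ENNReal.mul_rpow_of_nonneg _ _ hp0.le, ← ENNReal.rpow_mul,
        one_div_mul_cancel hp0.ne', ENNReal.rpow_one, hc,
        ENNReal.coe_rpow_of_nonneg _ (by positivity), ← ENNReal.rpow_mul,
        one_div_mul_cancel hp0.ne', ENNReal.rpow_one]
    have h3 := eLpNorm_congr_ae (p := ENNReal.ofReal p) (W1.sobFun_ofTest (U := Ω \ closure A) (p := p) hφ hφc)
    have h4 := eLpNorm_congr_ae (p := ENNReal.ofReal p) (W1.sobGrad_ofTest (U := Ω \ closure A) (p := p) hφ hφc)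
    rw [← h3, ← h4] at h2
    have h5 := ENNReal.toReal_mono
      (ENNReal.mul_ne_top ENNReal.coe_ne_top (memLp_sobGrad (W1.ofTest _ p hφ hφc)).2.ne) h2
    rw [ENNReal.toReal_mul, ENNReal.coe_toReal] at h5
    exact h5
  refine ⟨max c 1, by positivity, fun u hu => ?_⟩
  rw [norm_W1]
  refine max_le ((hmain u hu).trans ?_) ?_
  · gcongr; exact le_max_left _ _
  · exact le_mul_of_one_le_left (norm_nonneg _) (le_max_right _ _)

end Restriction

section PowerInequalities

variable {n : ℕ} {p : ℝ}

theorem rpow_sub_two_mul_inner_self (hp : 1 < p) (η : Euc n) :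
    ‖η‖ ^ (p - 2) * inner ℝ η η = ‖η‖ ^ p := by
  rw [real_inner_self_eq_norm_sq]
  rcases eq_or_ne η 0 with rfl | hη
  · simp [Real.zero_rpow (by linarith : p ≠ 0)]
  · have h : 0 < ‖η‖ := norm_pos_iff.2 hη
    rw [← Real.rpow_natCast, ← Real.rpow_add h]
    norm_num

theorem abs_rpow_sub_two_mul_inner_le (hp : 1 < p) (η ξ : Euc n) :
    |‖η‖ ^ (p - 2) * inner ℝ η ξ| ≤ ‖η‖ ^ (p - 1) * ‖ξ‖ := by
  rcases eq_or_ne η 0 with rfl | hη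
  · simp [Real.zero_rpow (by linarith : p - 1 ≠ 0)]
  · have h : 0 < ‖η‖ := norm_pos_iff.2 hη
    rw [abs_mul, abs_of_nonneg (by positivity)]
    calc ‖η‖ ^ (p - 2) * |inner ℝ η ξ| ≤ ‖η‖ ^ (p - 2) * (‖η‖ * ‖ξ‖) := by
          gcongr; exact abs_real_inner_le_norm _ _
      _ = ‖η‖ ^ (p - 1) * ‖ξ‖ := by
          rw [← mul_assoc]
          nth_rewrite 2 [← Real.rpow_one ‖η‖]
          rw [← Real.rpow_add h]
          congr 2; ring

theorem mul_rpow_sub_one_mul_le (hp : 1 < p) {a b : ℝ} (ha : 0 ≤ a) (hb : 0 ≤ b) :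
    p * (a ^ (p - 1) * b) ≤ b ^ p + (p - 1) * a ^ p := by
  have hpq := Real.HolderConjugate.conjExponent hp
  have h := Real.young_inequality_of_nonneg hb (Real.rpow_nonneg ha (p - 1)) hpq
  have h1 : (a ^ (p - 1)) ^ p.conjExponent = a ^ p := by
    rw [← Real.rpow_mul ha, hpq.sub_one_mul_conj]
  rw [h1] at h
  have h2 : p / p.conjExponent = p - 1 := hpq.div_conj_eq_sub_one
  have hp0 : 0 < p := by linarith
  calc p * (a ^ (p - 1) * b) = p * (b * a ^ (p - 1)) := by ring
    _ ≤ p * (b ^ p / p + a ^ p / p.conjExponent) := by gcongr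
    _ = b ^ p + p / p.conjExponent * a ^ p := by field_simp
    _ = _ := by rw [h2]

/-- First order convexity of `‖·‖^p`. -/
theorem rpow_norm_add_inner_le (hp : 1 < p) (η ξ : Euc n) :
    ‖η‖ ^ p + p * (‖η‖ ^ (p - 2) * inner ℝ η (ξ - η)) ≤ ‖ξ‖ ^ p := by
  have h1 := mul_rpow_sub_one_mul_le hp (norm_nonneg η) (norm_nonneg ξ)
  have h2 := (abs_le.1 (abs_rpow_sub_two_mul_inner_le hp η ξ)).2
  have h3 := rpow_sub_two_mul_inner_self hp η
  rw [inner_sub_right, mul_sub, h3]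
  nlinarith

theorem rpow_norm_midpoint_lt (hp : 1 < p) {a b : Euc n} (hab : a ≠ b) :
    ‖(1 / 2 : ℝ) • (a + b)‖ ^ p < 1 / 2 * ‖a‖ ^ p + 1 / 2 * ‖b‖ ^ p := by
  have hp0 : 0 < p := by linarith
  by_cases hn : ‖a‖ = ‖b‖
  · have h1 : ‖(1 / 2 : ℝ) • a + (1 / 2 : ℝ) • b‖ < ‖b‖ :=
      norm_combo_lt_of_ne hn.le le_rfl hab (by norm_num) (by norm_num) (by norm_num)
    rw [smul_add, hn]
    have h2 := Real.rpow_lt_rpow (norm_nonneg _) h1 hp0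
    linarith
  · have h1 := (strictConvexOn_rpow hp).2 (norm_nonneg a) (norm_nonneg b) hn
      (show (0 : ℝ) < 1 / 2 by norm_num) (show (0 : ℝ) < 1 / 2 by norm_num) (by norm_num)
    simp only [smul_eq_mul] at h1
    refine lt_of_le_of_lt (Real.rpow_le_rpow (norm_nonneg _) ?_ hp0.le) h1
    rw [smul_add]
    refine (norm_add_le _ _).trans_eq ?_
    rw [norm_smul, norm_smul]
    norm_num

theorem rpow_norm_midpoint_le (hp : 1 < p) (a b : Euc n) :
    ‖(1 / 2 : ℝ) • (a + b)‖ ^ p ≤ 1 / 2 * ‖a‖ ^ p + 1 / 2 * ‖b‖ ^ p := by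
  rcases eq_or_ne a b with rfl | h
  · rw [← two_smul ℝ a, smul_smul]
    norm_num
    linarith
  · exact (rpow_norm_midpoint_lt hp h).le

/-- Uniform convexity of `‖·‖^p`. -/
theorem exists_rpow_norm_sub_le (hp : 1 < p) {ε : ℝ} (hε : 0 < ε) :
    ∃ C : ℝ, 0 ≤ C ∧ ∀ a b : Euc n, ‖a - b‖ ^ p ≤ ε * (‖a‖ ^ p + ‖b‖ ^ p) +
      C * (1 / 2 * ‖a‖ ^ p + 1 / 2 * ‖b‖ ^ p - ‖(1 / 2 : ℝ) • (a + b)‖ ^ p) := by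
  have hp0 : 0 < p := by linarith
  let d : Euc n × Euc n → ℝ := fun z =>
    1 / 2 * ‖z.1‖ ^ p + 1 / 2 * ‖z.2‖ ^ p - ‖(1 / 2 : ℝ) • (z.1 + z.2)‖ ^ p
  have hpow : Continuous fun x : Euc n => ‖x‖ ^ p :=
    continuous_norm.rpow_const fun _ => Or.inr hp0.le
  have c1 : Continuous fun z : Euc n × Euc n => ‖z.1‖ ^ p := hpow.comp continuous_fst
  have c2 : Continuous fun z : Euc n × Euc n => ‖z.2‖ ^ p := hpow.comp continuous_snd
  have c3 : Continuous fun z : Euc n × Euc n => ‖z.1 - z.2‖ ^ p :=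
    hpow.comp (continuous_fst.sub continuous_snd)
  have hd : Continuous d := ((continuous_const.mul c1).add (continuous_const.mul c2)).sub
    (hpow.comp (f := fun z : Euc n × Euc n => (1 / 2 : ℝ) • (z.1 + z.2)) (by fun_prop))
  have hle1 : ∀ x : Euc n, ‖x‖ ^ p ≤ 1 → ‖x‖ ≤ 1 := fun x hx => by
    by_contra hlt
    exact absurd hx (not_le.2 (Real.one_lt_rpow (not_le.1 hlt) hp0))
  let K : Set (Euc n × Euc n) := {z | ‖z.1‖ ^ p + ‖z.2‖ ^ p = 1 ∧ ε ≤ ‖z.1 - z.2‖ ^ p}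
  have hKb : ∀ z : Euc n × Euc n, ‖z.1‖ ^ p + ‖z.2‖ ^ p = 1 → ‖z.1‖ ≤ 1 ∧ ‖z.2‖ ≤ 1 := by
    intro z hz
    have h1 : 0 ≤ ‖z.1‖ ^ p := by positivity
    have h2 : 0 ≤ ‖z.2‖ ^ p := by positivity
    exact ⟨hle1 _ (by linarith), hle1 _ (by linarith)⟩
  have hK : IsCompact K := by
    refine Metric.isCompact_of_isClosed_isBounded ?_ ?_
    · exact (isClosed_eq (c1.add c2) continuous_const).inter (isClosed_le continuous_const c3)
    · refine (Metric.isBounded_closedBall (x := 0) (r := 1)).subset fun z hz => ?_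
      rw [mem_closedBall_zero_iff]
      exact max_le (hKb z hz.1).1 (hKb z hz.1).2
  obtain ⟨δ, hδ, hδK⟩ : ∃ δ : ℝ, 0 < δ ∧ ∀ z ∈ K, δ ≤ d z := by
    rcases K.eq_empty_or_nonempty with hKe | hKn
    · exact ⟨1, one_pos, by simp [hKe]⟩
    · obtain ⟨z, hz, hmin⟩ := hK.exists_isMinOn hKn hd.continuousOn
      refine ⟨d z, ?_, fun y hy => hmin hy⟩
      have hne : z.1 ≠ z.2 := by
        intro h
        have := hz.2
        rw [h, sub_self, norm_zero, Real.zero_rpow hp0.ne'] at this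
        linarith
      have := rpow_norm_midpoint_lt hp hne
      simp only [d]
      linarith
  refine ⟨2 ^ p / δ, by positivity, fun a b => ?_⟩
  have hunit : ∀ z : Euc n × Euc n, ‖z.1‖ ^ p + ‖z.2‖ ^ p = 1 →
      ‖z.1 - z.2‖ ^ p ≤ ε + 2 ^ p / δ * d z := by
    intro z hz
    have hdz : 0 ≤ d z := by
      have := rpow_norm_midpoint_le hp z.1 z.2
      simp only [d]; linarith
    by_cases hzε : ε ≤ ‖z.1 - z.2‖ ^ p
    · have h1 : ‖z.1 - z.2‖ ^ p ≤ 2 ^ p := by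
        refine Real.rpow_le_rpow (norm_nonneg _) ?_ hp0.le
        linarith [norm_sub_le z.1 z.2, (hKb z hz).1, (hKb z hz).2]
      have h2 := hδK z ⟨hz, hzε⟩
      have h3 : (2 : ℝ) ^ p ≤ 2 ^ p / δ * d z := by
        rw [div_mul_eq_mul_div, le_div_iff₀ hδ]
        gcongr
      linarith
    · have : 0 ≤ 2 ^ p / δ * d z := by positivity
      linarith
  set S : ℝ := ‖a‖ ^ p + ‖b‖ ^ p with hS
  have hS0 : 0 ≤ S := by positivity
  rcases hS0.eq_or_lt with hS1 | hS1
  · have ha : 0 ≤ ‖a‖ ^ p := by positivity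
    have hb : 0 ≤ ‖b‖ ^ p := by positivity
    have ha0 : a = 0 := by
      by_contra hne
      have := Real.rpow_pos_of_pos (norm_pos_iff.2 hne) p
      linarith
    have hb0 : b = 0 := by
      by_contra hne
      have := Real.rpow_pos_of_pos (norm_pos_iff.2 hne) p
      linarith
    simp [hS, ha0, hb0, Real.zero_rpow hp0.ne']
  · set t : ℝ := S ^ (1 / p) with ht
    have ht0 : 0 < t := Real.rpow_pos_of_pos hS1 _
    have htp : t ^ p = S := by
      rw [ht, ← Real.rpow_mul hS0, one_div_mul_cancel hp0.ne', Real.rpow_one]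
    have hsc : ∀ x : Euc n, ‖t⁻¹ • x‖ ^ p = ‖x‖ ^ p / S := by
      intro x
      rw [norm_smul, norm_inv, Real.norm_of_nonneg ht0.le, Real.mul_rpow (by positivity)
        (norm_nonneg _), Real.inv_rpow ht0.le, htp]
      ring
    have h1 := hunit (t⁻¹ • a, t⁻¹ • b) (by
      simp only [hsc]
      rw [← add_div, ← hS, div_self hS1.ne'])
    simp only [d] at h1
    rw [← smul_sub, ← smul_add, smul_comm, hsc, hsc, hsc, hsc] at h1
    have h2 := mul_le_mul_of_nonneg_right h1 hS0
    have h3 : ‖a - b‖ ^ p / S * S = ‖a - b‖ ^ p := div_mul_cancel₀ _ hS1.ne'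
    rw [h3] at h2
    refine h2.trans_eq ?_
    field_simp

/-- The excess of `‖·‖^p` over its tangent at `η` controls the distance to `η`. -/
theorem exists_rpow_norm_sub_le_excess (hp : 1 < p) {ε : ℝ} (hε : 0 < ε) :
    ∃ C : ℝ, 0 ≤ C ∧ ∀ η ξ : Euc n, ‖ξ - η‖ ^ p ≤ ε * (‖ξ‖ ^ p + ‖η‖ ^ p) +
      C * (‖ξ‖ ^ p - ‖η‖ ^ p - p * (‖η‖ ^ (p - 2) * inner ℝ η (ξ - η))) := by
  obtain ⟨C, hC, H⟩ := exists_rpow_norm_sub_le (n := n) hp hε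
  refine ⟨C / 2, by positivity, fun η ξ => (H ξ η).trans ?_⟩
  have h1 := rpow_norm_add_inner_le hp η ((1 / 2 : ℝ) • (ξ + η))
  have h2 : (1 / 2 : ℝ) • (ξ + η) - η = (1 / 2 : ℝ) • (ξ - η) := by module
  rw [h2, real_inner_smul_right] at h1
  have h3 : 1 / 2 * ‖ξ‖ ^ p + 1 / 2 * ‖η‖ ^ p - ‖(1 / 2 : ℝ) • (ξ + η)‖ ^ p ≤
      1 / 2 * (‖ξ‖ ^ p - ‖η‖ ^ p - p * (‖η‖ ^ (p - 2) * inner ℝ η (ξ - η))) := by linarith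
  nlinarith

theorem rpow_sub_one_mul_le (hp : 1 < p) {a b : ℝ} (ha : 0 ≤ a) (hb : 0 ≤ b) :
    a ^ (p - 1) * b ≤ a ^ p + b ^ p := by
  have h1 := mul_rpow_sub_one_mul_le hp ha hb
  have h2 : 0 ≤ a ^ p := by positivity
  have h3 : 0 ≤ b ^ p := by positivity
  have h4 : 0 ≤ a ^ (p - 1) * b := by positivity
  nlinarith

theorem abs_rpow_sub_two_mul_inner_le_add (hp : 1 < p) (η ξ : Euc n) :
    |‖η‖ ^ (p - 2) * inner ℝ η ξ| ≤ ‖η‖ ^ p + ‖ξ‖ ^ p :=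
  (abs_rpow_sub_two_mul_inner_le hp η ξ).trans
    (rpow_sub_one_mul_le hp (norm_nonneg _) (norm_nonneg _))

theorem continuous_rpow_sub_two_mul_inner (hp : 1 < p) (ξ : Euc n) :
    Continuous fun η : Euc n => ‖η‖ ^ (p - 2) * inner ℝ η ξ := by
  rw [continuous_iff_continuousAt]
  intro η
  rcases eq_or_ne η 0 with rfl | hη
  · have h0 : Tendsto (fun η : Euc n => ‖η‖ ^ (p - 1) * ‖ξ‖) (𝓝 0) (𝓝 0) := by
      have hc : Continuous fun η : Euc n => ‖η‖ ^ (p - 1) * ‖ξ‖ :=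
        (continuous_norm.rpow_const fun _ => Or.inr (by linarith)).mul continuous_const
      have := hc.tendsto 0
      simpa [Real.zero_rpow (by linarith : p - 1 ≠ 0)] using this
    have h1 : Tendsto (fun η : Euc n => ‖η‖ ^ (p - 2) * inner ℝ η ξ) (𝓝 0) (𝓝 0) :=
      squeeze_zero_norm
        (fun η => (Real.norm_eq_abs _).trans_le (abs_rpow_sub_two_mul_inner_le hp η ξ)) h0
    simpa [ContinuousAt] using h1
  · refine ContinuousAt.mul ?_ (by fun_prop)
    exact continuousAt_id.norm.rpow_const (Or.inl (norm_ne_zero_iff.2 hη))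

theorem add_rpow_norm_le (hp : 1 < p) (a b : Euc n) :
    ‖a + b‖ ^ p ≤ 2 ^ (p - 1) * (‖a‖ ^ p + ‖b‖ ^ p) := by
  have h := rpow_norm_midpoint_le hp a b
  have h2 : ‖(1 / 2 : ℝ) • (a + b)‖ ^ p = ‖a + b‖ ^ p / 2 ^ p := by
    rw [norm_smul, Real.mul_rpow (norm_nonneg _) (norm_nonneg _)]
    rw [Real.norm_of_nonneg (by norm_num), Real.div_rpow zero_le_one zero_le_two, Real.one_rpow]
    ring
  rw [h2, div_le_iff₀ (by positivity)] at h
  refine h.trans_eq ?_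
  rw [Real.rpow_sub_one two_ne_zero]
  ring

end PowerInequalities

section WeightedEnergy

variable {n : ℕ} {U : Set (Euc n)} {p : ℝ} [Fact (1 < p)] {β : Euc n → ℝ} {b₀ b₁ : ℝ}

/-- `β` is a measurable weight on `U` with values in `[b₀, b₁]`, `b₀ > 0`. -/
structure IsWeight (U : Set (Euc n)) (β : Euc n → ℝ) (b₀ b₁ : ℝ) : Prop where
  aemeasurable : AEMeasurable β (volume.restrict U)
  pos : 0 < b₀
  bounds : ∀ᵐ x ∂(volume.restrict U), b₀ ≤ β x ∧ β x ≤ b₁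

theorem integrable_norm_sobGrad_rpow (u : W1 U p) :
    Integrable (fun x => ‖sobGrad u x‖ ^ p) (volume.restrict U) := by
  have hp0 : 0 < p := zero_lt_one.trans Fact.out
  have h := (memLp_sobGrad u).integrable_norm_rpow (by simpa using hp0) ENNReal.ofReal_ne_top
  rwa [ENNReal.toReal_ofReal hp0.le] at h

theorem norm_rpow_eq_integral {F : Type*} [NormedAddCommGroup F] {μ : Measure (Euc n)}
    (g : Lp F (ENNReal.ofReal p) μ) : ‖g‖ ^ p = ∫ x, ‖g x‖ ^ p ∂μ := by
  have hp0 : 0 < p := zero_lt_one.trans Fact.out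
  rw [Lp.norm_def, (Lp.memLp g).eLpNorm_eq_integral_rpow_norm (by simpa using hp0)
    ENNReal.ofReal_ne_top, ENNReal.toReal_ofReal hp0.le, ENNReal.toReal_ofReal (by positivity),
    ← Real.rpow_mul (by positivity), inv_mul_cancel₀ hp0.ne', Real.rpow_one]

theorem IsWeight.integrable_mul (hβ : IsWeight U β b₀ b₁) {g : Euc n → ℝ}
    (hg : Integrable g (volume.restrict U)) :
    Integrable (fun x => β x * g x) (volume.restrict U) := by
  refine hg.bdd_mul (c := b₁) hβ.aemeasurable.aestronglyMeasurable ?_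
  filter_upwards [hβ.bounds] with x hx
  rw [Real.norm_of_nonneg (hβ.pos.le.trans hx.1)]
  exact hx.2

/-- The weighted `p`-energy as a real number. -/
noncomputable def pEnergy (β : Euc n → ℝ) (u : W1 U p) : ℝ :=
  ∫ x in U, β x * ‖sobGrad u x‖ ^ p

theorem IsWeight.integrable_energy (hβ : IsWeight U β b₀ b₁) (u : W1 U p) :
    Integrable (fun x => β x * ‖sobGrad u x‖ ^ p) (volume.restrict U) :=
  hβ.integrable_mul (integrable_norm_sobGrad_rpow u)

theorem IsWeight.pEnergy_nonneg (hβ : IsWeight U β b₀ b₁) (u : W1 U p) : 0 ≤ pEnergy β u := by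
  refine integral_nonneg_of_ae ?_
  filter_upwards [hβ.bounds] with x hx
  have := hβ.pos.le.trans hx.1
  positivity

theorem IsWeight.weightedEnergy_eq (hβ : IsWeight U β b₀ b₁) (u : W1 U p) :
    weightedEnergy β u = ENNReal.ofReal (pEnergy β u) := by
  rw [pEnergy, ofReal_integral_eq_lintegral_ofReal (hβ.integrable_energy u)]
  · rfl
  · filter_upwards [hβ.bounds] with x hx
    have := hβ.pos.le.trans hx.1
    simp only [Pi.zero_apply]
    positivity

theorem IsWeight.continuous_pEnergy (hβ : IsWeight U β b₀ b₁) :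
    Continuous (pEnergy β : W1 U p → ℝ) := by
  have hp0 : 0 < p := zero_lt_one.trans Fact.out
  have hm : MemLp (fun x => β x ^ (1 / p)) ⊤ (volume.restrict U) := by
    refine memLp_top_of_bound (hβ.aemeasurable.pow_const _).aestronglyMeasurable (b₁ ^ (1 / p)) ?_
    filter_upwards [hβ.bounds] with x hx
    have h0 := hβ.pos.le.trans hx.1
    rw [Real.norm_of_nonneg (by positivity)]
    exact Real.rpow_le_rpow h0 hx.2 (by positivity)
  let T : Lp (Euc n) (ENNReal.ofReal p) (volume.restrict U) →L[ℝ]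
      Lp (Euc n) (ENNReal.ofReal p) (volume.restrict U) :=
    (ContinuousLinearMap.lsmul ℝ ℝ).holderL (volume.restrict U) ⊤ (ENNReal.ofReal p)
      (ENNReal.ofReal p) (hm.toLp _)
  have hT : ∀ u : W1 U p, pEnergy β u = ‖T u.1.2‖ ^ p := by
    intro u
    rw [norm_rpow_eq_integral, pEnergy]
    refine integral_congr_ae ?_
    filter_upwards [(ContinuousLinearMap.lsmul ℝ ℝ).coeFn_holder (r := ENNReal.ofReal p)
      (hm.toLp _) u.1.2, hm.coeFn_toLp, hβ.bounds] with x h1 h2 h3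
    have h0 := hβ.pos.le.trans h3.1
    have h4 : T u.1.2 x = β x ^ (1 / p) • sobGrad u x := by
      refine h1.trans ?_
      rw [h2]; rfl
    rw [h4, norm_smul, Real.mul_rpow (norm_nonneg _) (norm_nonneg _),
      Real.norm_of_nonneg (by positivity), ← Real.rpow_mul h0, one_div_mul_cancel hp0.ne',
      Real.rpow_one]
  have h5 : (pEnergy β : W1 U p → ℝ) = fun u => ‖T u.1.2‖ ^ p := funext hT
  rw [h5]
  exact (T.continuous.comp (continuous_snd.comp continuous_subtype_val)).norm.rpow_const
    fun _ => Or.inr hp0.le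

theorem integral_le_of_convexity_defect {α : Type*} [MeasurableSpace α] {μ : Measure α}
    {d f g h : α → ℝ} {ε C : ℝ} (hd : Integrable d μ) (hf : Integrable f μ) (hg : Integrable g μ)
    (hh : Integrable h μ)
    (hle : ∀ᵐ x ∂μ, d x ≤ ε * (f x + g x) + C * (1 / 2 * f x + 1 / 2 * g x - h x)) :
    ∫ x, d x ∂μ ≤ ε * (∫ x, f x ∂μ + ∫ x, g x ∂μ) +
      C * (1 / 2 * ∫ x, f x ∂μ + 1 / 2 * ∫ x, g x ∂μ - ∫ x, h x ∂μ) := by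
  have i1 : Integrable (fun x => ε * (f x + g x)) μ := (hf.add hg).const_mul ε
  have i2 : Integrable (fun x => 1 / 2 * f x + 1 / 2 * g x) μ :=
    (hf.const_mul (1 / 2)).add (hg.const_mul (1 / 2))
  have i3 : Integrable (fun x => C * (1 / 2 * f x + 1 / 2 * g x - h x)) μ :=
    (i2.sub hh).const_mul C
  refine (integral_mono_ae hd (i1.add i3) hle).trans_eq ?_
  rw [integral_add' i1 i3, integral_const_mul, integral_const_mul, integral_sub i2 hh,
    integral_add hf hg, integral_add (hf.const_mul _) (hg.const_mul _), integral_const_mul,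
    integral_const_mul]

theorem IsWeight.exists_uniform_convexity (hβ : IsWeight U β b₀ b₁) {ε : ℝ} (hε : 0 < ε) :
    ∃ C : ℝ, 0 ≤ C ∧ ∀ u v : W1 U p, b₀ * ‖(u - v).1.2‖ ^ p ≤
      ε * (pEnergy β u + pEnergy β v) +
        C * (1 / 2 * pEnergy β u + 1 / 2 * pEnergy β v - pEnergy β ((1 / 2 : ℝ) • (u + v))) := by
  obtain ⟨C, hC, H⟩ := exists_rpow_norm_sub_le (n := n) (Fact.out : 1 < p) hε
  refine ⟨C, hC, fun u v => ?_⟩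
  have iu := hβ.integrable_energy u
  have iv := hβ.integrable_energy v
  have im := hβ.integrable_energy ((1 / 2 : ℝ) • (u + v))
  rw [norm_rpow_eq_integral, ← integral_const_mul]
  refine integral_le_of_convexity_defect ((integrable_norm_sobGrad_rpow (u - v)).const_mul b₀)
    iu iv im ?_
  filter_upwards [hβ.bounds, sobGrad_sub u v, sobGrad_smul (1 / 2 : ℝ) (u + v), sobGrad_add u v]
    with x hx h1 h2 h3
  have h4 := H (sobGrad u x) (sobGrad v x)
  have h0 := hβ.pos.le.trans hx.1
  rw [← h1, ← h3, ← h2] at h4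
  have h5 := mul_le_mul_of_nonneg_left h4 h0
  have h6 : b₀ * ‖sobGrad (u - v) x‖ ^ p ≤ β x * ‖sobGrad (u - v) x‖ ^ p := by
    gcongr; exact hx.1
  exact (h6.trans h5).trans_eq (by ring)

set_option maxHeartbeats 1000000 in
/-- Almost minimizers of the weighted energy are close to each other. -/
theorem IsWeight.norm_sub_lt_of_almost_minimizing (hβ : IsWeight U β b₀ b₁) {S : Set (W1 U p)}
    (hmid : ∀ u ∈ S, ∀ v ∈ S, (1 / 2 : ℝ) • (u + v) ∈ S) {K : ℝ} (hK : 0 ≤ K)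
    (hP : ∀ u ∈ S, ∀ v ∈ S, ‖u - v‖ ≤ K * ‖(u - v).1.2‖) {m : ℝ} (hm0 : 0 ≤ m)
    (hml : ∀ u ∈ S, m ≤ pEnergy β u) {η : ℝ} (hη : 0 < η) :
    ∃ τ : ℝ, 0 < τ ∧ ∀ u ∈ S, ∀ v ∈ S, pEnergy β u ≤ m + τ →
      pEnergy β v ≤ m + τ → ‖u - v‖ < η := by
  have hp0 : 0 < p := zero_lt_one.trans Fact.out
  set κ : ℝ := b₀ * (η / (K + 1)) ^ p with hκ
  have hK1 : 0 < K + 1 := by linarith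
  have hκ0 : 0 < κ := mul_pos hβ.pos (Real.rpow_pos_of_pos (by positivity) _)
  obtain ⟨C, hC, H⟩ := hβ.exists_uniform_convexity (p := p)
    (ε := κ / (4 * (m + 1))) (by positivity)
  refine ⟨min 1 (κ / (4 * (C + 1))), by positivity, fun u hu v hv huτ hvτ => ?_⟩
  have hτ1 := min_le_left 1 (κ / (4 * (C + 1)))
  have hτ2 := min_le_right 1 (κ / (4 * (C + 1)))
  have hτ0 : 0 < min 1 (κ / (4 * (C + 1))) := by positivity
  set τ := min 1 (κ / (4 * (C + 1)))
  have h1 := H u v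
  have h2 := hml _ (hmid u hu v hv)
  have h3 : κ / (4 * (m + 1)) * (pEnergy β u + pEnergy β v) ≤ κ / 2 := by
    calc _ ≤ κ / (4 * (m + 1)) * (2 * (m + 1)) := by gcongr; linarith
      _ = κ / 2 := by field_simp; norm_num
  have h4 : C * (1 / 2 * pEnergy β u + 1 / 2 * pEnergy β v -
      pEnergy β ((1 / 2 : ℝ) • (u + v))) ≤ κ / 4 := by
    calc _ ≤ C * τ := by gcongr; linarith
      _ ≤ C * (κ / (4 * (C + 1))) := by gcongr
      _ = κ / 4 * (C / (C + 1)) := by field_simp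
      _ ≤ κ / 4 * 1 := by
        gcongr
        rw [div_le_one (by linarith)]; linarith
      _ = _ := mul_one _
  have h5 : b₀ * ‖(u - v).1.2‖ ^ p < b₀ * (η / (K + 1)) ^ p := by
    rw [← hκ]; linarith
  have h6 := (Real.rpow_lt_rpow_iff (norm_nonneg _) (by positivity) hp0).1
    (lt_of_mul_lt_mul_left h5 hβ.pos.le)
  calc ‖u - v‖ ≤ K * ‖(u - v).1.2‖ := hP u hu v hv
    _ ≤ K * (η / (K + 1)) := by gcongr
    _ < (K + 1) * (η / (K + 1)) := by gcongr; linarith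
    _ = η := by field_simp

set_option maxHeartbeats 1000000 in
/-- The weighted energy has a unique minimizer in every closed convex set on whose differences the
gradient controls the norm. -/
theorem IsWeight.exists_unique_minimizer (hβ : IsWeight U β b₀ b₁) {S : Set (W1 U p)}
    (hS : IsClosed S) (hne : S.Nonempty)
    (hmid : ∀ u ∈ S, ∀ v ∈ S, (1 / 2 : ℝ) • (u + v) ∈ S) {K : ℝ} (hK : 0 ≤ K)
    (hP : ∀ u ∈ S, ∀ v ∈ S, ‖u - v‖ ≤ K * ‖(u - v).1.2‖) :
    ∃ u ∈ S, (∀ v ∈ S, pEnergy β u ≤ pEnergy β v) ∧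
      ∀ v ∈ S, (∀ w ∈ S, pEnergy β v ≤ pEnergy β w) → v = u := by
  have hp : 1 < p := Fact.out
  have hp0 : 0 < p := by linarith
  set m : ℝ := sInf (pEnergy β '' S) with hm
  have hbdd : BddBelow (pEnergy β '' S) :=
    ⟨0, by rintro _ ⟨u, _, rfl⟩; exact hβ.pEnergy_nonneg u⟩
  have hml : ∀ u ∈ S, m ≤ pEnergy β u := fun u hu => csInf_le hbdd ⟨u, hu, rfl⟩
  have hm0 : 0 ≤ m := le_csInf (hne.image _)
    (by rintro _ ⟨u, _, rfl⟩; exact hβ.pEnergy_nonneg u)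
  have hclose := fun (η : ℝ) (hη : 0 < η) =>
    hβ.norm_sub_lt_of_almost_minimizing hmid hK hP hm0 hml hη
  have hseq : ∀ k : ℕ, ∃ u ∈ S, pEnergy β u < m + 1 / ((k : ℝ) + 1) := by
    intro k
    obtain ⟨_, ⟨u, hu, rfl⟩, h⟩ := exists_lt_of_csInf_lt (hne.image (pEnergy β))
      (show sInf (pEnergy β '' S) < m + 1 / ((k : ℝ) + 1) by
        rw [← hm]; linarith [show 0 < 1 / ((k : ℝ) + 1) by positivity])
    exact ⟨u, hu, h⟩
  choose u hu hum using hseq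
  have hcauchy : CauchySeq u := by
    refine Metric.cauchySeq_iff'.2 fun η hη => ?_
    obtain ⟨τ, hτ, H⟩ := hclose η hη
    obtain ⟨N, hN⟩ := exists_nat_one_div_lt hτ
    refine ⟨N, fun k hk => ?_⟩
    rw [dist_eq_norm]
    refine H _ (hu k) _ (hu N) ?_ (by linarith [hum N])
    have : 1 / ((k : ℝ) + 1) ≤ 1 / ((N : ℝ) + 1) := Nat.one_div_le_one_div hk
    linarith [hum k]
  obtain ⟨u₀, hu₀⟩ := cauchySeq_tendsto_of_complete hcauchy
  have hu₀S : u₀ ∈ S := hS.mem_of_tendsto hu₀ (Eventually.of_forall hu)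
  have hu₀m : pEnergy β u₀ ≤ m := by
    have h1 := (hβ.continuous_pEnergy.tendsto u₀).comp hu₀
    have h2 : Tendsto (fun k : ℕ => m + 1 / ((k : ℝ) + 1)) atTop (𝓝 (m + 0)) :=
      tendsto_const_nhds.add tendsto_one_div_add_atTop_nhds_zero_nat
    rw [add_zero] at h2
    exact le_of_tendsto_of_tendsto' h1 h2 fun k => (hum k).le
  refine ⟨u₀, hu₀S, fun v hv => hu₀m.trans (hml v hv), fun v hv hmin => ?_⟩
  by_contra hne'
  obtain ⟨τ, hτ, H⟩ := hclose ‖v - u₀‖ (norm_pos_iff.2 (sub_ne_zero.2 hne'))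
  exact lt_irrefl _ (H v hv u₀ hu₀S (by linarith [hmin u₀ hu₀S]) (by linarith))

theorem IsWeight.integrable_euler (hβ : IsWeight U β b₀ b₁) (u φ : W1 U p) :
    Integrable (fun x => β x * ‖sobGrad u x‖ ^ (p - 2) * inner ℝ (sobGrad u x) (sobGrad φ x))
      (volume.restrict U) := by
  have hp : 1 < p := Fact.out
  have h1 : Integrable (fun x => ‖sobGrad u x‖ ^ (p - 2) * inner ℝ (sobGrad u x) (sobGrad φ x))
      (volume.restrict U) := by
    refine ((integrable_norm_sobGrad_rpow u).add (integrable_norm_sobGrad_rpow φ)).mono'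
      (((memLp_sobGrad u).1.norm.aemeasurable.pow_const _).aestronglyMeasurable.mul
        ((memLp_sobGrad u).1.inner (memLp_sobGrad φ).1)) (Eventually.of_forall fun x => ?_)
    exact abs_rpow_sub_two_mul_inner_le_add hp _ _
  simpa only [mul_assoc] using hβ.integrable_mul h1

/-- The Euler–Lagrange equation of the weighted energy. -/
theorem IsWeight.euler_eq_zero (hβ : IsWeight U β b₀ b₁) {u φ : W1 U p}
    (hmin : ∀ t : ℝ, pEnergy β u ≤ pEnergy β (u + t • φ)) :
    ∫ x in U, β x * ‖sobGrad u x‖ ^ (p - 2) * inner ℝ (sobGrad u x) (sobGrad φ x) = 0 := by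
  have hp : 1 < p := Fact.out
  have hp0 : 0 < p := by linarith
  have hgrad : ∀ t : ℝ, ∀ φ : W1 U p, sobGrad (u + t • φ) =ᵐ[volume.restrict U]
      fun x => sobGrad u x + t • sobGrad φ x := by
    intro t φ
    filter_upwards [sobGrad_add u (t • φ), sobGrad_smul t φ] with x h1 h2
    rw [h1, h2]
  have hnonneg : ∀ φ : W1 U p, (∀ t : ℝ, pEnergy β u ≤ pEnergy β (u + t • φ)) →
      0 ≤ ∫ x in U, β x * ‖sobGrad u x‖ ^ (p - 2) * inner ℝ (sobGrad u x) (sobGrad φ x) := by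
    intro φ hmin
    let t : ℕ → ℝ := fun k => 1 / ((k : ℝ) + 1)
    have ht0 : ∀ k, 0 < t k := fun k => by positivity
    have ht1 : ∀ k, t k ≤ 1 := fun k => by
      simp only [t]
      rw [div_le_one (by positivity)]
      linarith [Nat.cast_nonneg (α := ℝ) k]
    have ht : Tendsto t atTop (𝓝 0) := tendsto_one_div_add_atTop_nhds_zero_nat
    let I : ℕ → Euc n → ℝ := fun k x => β x * (‖sobGrad u x + t k • sobGrad φ x‖ ^ (p - 2) *
      inner ℝ (sobGrad u x + t k • sobGrad φ x) (sobGrad φ x))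
    have hI : ∀ k, I k =ᵐ[volume.restrict U] fun x => β x *
        ‖sobGrad (u + t k • φ) x‖ ^ (p - 2) * inner ℝ (sobGrad (u + t k • φ) x) (sobGrad φ x) := by
      intro k
      filter_upwards [hgrad (t k) φ] with x hx
      rw [hx]
      simp only [I, mul_assoc]
    have hIi : ∀ k, Integrable (I k) (volume.restrict U) := fun k =>
      (hβ.integrable_euler (u + t k • φ) φ).congr (hI k).symm
    have hpos : ∀ k, 0 ≤ ∫ x in U, I k x := by
      intro k
      have h1 : pEnergy β (u + t k • φ) - pEnergy β u ≤ p * t k * ∫ x in U, I k x := by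
        simp only [pEnergy]
        rw [← integral_sub (hβ.integrable_energy _) (hβ.integrable_energy _),
          ← integral_const_mul]
        refine integral_mono_ae ((hβ.integrable_energy _).sub (hβ.integrable_energy _))
          ((hIi k).const_mul _) ?_
        filter_upwards [hgrad (t k) φ, hβ.bounds] with x hx hb
        have h2 := rpow_norm_add_inner_le hp (sobGrad u x + t k • sobGrad φ x) (sobGrad u x)
        have h3 : sobGrad u x - (sobGrad u x + t k • sobGrad φ x) = -(t k • sobGrad φ x) := by abel
        rw [h3, inner_neg_right, real_inner_smul_right] at h2
        rw [hx]
        simp only [I]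
        have h4 := mul_le_mul_of_nonneg_left h2 (hβ.pos.le.trans hb.1)
        linarith
      have h2 := hmin (t k)
      have h3 : 0 < p * t k := mul_pos hp0 (ht0 k)
      by_contra hneg
      have := mul_neg_of_pos_of_neg h3 (not_le.1 hneg)
      linarith
    have hlim : Tendsto (fun k => ∫ x in U, I k x) atTop (𝓝 (∫ x in U, β x *
        ‖sobGrad u x‖ ^ (p - 2) * inner ℝ (sobGrad u x) (sobGrad φ x))) := by
      refine tendsto_integral_of_dominated_convergence
        (fun x => b₁ * (2 ^ (p - 1) * (‖sobGrad u x‖ ^ p + ‖sobGrad φ x‖ ^ p) +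
          ‖sobGrad φ x‖ ^ p)) (fun k => (hIi k).1) ?_ ?_ ?_
      · exact ((((integrable_norm_sobGrad_rpow u).add
          (integrable_norm_sobGrad_rpow φ)).const_mul _).add
            (integrable_norm_sobGrad_rpow φ)).const_mul _
      · intro k
        filter_upwards [hβ.bounds] with x hb
        have h0 := hβ.pos.le.trans hb.1
        simp only [I]
        rw [norm_mul, Real.norm_of_nonneg h0]
        have h1 : ‖t k • sobGrad φ x‖ ^ p ≤ ‖sobGrad φ x‖ ^ p := by
          refine Real.rpow_le_rpow (norm_nonneg _) ?_ hp0.le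
          rw [norm_smul, Real.norm_of_nonneg (ht0 k).le]
          exact mul_le_of_le_one_left (norm_nonneg _) (ht1 k)
        have h2 := abs_rpow_sub_two_mul_inner_le_add hp (sobGrad u x + t k • sobGrad φ x)
          (sobGrad φ x)
        have h3 := add_rpow_norm_le hp (sobGrad u x) (t k • sobGrad φ x)
        refine mul_le_mul hb.2 (h2.trans ?_) (norm_nonneg _) (h0.trans hb.2)
        gcongr
        refine h3.trans ?_
        gcongr
      · refine Eventually.of_forall fun x => ?_
        have h1 : Tendsto (fun k => sobGrad u x + t k • sobGrad φ x) atTop (𝓝 (sobGrad u x)) := by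
          simpa using tendsto_const_nhds.add (ht.smul_const (sobGrad φ x))
        have h2 := ((continuous_rpow_sub_two_mul_inner hp (sobGrad φ x)).tendsto
          (sobGrad u x)).comp h1
        simp only [mul_assoc]
        exact h2.const_mul (β x)
    exact ge_of_tendsto' hlim hpos
  refine le_antisymm ?_ (hnonneg φ hmin)
  have h1 := hnonneg (-φ) fun t => by
    have := hmin (-t)
    rwa [smul_neg, ← neg_smul]
  have h2 : ∫ x in U, β x * ‖sobGrad u x‖ ^ (p - 2) * inner ℝ (sobGrad u x) (sobGrad (-φ) x) =
      - ∫ x in U, β x * ‖sobGrad u x‖ ^ (p - 2) * inner ℝ (sobGrad u x) (sobGrad φ x) := by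
    rw [← integral_neg]
    refine integral_congr_ae ?_
    filter_upwards [sobGrad_smul (-1 : ℝ) φ] with x hx
    have h3 : (-1 : ℝ) • φ = -φ := neg_one_smul ℝ φ
    rw [h3, neg_one_smul] at hx
    rw [hx, inner_neg_right, mul_neg]
  rw [h2] at h1
  linarith

end WeightedEnergy

section Caratheodory

variable {n : ℕ} {U : Set (Euc n)} {Q : Euc n → ℝ → ℝ} {p : ℝ}

theorem aemeasurable_apply_of_countable {α ι : Type*} [MeasurableSpace α] {μ : Measure α}
    [Countable ι] [MeasurableSpace ι] [MeasurableSingletonClass ι] {f : ι → α → ℝ}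
    (hf : ∀ i, AEMeasurable (f i) μ) {j : α → ι} (hj : Measurable j) :
    AEMeasurable (fun x => f (j x) x) μ := by
  refine ⟨fun x => (hf (j x)).mk _ x, ?_, ?_⟩
  · have h : Measurable fun z : α × ι => (hf z.2).mk _ z.1 :=
      measurable_from_prod_countable_left fun i => (hf i).measurable_mk
    exact h.comp (measurable_id.prodMk hj)
  · filter_upwards [ae_all_iff.2 fun i => (hf i).ae_eq_mk] with x hx
    exact hx (j x)

/-- Compositions of Carathéodory functions with measurable functions are measurable. -/
theorem IsCaratheodory.aemeasurable_comp (hQ : IsCaratheodory U Q) {E : Euc n → ℝ}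
    (hE : AEMeasurable E (volume.restrict U)) (hE0 : ∀ x, 0 ≤ E x) :
    AEMeasurable (fun x => Q x (E x)) (volume.restrict U) := by
  have hk : ∀ k : ℕ, AEMeasurable (fun x => Q x ((⌊hE.mk E x * k⌋₊ : ℝ) / k))
      (volume.restrict U) := fun k =>
    aemeasurable_apply_of_countable (f := fun (i : ℕ) x => Q x ((i : ℝ) / k))
      (fun i => hQ.1 _ (by positivity))
      (Nat.measurable_floor.comp (hE.measurable_mk.mul_const (k : ℝ)))
  refine aemeasurable_of_tendsto_metrizable_ae atTop hk ?_
  filter_upwards [hQ.2, hE.ae_eq_mk] with x hc hx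
  rw [← hx]
  have h1 : Tendsto (fun k : ℕ => (⌊E x * k⌋₊ : ℝ) / k) atTop (𝓝 (E x)) :=
    (tendsto_nat_floor_mul_div_atTop (hE0 x)).comp tendsto_natCast_atTop_atTop
  exact (hc (E x) (hE0 x)).tendsto.comp (tendsto_nhdsWithin_iff.2
    ⟨h1, Eventually.of_forall fun k => by simp only [mem_Ici]; positivity⟩)

theorem isWeight_of_growth (hQ : IsCaratheodory U Q) {c C E₀ : ℝ} (hc : 0 < c) (hE₀ : 0 < E₀)
    (hp : 0 < p) (hg : HasGrowth U Q p c C E₀) {β : Euc n → ℝ}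
    (hβ : ∀ᵐ x ∂(volume.restrict U), Tendsto (fun E : ℝ => Q x E / E ^ p) atTop (𝓝 (β x))) :
    IsWeight U β (c / E₀ ^ p) (C / E₀ ^ p) where
  aemeasurable := by
    refine aemeasurable_of_tendsto_metrizable_ae atTop
      (f := fun (k : ℕ) x => Q x k / (k : ℝ) ^ p)
      (fun k => (hQ.1 k (Nat.cast_nonneg k)).div_const _) ?_
    filter_upwards [hβ] with x hx
    exact hx.comp tendsto_natCast_atTop_atTop
  pos := by positivity
  bounds := by
    filter_upwards [hβ, hg] with x hx hgx
    have hpow : Tendsto (fun E : ℝ => (E ^ p)⁻¹) atTop (𝓝 0) :=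
      (tendsto_rpow_atTop hp).inv_tendsto_atTop
    have heq : ∀ E : ℝ, 0 < E → ∀ b : ℝ, (E / E₀) ^ p / E ^ p = 1 / E₀ ^ p := fun E hE b => by
      rw [Real.div_rpow hE.le hE₀.le]
      have := (Real.rpow_pos_of_pos hE p).ne'
      field_simp
    constructor
    · have hl : Tendsto (fun E : ℝ => c / E₀ ^ p - c * (E ^ p)⁻¹) atTop (𝓝 (c / E₀ ^ p - c * 0)) :=
        tendsto_const_nhds.sub (hpow.const_mul c)
      rw [mul_zero, sub_zero] at hl
      refine le_of_tendsto_of_tendsto hl hx ?_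
      filter_upwards [eventually_gt_atTop 0] with E hE
      have h1 := Real.rpow_pos_of_pos hE p
      calc c / E₀ ^ p - c * (E ^ p)⁻¹ = c * ((E / E₀) ^ p - 1) / E ^ p := by
            rw [mul_div_assoc, sub_div, heq E hE 0]; ring
        _ ≤ _ := by gcongr; exact (hgx E hE.le).1
    · have hl : Tendsto (fun E : ℝ => C / E₀ ^ p + C * (E ^ p)⁻¹) atTop (𝓝 (C / E₀ ^ p + C * 0)) :=
        tendsto_const_nhds.add (hpow.const_mul C)
      rw [mul_zero, add_zero] at hl
      refine le_of_tendsto_of_tendsto hx hl ?_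
      filter_upwards [eventually_gt_atTop 0] with E hE
      have h1 := Real.rpow_pos_of_pos hE p
      calc _ ≤ C * ((E / E₀) ^ p + 1) / E ^ p := by gcongr; exact (hgx E hE.le).2
        _ = _ := by rw [mul_div_assoc, add_div, heq E hE 0]; ring

end Caratheodory

section PointwiseConvergence

variable {n : ℕ} {p : ℝ}

/-- A function with `p`-growth and recession coefficient `β` is close to `β E^p`. -/
theorem exists_abs_sub_rpow_le (hp : 0 < p) {Q : ℝ → ℝ} {β C E₀ : ℝ} (hE₀ : 0 < E₀)
    (hQ : ∀ E : ℝ, 0 ≤ E → 0 ≤ Q E ∧ Q E ≤ C * ((E / E₀) ^ p + 1)) (hC : 0 ≤ C)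
    (hlim : Tendsto (fun E : ℝ => Q E / E ^ p) atTop (𝓝 β)) {ε : ℝ} (hε : 0 < ε) :
    ∃ K : ℝ, 0 ≤ K ∧ ∀ E : ℝ, 0 ≤ E → |Q E - β * E ^ p| ≤ ε * E ^ p + K := by
  obtain ⟨E₁, hE₁⟩ := (((Metric.tendsto_nhds.1 hlim ε hε).and (eventually_gt_atTop 0))).exists_forall_of_atTop
  set M : ℝ := max E₁ 1
  have hM : 0 < M := lt_max_of_lt_right one_pos
  refine ⟨C * ((M / E₀) ^ p + 1) + |β| * M ^ p, by positivity, fun E hE => ?_⟩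
  by_cases hEM : E₁ ≤ E
  · obtain ⟨h1, h2⟩ := hE₁ E hEM
    have h3 := Real.rpow_pos_of_pos h2 p
    rw [Real.dist_eq] at h1
    have h4 : Q E - β * E ^ p = (Q E / E ^ p - β) * E ^ p := by field_simp
    rw [h4, abs_mul, abs_of_pos h3]
    have h5 : |Q E / E ^ p - β| * E ^ p ≤ ε * E ^ p := by gcongr
    have h6 : 0 ≤ C * ((M / E₀) ^ p + 1) + |β| * M ^ p := by positivity
    linarith
  · have hEM' : E ≤ M := (not_le.1 hEM).le.trans (le_max_left _ _)
    have h1 := hQ E hE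
    have h2 : Q E ≤ C * ((M / E₀) ^ p + 1) := h1.2.trans (by gcongr)
    have h3 : |β * E ^ p| ≤ |β| * M ^ p := by
      rw [abs_mul, abs_of_nonneg (by positivity : 0 ≤ E ^ p)]
      gcongr
    have h4 : |Q E - β * E ^ p| ≤ |Q E| + |β * E ^ p| := abs_sub _ _
    rw [abs_of_nonneg h1.1] at h4
    have h5 : 0 ≤ ε * E ^ p := by positivity
    linarith

theorem exists_mul_rpow_sub_one_mul_le (hp : 1 < p) {b B : ℝ} (hb : 0 < b) (hB : 0 ≤ B) :
    ∃ D : ℝ, 0 ≤ D ∧ ∀ a x : ℝ, 0 ≤ a → 0 ≤ x → B * (a ^ (p - 1) * x) ≤ b * x ^ p + D * a ^ p := by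
  have hp0 : 0 < p := by linarith
  -- rescale `x` by a small factor
  obtain ⟨θ, hθ, hθb⟩ : ∃ θ : ℝ, 0 < θ ∧ B * θ ^ (p - 1) ≤ b := by
    have h1 : Tendsto (fun θ : ℝ => B * θ ^ (p - 1)) (𝓝[>] 0) (𝓝 (B * 0 ^ (p - 1))) :=
      ((Real.continuousAt_rpow_const 0 (p - 1) (Or.inr (by linarith))).tendsto.mono_left
        nhdsWithin_le_nhds).const_mul B
    rw [Real.zero_rpow (by linarith), mul_zero] at h1
    obtain ⟨θ, h2, h3⟩ := ((h1.eventually (gt_mem_nhds hb)).and self_mem_nhdsWithin).exists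
    exact ⟨θ, h3, h2.le⟩
  refine ⟨B / θ, by positivity, fun a x ha hx => ?_⟩
  have h1 := rpow_sub_one_mul_le hp ha (mul_nonneg hθ.le hx)
  rw [Real.mul_rpow hθ.le hx] at h1
  have h2 : B * (a ^ (p - 1) * x) = B / θ * (a ^ (p - 1) * (θ * x)) := by field_simp
  have h3 : θ ^ p = θ ^ (p - 1) * θ := by
    rw [← Real.rpow_add_one hθ.ne']; ring_nf
  calc B * (a ^ (p - 1) * x) ≤ B / θ * (a ^ p + θ ^ p * x ^ p) := by rw [h2]; gcongr
    _ = B * θ ^ (p - 1) * x ^ p + B / θ * a ^ p := by rw [h3]; field_simp; ring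
    _ ≤ _ := by gcongr

/-- Rescaled densities, with a linear term subtracted, are uniformly coercive. -/
theorem exists_coercive (hp : 1 < p) {b₀ b₁ c : ℝ} (hb₀ : 0 < b₀) (hb : b₀ ≤ b₁) :
    ∃ D : ℝ, 0 ≤ D ∧ ∀ (β F s : ℝ) (η ξ : Euc n), b₀ ≤ β → β ≤ b₁ →
      b₀ * ‖ξ‖ ^ p - c * s ≤ F →
      b₀ / 2 * ‖ξ‖ ^ p - D * ‖η‖ ^ p - c * s ≤
        F - p * (β * (‖η‖ ^ (p - 2) * inner ℝ η ξ)) := by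
  obtain ⟨D, hD, H⟩ := exists_mul_rpow_sub_one_mul_le hp (b := b₀ / 2) (B := p * b₁)
    (by positivity) (by nlinarith)
  refine ⟨D, hD, fun β F s η ξ h0 h1 hF => ?_⟩
  have h2 := H ‖η‖ ‖ξ‖ (norm_nonneg _) (norm_nonneg _)
  have h3 := (abs_le.1 (abs_rpow_sub_two_mul_inner_le hp η ξ)).2
  have h4 : β * (‖η‖ ^ (p - 2) * inner ℝ η ξ) ≤ b₁ * (‖η‖ ^ (p - 1) * ‖ξ‖) := by
    calc _ ≤ β * (‖η‖ ^ (p - 1) * ‖ξ‖) := by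
          have : 0 ≤ β := hb₀.le.trans h0
          gcongr
      _ ≤ _ := by gcongr
  have h5 : p * (β * (‖η‖ ^ (p - 2) * inner ℝ η ξ)) ≤ p * (b₁ * (‖η‖ ^ (p - 1) * ‖ξ‖)) := by
    gcongr
  linarith

/-- The tangent excess at `η` tends to zero only along sequences converging to `η`. -/
theorem tendsto_of_excess_tendsto (hp : 1 < p) {η : Euc n} {ξ : ℕ → Euc n} {M : ℝ}
    (hM : ∀ᶠ k in atTop, ‖ξ k‖ ^ p ≤ M)
    (h : Tendsto (fun k => ‖ξ k‖ ^ p - ‖η‖ ^ p - p * (‖η‖ ^ (p - 2) * inner ℝ η (ξ k - η))) atTop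
      (𝓝 0)) : Tendsto ξ atTop (𝓝 η) := by
  have hp0 : 0 < p := by linarith
  rw [tendsto_iff_norm_sub_tendsto_zero]
  have h1 : Tendsto (fun k => ‖ξ k - η‖ ^ p) atTop (𝓝 0) := by
    rw [Metric.tendsto_nhds]
    intro τ hτ
    set S : ℝ := |M| + ‖η‖ ^ p + 1 with hS
    have hS0 : 0 < S := by positivity
    obtain ⟨C, hC, H⟩ := exists_rpow_norm_sub_le_excess (n := n) hp
      (ε := τ / (2 * S)) (by positivity)
    have h2 := (h.const_mul C).eventually (gt_mem_nhds (show C * 0 < τ / 2 by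
      rw [mul_zero]; exact half_pos hτ))
    filter_upwards [h2, hM] with k hk hkM
    rw [Real.dist_eq, sub_zero, abs_of_nonneg (by positivity)]
    have h3 : τ / (2 * S) * (‖ξ k‖ ^ p + ‖η‖ ^ p) ≤ τ / (2 * S) * S := by
      gcongr
      linarith [le_abs_self M]
    have h4 : τ / (2 * S) * S = τ / 2 := by field_simp
    linarith [H η (ξ k)]
  have h2 := h1.rpow_const (p := 1 / p) (Or.inr (by positivity))
  rw [Real.zero_rpow (by positivity)] at h2
  refine h2.congr fun k => ?_
  rw [← Real.rpow_mul (norm_nonneg _), mul_one_div_cancel hp0.ne', Real.rpow_one]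

/-- A sequence of values `F k ≈ β ‖ξ k‖^p`, up to errors that are small relative to `‖ξ k‖^p`. -/
def IsAsymptoticPower (p β : ℝ) (F : ℕ → ℝ) (ξ : ℕ → Euc n) : Prop :=
  ∀ ε : ℝ, 0 < ε → ∀ᶠ k in atTop, |F k - β * ‖ξ k‖ ^ p| ≤ ε * (‖ξ k‖ ^ p + 1)

theorem IsAsymptoticPower.tendsto_neg_part (hp : 1 < p) {b₀ b₁ c D β : ℝ} (hb₀ : 0 < b₀)
    (hβ : b₀ ≤ β) {F s : ℕ → ℝ} {η : Euc n} {ξ : ℕ → Euc n}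
    (hF : IsAsymptoticPower p β F ξ) (hs : ∀ k, c * s k ≤ b₁)
    (hco : ∀ k, b₀ / 2 * ‖ξ k‖ ^ p - D * ‖η‖ ^ p - c * s k ≤
      F k - p * (β * (‖η‖ ^ (p - 2) * inner ℝ η (ξ k)))) :
    Tendsto (fun k => max ((1 - p) * (β * ‖η‖ ^ p) -
      (F k - p * (β * (‖η‖ ^ (p - 2) * inner ℝ η (ξ k))))) 0) atTop (𝓝 0) := by
  rw [Metric.tendsto_nhds]
  intro τ hτ
  set N : ℝ := |(D * ‖η‖ ^ p + b₁) * (2 / b₀)| + 1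
  have hN : 0 < N := by positivity
  filter_upwards [hF (τ / (2 * N)) (by positivity)] with k hk
  rw [Real.dist_eq, sub_zero, abs_of_nonneg (le_max_right _ _)]
  refine max_lt ?_ hτ
  by_contra hlt
  have h0 := not_lt.1 hlt
  have h1 := rpow_norm_add_inner_le hp η (ξ k)
  rw [inner_sub_right, mul_sub, rpow_sub_two_mul_inner_self hp] at h1
  have hβ0 : 0 < β := hb₀.trans_le hβ
  have h2 := mul_le_mul_of_nonneg_left h1 hβ0.le
  have h5 : 0 ≤ β * ‖η‖ ^ p := by positivity
  have h3 : ‖ξ k‖ ^ p ≤ (D * ‖η‖ ^ p + b₁) * (2 / b₀) := by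
    rw [mul_div_assoc', le_div_iff₀ hb₀]
    nlinarith [hco k, hs k]
  have h4 : τ / (2 * N) * (‖ξ k‖ ^ p + 1) ≤ τ / 2 := by
    calc _ ≤ τ / (2 * N) * N := by
          gcongr
          linarith [le_abs_self ((D * ‖η‖ ^ p + b₁) * (2 / b₀))]
      _ = τ / 2 := by field_simp
  have h6 := (abs_le.1 hk).1
  nlinarith

theorem IsAsymptoticPower.tendsto (hp : 1 < p) {b₀ b₁ c D β : ℝ} (hb₀ : 0 < b₀)
    (hβ : b₀ ≤ β) {F s : ℕ → ℝ} {η : Euc n} {ξ : ℕ → Euc n}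
    (hF : IsAsymptoticPower p β F ξ) (hs : ∀ k, c * s k ≤ b₁)
    (hco : ∀ k, b₀ / 2 * ‖ξ k‖ ^ p - D * ‖η‖ ^ p - c * s k ≤
      F k - p * (β * (‖η‖ ^ (p - 2) * inner ℝ η (ξ k))))
    (hlim : Tendsto (fun k => F k - p * (β * (‖η‖ ^ (p - 2) * inner ℝ η (ξ k)))) atTop
      (𝓝 ((1 - p) * (β * ‖η‖ ^ p)))) : Tendsto ξ atTop (𝓝 η) := by
  have hβ0 : 0 < β := hb₀.trans_le hβ
  set g : ℝ := (1 - p) * (β * ‖η‖ ^ p) with hg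
  set M : ℝ := (g + 1 + D * ‖η‖ ^ p + b₁) * (2 / b₀) with hM
  have hbd : ∀ᶠ k in atTop, ‖ξ k‖ ^ p ≤ M := by
    filter_upwards [hlim.eventually (gt_mem_nhds (lt_add_one g))] with k hk
    rw [hM, mul_div_assoc', le_div_iff₀ hb₀]
    nlinarith [hco k, hs k]
  refine tendsto_of_excess_tendsto hp hbd ?_
  have hex : ∀ k, 0 ≤ ‖ξ k‖ ^ p - ‖η‖ ^ p - p * (‖η‖ ^ (p - 2) * inner ℝ η (ξ k - η)) := fun k => by
    linarith [rpow_norm_add_inner_le hp η (ξ k)]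
  rw [Metric.tendsto_nhds]
  intro τ hτ
  set N : ℝ := |M| + 1
  have hN : 0 < N := by positivity
  have hτβ : 0 < β * τ / 2 := by positivity
  filter_upwards [hF (β * τ / 2 / N) (by positivity), hbd,
    hlim.eventually (gt_mem_nhds (show g < g + β * τ / 2 by linarith))] with k hk hkM hkg
  rw [Real.dist_eq, sub_zero, abs_of_nonneg (hex k)]
  have h4 : β * τ / 2 / N * (‖ξ k‖ ^ p + 1) ≤ β * τ / 2 := by
    calc _ ≤ β * τ / 2 / N * N := by
          gcongr
          linarith [le_abs_self M]
      _ = _ := by field_simp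
  have h6 := (abs_le.1 hk).1
  rw [inner_sub_right, mul_sub, rpow_sub_two_mul_inner_self hp]
  refine lt_of_mul_lt_mul_left (a := β) ?_ hβ0.le
  have h7 : β * (‖ξ k‖ ^ p - ‖η‖ ^ p - p * (‖η‖ ^ (p - 2) * inner ℝ η (ξ k) - ‖η‖ ^ p)) =
      β * ‖ξ k‖ ^ p - p * (β * (‖η‖ ^ (p - 2) * inner ℝ η (ξ k))) - g := by
    rw [hg]; ring
  rw [h7]
  linarith

end PointwiseConvergence

section StrongConvergence

/-- A Scheffé lemma: if the negative parts of `g k - g` tend to zero, dominated by an integrable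
function, and the integrals of `g k` do not exceed that of `g` in the limit, then `g k` tends to
`g` in `L¹`. -/
theorem tendsto_integral_abs_sub_of_neg_part {α : Type*} [MeasurableSpace α] {μ : Measure α}
    {g : ℕ → α → ℝ} {g₀ G : α → ℝ} (hg : ∀ k, Integrable (g k) μ) (hg₀ : Integrable g₀ μ)
    (hG : Integrable G μ) (hdom : ∀ k, ∀ᵐ x ∂μ, max (g₀ x - g k x) 0 ≤ G x)
    (hneg : ∀ᵐ x ∂μ, Tendsto (fun k => max (g₀ x - g k x) 0) atTop (𝓝 0))
    (hlim : ∀ δ : ℝ, 0 < δ → ∀ᶠ k in atTop, ∫ x, g k x ∂μ ≤ ∫ x, g₀ x ∂μ + δ) :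
    Tendsto (fun k => ∫ x, |g k x - g₀ x| ∂μ) atTop (𝓝 0) := by
  have hmi : ∀ k, Integrable (fun x => max (g₀ x - g k x) 0) μ := fun k =>
    (hg₀.sub (hg k)).pos_part
  have h1 : Tendsto (fun k => ∫ x, max (g₀ x - g k x) 0 ∂μ) atTop (𝓝 (∫ _, (0 : ℝ) ∂μ)) := by
    refine tendsto_integral_of_dominated_convergence G (fun k => (hmi k).1) hG (fun k => ?_) hneg
    filter_upwards [hdom k] with x hx
    rwa [Real.norm_of_nonneg (le_max_right _ _)]
  rw [integral_zero] at h1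
  have h2 : ∀ k, ∫ x, |g k x - g₀ x| ∂μ =
      (∫ x, g k x ∂μ - ∫ x, g₀ x ∂μ) + 2 * ∫ x, max (g₀ x - g k x) 0 ∂μ := fun k => by
    have i1 : Integrable (fun x => g k x - g₀ x) μ := (hg k).sub hg₀
    rw [← integral_sub (hg k) hg₀, ← integral_const_mul, ← integral_add i1 ((hmi k).const_mul 2)]
    refine integral_congr_ae (Eventually.of_forall fun x => ?_)
    simp only
    rcases le_total (g k x) (g₀ x) with h | h
    · rw [abs_of_nonpos (by linarith), max_eq_left (by linarith)]; ring
    · rw [abs_of_nonneg (by linarith), max_eq_right (by linarith)]; ring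
  rw [Metric.tendsto_nhds]
  intro δ hδ
  filter_upwards [hlim (δ / 2) (by positivity),
    h1.eventually (gt_mem_nhds (show 0 < δ / 4 by positivity))] with k hk1 hk2
  rw [Real.dist_eq, sub_zero, abs_of_nonneg (integral_nonneg fun x => abs_nonneg _), h2 k]
  linarith

theorem exists_seq_tendsto_ae_of_tendsto_integral_abs_sub {α : Type*} [MeasurableSpace α]
    {μ : Measure α} {g : ℕ → α → ℝ} {g₀ : α → ℝ} (hg : ∀ k, Integrable (g k) μ)
    (hg₀ : Integrable g₀ μ) (h : Tendsto (fun k => ∫ x, |g k x - g₀ x| ∂μ) atTop (𝓝 0)) :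
    ∃ φ : ℕ → ℕ, StrictMono φ ∧ ∀ᵐ x ∂μ, Tendsto (fun k => g (φ k) x) atTop (𝓝 (g₀ x)) := by
  refine (tendstoInMeasure_of_tendsto_eLpNorm (p := 1) one_ne_zero (fun k => (hg k).1) hg₀.1
    ?_).exists_seq_tendsto_ae
  have h1 : ∀ k, eLpNorm (g k - g₀) 1 μ = ENNReal.ofReal (∫ x, |g k x - g₀ x| ∂μ) := fun k => by
    have i1 : Integrable (fun x => |g k x - g₀ x|) μ := ((hg k).sub hg₀).abs
    rw [eLpNorm_one_eq_lintegral_enorm, ofReal_integral_eq_lintegral_ofReal i1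
      (Eventually.of_forall fun x => abs_nonneg _)]
    refine lintegral_congr fun x => ?_
    rw [Pi.sub_apply, ← ofReal_norm, Real.norm_eq_abs]
  simp only [h1]
  simpa using ENNReal.tendsto_ofReal h

/-- A generalized dominated convergence theorem for nonnegative functions tending to zero. -/
theorem tendsto_integral_zero_of_le_add {α : Type*} [MeasurableSpace α] {μ : Measure α}
    {d e : ℕ → α → ℝ} {G : α → ℝ} (hd : ∀ k, Integrable (d k) μ) (he : ∀ k, Integrable (e k) μ)
    (hG : Integrable G μ) (hd0 : ∀ k x, 0 ≤ d k x) (he0 : ∀ k x, 0 ≤ e k x) (hG0 : ∀ᵐ x ∂μ, 0 ≤ G x)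
    (hle : ∀ k, ∀ᵐ x ∂μ, d k x ≤ e k x + G x)
    (hlim : ∀ᵐ x ∂μ, Tendsto (fun k => d k x) atTop (𝓝 0))
    (hel : Tendsto (fun k => ∫ x, e k x ∂μ) atTop (𝓝 0)) :
    Tendsto (fun k => ∫ x, d k x ∂μ) atTop (𝓝 0) := by
  have hmi : ∀ k, Integrable (fun x => min (d k x) (G x)) μ := fun k => (hd k).inf hG
  have h1 : Tendsto (fun k => ∫ x, min (d k x) (G x) ∂μ) atTop (𝓝 (∫ _, (0 : ℝ) ∂μ)) := by
    refine tendsto_integral_of_dominated_convergence G (fun k => (hmi k).1) hG (fun k => ?_) ?_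
    · filter_upwards [hG0] with x hx
      rw [Real.norm_of_nonneg (le_min (hd0 k x) hx)]
      exact min_le_right _ _
    · filter_upwards [hG0, hlim] with x hx hl
      exact squeeze_zero (fun k => le_min (hd0 k x) hx) (fun k => min_le_left _ _) hl
  rw [integral_zero] at h1
  refine squeeze_zero (fun k => integral_nonneg (hd0 k)) (fun k => ?_) (by simpa using hel.add h1)
  rw [← integral_add (he k) (hmi k)]
  refine integral_mono_ae (hd k) ((he k).add (hmi k)) ?_
  filter_upwards [hle k] with x hx
  have := he0 k x
  rcases le_total (d k x) (G x) with h | h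
  · simp only [min_eq_left h]; linarith
  · simp only [min_eq_right h]; linarith

variable {n : ℕ} {U : Set (Euc n)} {p : ℝ} [Fact (1 < p)] {β : Euc n → ℝ} {b₀ b₁ : ℝ}

set_option maxHeartbeats 1000000 in
/-- Sequences along which asymptotically `p`-homogeneous energies do not exceed the weighted
`p`-energy of a critical point converge to that critical point, up to a subsequence. -/
theorem IsWeight.exists_subseq_tendsto_norm_grad (hβ : IsWeight U β b₀ b₁)
    [IsFiniteMeasure (volume.restrict U)] {u₀ : W1 U p} {w : ℕ → W1 U p} {c : ℝ} (hc : 0 ≤ c)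
    {s : ℕ → ℝ} (hs : Tendsto s atTop (𝓝 0)) (hs0 : ∀ k, 0 ≤ s k) (hs1 : ∀ k, s k ≤ 1)
    {F : ℕ → Euc n → ℝ} (hFi : ∀ k, Integrable (F k) (volume.restrict U))
    (hF0 : ∀ k, ∀ᵐ x ∂(volume.restrict U), 0 ≤ F k x)
    (hFc : ∀ k, ∀ᵐ x ∂(volume.restrict U), b₀ * ‖sobGrad (w k) x‖ ^ p - c * s k ≤ F k x)
    (hF : ∀ᵐ x ∂(volume.restrict U),
      IsAsymptoticPower p (β x) (fun k => F k x) fun k => sobGrad (w k) x)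
    (hcrit : ∀ k, ∫ x in U, β x * ‖sobGrad u₀ x‖ ^ (p - 2) *
      inner ℝ (sobGrad u₀ x) (sobGrad (w k - u₀) x) = 0)
    (hlim : ∀ δ : ℝ, 0 < δ → ∀ᶠ k in atTop, ∫ x in U, F k x ≤ pEnergy β u₀ + δ) :
    ∃ φ : ℕ → ℕ, StrictMono φ ∧ Tendsto (fun k => ‖(w (φ k) - u₀).1.2‖) atTop (𝓝 0) := by
  have hp : 1 < p := Fact.out
  have hp0 : 0 < p := by linarith
  set μ := volume.restrict U with hμ
  by_cases hμ0 : μ = 0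
  · refine ⟨id, strictMono_id, ?_⟩
    have h1 : ∀ k, ‖(w k - u₀).1.2‖ = 0 := fun k => by
      have h2 := norm_rpow_eq_integral (p := p) (w k - u₀).1.2
      have h3 : ∀ g : Euc n → ℝ, ∫ x in U, g x = 0 := fun g => by
        rw [← hμ, hμ0, integral_zero_measure]
      rw [h3] at h2
      exact ((Real.rpow_eq_zero_iff_of_nonneg (norm_nonneg _)).1 h2).1
    simp only [id, h1]
    exact tendsto_const_nhds
  have hb : b₀ ≤ b₁ := by
    have : NeZero μ := ⟨hμ0⟩
    obtain ⟨x, hx⟩ := hβ.bounds.exists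
    exact hx.1.trans hx.2
  obtain ⟨D, hD, hco⟩ := exists_coercive (n := n) (c := c) hp hβ.pos hb
  let E : ℕ → Euc n → ℝ := fun k x =>
    β x * (‖sobGrad u₀ x‖ ^ (p - 2) * inner ℝ (sobGrad u₀ x) (sobGrad (w k) x))
  have hEi : ∀ k, Integrable (E k) μ := fun k => by
    simpa only [E, mul_assoc] using hβ.integrable_euler u₀ (w k)
  have hη := integrable_norm_sobGrad_rpow u₀
  have hβη := hβ.integrable_energy u₀
  have hE : ∀ k, ∫ x, E k x ∂μ = pEnergy β u₀ := fun k => by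
    rw [← sub_eq_zero, ← hcrit k, pEnergy, ← integral_sub (hEi k) hβη]
    refine integral_congr_ae ?_
    filter_upwards [sobGrad_sub (w k) u₀] with x hx
    rw [hx, inner_sub_right, mul_sub, mul_assoc, mul_assoc, rpow_sub_two_mul_inner_self hp]
  have hcos : ∀ k, ∀ᵐ x ∂μ, b₀ / 2 * ‖sobGrad (w k) x‖ ^ p - D * ‖sobGrad u₀ x‖ ^ p - c * s k ≤
      F k x - p * E k x := fun k => by
    filter_upwards [hFc k, hβ.bounds] with x hx hbx
    exact hco _ _ _ _ _ hbx.1 hbx.2 hx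
  have hcs : ∀ k, c * s k ≤ c := fun k => mul_le_of_le_one_right hc (hs1 k)
  -- the functions with the linear term subtracted converge in `L¹`
  have hgi : ∀ k, Integrable (fun x => F k x - p * E k x) μ := fun k =>
    (hFi k).sub ((hEi k).const_mul p)
  have hg₀i : Integrable (fun x => (1 - p) * (β x * ‖sobGrad u₀ x‖ ^ p)) μ := hβη.const_mul _
  have hstep1 := tendsto_integral_abs_sub_of_neg_part hgi hg₀i
    (G := fun x => D * ‖sobGrad u₀ x‖ ^ p + c) ((hη.const_mul D).add (integrable_const c))
    (fun k => by
      filter_upwards [hcos k, hβ.bounds] with x hx hbx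
      have h0 := hβ.pos.le.trans hbx.1
      have h1 := hβ.pos
      have h2 : 0 ≤ b₀ / 2 * ‖sobGrad (w k) x‖ ^ p := by positivity
      have h3 : (1 - p) * (β x * ‖sobGrad u₀ x‖ ^ p) ≤ 0 :=
        mul_nonpos_of_nonpos_of_nonneg (by linarith) (by positivity)
      have h4 : 0 ≤ D * ‖sobGrad u₀ x‖ ^ p := by positivity
      exact max_le (by linarith [hcs k]) (by linarith))
    (by
      filter_upwards [hF, hβ.bounds, ae_all_iff.2 hcos] with x hx hbx hcx
      exact hx.tendsto_neg_part hp hβ.pos hbx.1 hcs hcx)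
    (fun δ hδ => by
      filter_upwards [hlim δ hδ] with k hk
      rw [integral_sub (hFi k) ((hEi k).const_mul p), integral_const_mul, integral_const_mul, hE k]
      change _ ≤ (1 - p) * pEnergy β u₀ + δ
      linarith)
  obtain ⟨φ, hφ, hae⟩ := exists_seq_tendsto_ae_of_tendsto_integral_abs_sub hgi hg₀i hstep1
  refine ⟨φ, hφ, ?_⟩
  have hFφ : ∀ᵐ x ∂μ, IsAsymptoticPower p (β x) (fun k => F (φ k) x)
      fun k => sobGrad (w (φ k)) x := by
    filter_upwards [hF] with x hx ε hε
    exact hφ.tendsto_atTop.eventually (hx ε hε)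
  have hgrad : ∀ᵐ x ∂μ, Tendsto (fun k => sobGrad (w (φ k)) x) atTop (𝓝 (sobGrad u₀ x)) := by
    filter_upwards [hFφ, hβ.bounds, ae_all_iff.2 hcos, hae] with x hx hbx hcx hax
    exact hx.tendsto hp hβ.pos hbx.1 (fun k => hcs (φ k)) (fun k => hcx (φ k)) hax
  have hE0 : ∀ᵐ x ∂μ, Tendsto (fun k => E (φ k) x) atTop (𝓝 (β x * ‖sobGrad u₀ x‖ ^ p)) := by
    filter_upwards [hgrad] with x hx
    have h1 : Tendsto (fun k => inner ℝ (sobGrad u₀ x) (sobGrad (w (φ k)) x)) atTop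
        (𝓝 (inner ℝ (sobGrad u₀ x) (sobGrad u₀ x))) := tendsto_const_nhds.inner hx
    have h2 := (h1.const_mul (‖sobGrad u₀ x‖ ^ (p - 2))).const_mul (β x)
    rwa [rpow_sub_two_mul_inner_self hp] at h2
  have hFlim : ∀ᵐ x ∂μ, Tendsto (fun k => F (φ k) x) atTop (𝓝 (β x * ‖sobGrad u₀ x‖ ^ p)) := by
    filter_upwards [hae, hE0] with x h1 h2
    have h3 := h1.add (h2.const_mul p)
    convert h3 using 2 <;> ring
  -- hence so do the energy densities
  have hstep2 := tendsto_integral_abs_sub_of_neg_part (fun k => hFi (φ k)) hβη hβη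
    (fun k => by
      filter_upwards [hF0 (φ k), hβ.bounds] with x hx hbx
      have h0 := hβ.pos.le.trans hbx.1
      exact max_le (by linarith) (by positivity))
    (by
      filter_upwards [hFlim] with x hx
      have h1 := (tendsto_const_nhds (x := β x * ‖sobGrad u₀ x‖ ^ p)).sub hx
      rw [sub_self] at h1
      simpa using h1.max (tendsto_const_nhds (x := (0 : ℝ))))
    (fun δ hδ => hφ.tendsto_atTop.eventually (hlim δ hδ))
  -- and the gradients converge in `L^p`
  set C : ℝ := 2 ^ (p - 1) with hC
  have hC0 : 0 < C := by positivity
  have hb₀ := hβ.pos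
  have hstep3 := tendsto_integral_zero_of_le_add (μ := μ)
    (d := fun k x => ‖sobGrad (w (φ k) - u₀) x‖ ^ p)
    (e := fun k x => C / b₀ * |F (φ k) x - β x * ‖sobGrad u₀ x‖ ^ p| + C / b₀ * (c * s (φ k)))
    (G := fun x => C / b₀ * (β x * ‖sobGrad u₀ x‖ ^ p) + C * ‖sobGrad u₀ x‖ ^ p)
    (fun k => integrable_norm_sobGrad_rpow _)
    (fun k => (((hFi (φ k)).sub hβη).abs.const_mul _).add (integrable_const _))
    ((hβη.const_mul _).add (hη.const_mul _)) (fun k x => by positivity)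
    (fun k x => by have := hs0 (φ k); positivity)
    (by
      filter_upwards [hβ.bounds] with x hbx
      have h0 := hβ.pos.le.trans hbx.1
      positivity)
    (fun k => by
      filter_upwards [hFc (φ k), sobGrad_sub (w (φ k)) u₀] with x hx hsx
      have h1 := add_rpow_norm_le hp (sobGrad (w (φ k)) x) (-sobGrad u₀ x)
      rw [← sub_eq_add_neg, norm_neg, ← hsx, ← hC] at h1
      have h2 : C * ‖sobGrad (w (φ k)) x‖ ^ p ≤ C / b₀ * (F (φ k) x + c * s (φ k)) := by
        rw [div_mul_eq_mul_div, le_div_iff₀ hb₀]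
        nlinarith
      have h3 : C / b₀ * F (φ k) x ≤ C / b₀ * (|F (φ k) x - β x * ‖sobGrad u₀ x‖ ^ p| +
          β x * ‖sobGrad u₀ x‖ ^ p) := by
        gcongr
        linarith [le_abs_self (F (φ k) x - β x * ‖sobGrad u₀ x‖ ^ p)]
      linarith)
    (by
      filter_upwards [hgrad, ae_all_iff.2 fun k => sobGrad_sub (w (φ k)) u₀] with x hx hsx
      have h1 := (hx.sub_const (sobGrad u₀ x)).norm.rpow_const (p := p) (Or.inr hp0.le)
      rw [sub_self, norm_zero, Real.zero_rpow hp0.ne'] at h1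
      exact h1.congr fun k => by rw [hsx k])
    (by
      have h1 : ∀ k, ∫ x, (C / b₀ * |F (φ k) x - β x * ‖sobGrad u₀ x‖ ^ p| +
          C / b₀ * (c * s (φ k))) ∂μ = C / b₀ * ∫ x, |F (φ k) x - β x * ‖sobGrad u₀ x‖ ^ p| ∂μ +
            μ.real univ * (C / b₀ * (c * s (φ k))) := fun k => by
        have i1 : Integrable (fun x => C / b₀ * |F (φ k) x - β x * ‖sobGrad u₀ x‖ ^ p|) μ :=
          ((hFi (φ k)).sub hβη).abs.const_mul _
        rw [integral_add i1 (integrable_const _), integral_const_mul, integral_const,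
          smul_eq_mul]
      simp only [h1]
      have h2 := (hstep2.const_mul (C / b₀)).add ((((hs.comp hφ.tendsto_atTop).const_mul c).const_mul
        (C / b₀)).const_mul (μ.real univ))
      simpa using h2)
  have h1 : ∀ k, ‖(w (φ k) - u₀).1.2‖ =
      (∫ x, ‖sobGrad (w (φ k) - u₀) x‖ ^ p ∂μ) ^ (1 / p) := fun k => by
    change _ = (∫ x in U, ‖(w (φ k) - u₀).1.2 x‖ ^ p) ^ (1 / p)
    rw [← norm_rpow_eq_integral, ← Real.rpow_mul (norm_nonneg _), mul_one_div_cancel hp0.ne',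
      Real.rpow_one]
  simp only [h1]
  have h2 := hstep3.rpow_const (p := 1 / p) (Or.inr (by positivity))
  rwa [Real.zero_rpow (by positivity)] at h2

end StrongConvergence

section RescaledEnergy

variable {n : ℕ} {Ω A U : Set (Euc n)} {p q c C E₀ : ℝ}

theorem tendsto_rescaled (hp : 0 < p) {Q : ℝ → ℝ} {β E : ℝ} (hE : 0 ≤ E) (h0 : Q 0 = 0)
    (hlim : Tendsto (fun E : ℝ => Q E / E ^ p) atTop (𝓝 β)) :
    Tendsto (fun t : ℝ => Q (t * E) / t ^ p) atTop (𝓝 (β * E ^ p)) := by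
  rcases hE.eq_or_lt with rfl | hE
  · simp [h0, Real.zero_rpow hp.ne']
  · have h1 := (hlim.comp (tendsto_id.atTop_mul_const hE)).mul_const (E ^ p)
    refine h1.congr' ?_
    filter_upwards [eventually_gt_atTop 0] with t ht
    have h2 := (Real.rpow_pos_of_pos hE p).ne'
    simp only [Function.comp, id, Real.mul_rpow ht.le hE.le]
    field_simp

theorem isAsymptoticPower_rescaled (hp : 0 < p) {Q : ℝ → ℝ} {β : ℝ} (hE₀ : 0 < E₀)
    (hQ : ∀ E : ℝ, 0 ≤ E → 0 ≤ Q E ∧ Q E ≤ C * ((E / E₀) ^ p + 1)) (hC : 0 ≤ C)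
    (hlim : Tendsto (fun E : ℝ => Q E / E ^ p) atTop (𝓝 β)) {T : ℕ → ℝ}
    (hT : Tendsto T atTop atTop) (ξ : ℕ → Euc n) :
    IsAsymptoticPower p β (fun k => Q (T k * ‖ξ k‖) / T k ^ p) ξ := by
  intro ε hε
  obtain ⟨K, hK, H⟩ := exists_abs_sub_rpow_le hp hE₀ hQ hC hlim hε
  filter_upwards [hT.eventually_gt_atTop 0,
    ((tendsto_rpow_atTop hp).comp hT).eventually_ge_atTop (K / ε)] with k hk hkK
  have h1 := H (T k * ‖ξ k‖) (by positivity)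
  have h2 := Real.rpow_pos_of_pos hk p
  rw [Real.mul_rpow hk.le (norm_nonneg _)] at h1
  have h3 : Q (T k * ‖ξ k‖) / T k ^ p - β * ‖ξ k‖ ^ p =
      (Q (T k * ‖ξ k‖) - β * (T k ^ p * ‖ξ k‖ ^ p)) / T k ^ p := by field_simp
  rw [h3, abs_div, abs_of_pos h2, div_le_iff₀ h2]
  have h4 : K ≤ T k ^ p * ε := (div_le_iff₀ hε).1 hkK
  linarith

variable [Fact (1 < q)] {Q : Euc n → ℝ → ℝ} {β : Euc n → ℝ}

/-- The rescaled energy of growth `q < p` is negligible. -/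
theorem exists_lintegral_rescaled_le (hA : volume A ≠ ⊤) (hAΩ : A ⊆ Ω) (hC : 0 ≤ C) (hE₀ : 0 < E₀)
    (hg : HasGrowth A Q q c C E₀) (u : W1 Ω q) :
    ∃ a b : ℝ, ∀ t : ℝ, 0 < t →
      ENNReal.ofReal (1 / t ^ p) * ∫⁻ x in A, ENNReal.ofReal (Q x (t * ‖sobGrad u x‖)) ≤
        ENNReal.ofReal (a * t ^ (q - p) + b * t ^ (-p)) := by
  have hq0 : 0 < q := zero_lt_one.trans Fact.out
  have : IsFiniteMeasure (volume.restrict A) := ⟨by simpa using hA.lt_top⟩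
  have hi : Integrable (fun x => ‖sobGrad u x‖ ^ q) (volume.restrict A) :=
    (integrable_norm_sobGrad_rpow u).mono_measure (Measure.restrict_mono hAΩ le_rfl)
  refine ⟨C / E₀ ^ q * ∫ x in A, ‖sobGrad u x‖ ^ q, C * (volume.restrict A).real univ, fun t ht => ?_⟩
  have hi2 : Integrable (fun x => C * (t ^ q / E₀ ^ q * ‖sobGrad u x‖ ^ q + 1))
      (volume.restrict A) := ((hi.const_mul _).add (integrable_const 1)).const_mul C
  have h1 : ∫⁻ x in A, ENNReal.ofReal (Q x (t * ‖sobGrad u x‖)) ≤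
      ENNReal.ofReal (∫ x in A, C * (t ^ q / E₀ ^ q * ‖sobGrad u x‖ ^ q + 1)) := by
    rw [ofReal_integral_eq_lintegral_ofReal hi2 (Eventually.of_forall fun x => by positivity)]
    refine lintegral_mono_ae ?_
    filter_upwards [hg] with x hx
    have h2 := (hx (t * ‖sobGrad u x‖) (by positivity)).2
    rw [Real.div_rpow (by positivity) hE₀.le, Real.mul_rpow ht.le (norm_nonneg _)] at h2
    refine ENNReal.ofReal_le_ofReal (h2.trans (le_of_eq ?_))
    ring
  refine (mul_le_mul_right h1 _).trans ?_
  rw [← ENNReal.ofReal_mul (by positivity)]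
  refine ENNReal.ofReal_le_ofReal (le_of_eq ?_)
  rw [integral_const_mul, integral_add (hi.const_mul _) (integrable_const 1), integral_const_mul,
    integral_const, smul_eq_mul, mul_one, Real.rpow_sub ht, Real.rpow_neg ht.le]
  field_simp

variable [Fact (1 < p)]

theorem IsCaratheodory.aemeasurable_rescaled (hQ : IsCaratheodory U Q) {t : ℝ} (ht : 0 < t)
    (u : W1 U p) : AEMeasurable (fun x => Q x (t * ‖sobGrad u x‖)) (volume.restrict U) :=
  hQ.aemeasurable_comp ((memLp_sobGrad u).1.norm.aemeasurable.const_mul t) fun x => by positivity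

theorem rescaled_bounds (hconv : IsConvexDensity U Q) (hE₀ : 0 < E₀)
    (hg : HasGrowth U Q p c C E₀) (u : W1 U p) :
    ∀ᵐ x ∂(volume.restrict U), ∀ t : ℝ, 0 < t →
      0 ≤ Q x (t * ‖sobGrad u x‖) / t ^ p ∧
      c / E₀ ^ p * ‖sobGrad u x‖ ^ p - c * (1 / t ^ p) ≤ Q x (t * ‖sobGrad u x‖) / t ^ p ∧
      Q x (t * ‖sobGrad u x‖) / t ^ p ≤ C / E₀ ^ p * ‖sobGrad u x‖ ^ p + C * (1 / t ^ p) := by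
  filter_upwards [hconv, hg] with x hx hgx t ht
  have h0 : 0 ≤ t * ‖sobGrad u x‖ := by positivity
  have h1 := Real.rpow_pos_of_pos ht p
  have h2 := hgx _ h0
  have h3 : (t * ‖sobGrad u x‖ / E₀) ^ p = t ^ p * ‖sobGrad u x‖ ^ p / E₀ ^ p := by
    rw [Real.div_rpow h0 hE₀.le, Real.mul_rpow ht.le (norm_nonneg _)]
  rw [h3] at h2
  refine ⟨div_nonneg (hx.1 _ h0) h1.le, ?_, ?_⟩
  · rw [le_div_iff₀ h1]
    refine le_trans (le_of_eq ?_) h2.1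
    field_simp
  · rw [div_le_iff₀ h1]
    refine h2.2.trans (le_of_eq ?_)
    field_simp

theorem integrable_rescaled [IsFiniteMeasure (volume.restrict U)] (hQ : IsCaratheodory U Q)
    (hconv : IsConvexDensity U Q) (hE₀ : 0 < E₀) (hg : HasGrowth U Q p c C E₀) {t : ℝ} (ht : 0 < t)
    (u : W1 U p) : Integrable (fun x => Q x (t * ‖sobGrad u x‖) / t ^ p) (volume.restrict U) := by
  refine (((integrable_norm_sobGrad_rpow u).const_mul (C / E₀ ^ p)).add
    (integrable_const (C * (1 / t ^ p)))).mono'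
      ((hQ.aemeasurable_rescaled ht u).div_const _).aestronglyMeasurable ?_
  filter_upwards [rescaled_bounds hconv hE₀ hg u] with x hx
  obtain ⟨h1, -, h2⟩ := hx t ht
  rwa [Real.norm_of_nonneg h1]

theorem ofReal_integral_rescaled [IsFiniteMeasure (volume.restrict U)] (hQ : IsCaratheodory U Q)
    (hconv : IsConvexDensity U Q) (hE₀ : 0 < E₀) (hg : HasGrowth U Q p c C E₀) {t : ℝ} (ht : 0 < t)
    (u : W1 U p) : ENNReal.ofReal (∫ x in U, Q x (t * ‖sobGrad u x‖) / t ^ p) =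
      ENNReal.ofReal (1 / t ^ p) * ∫⁻ x in U, ENNReal.ofReal (Q x (t * ‖sobGrad u x‖)) := by
  rw [ofReal_integral_eq_lintegral_ofReal (integrable_rescaled hQ hconv hE₀ hg ht u)
    ((rescaled_bounds hconv hE₀ hg u).mono fun x hx => (hx t ht).1),
    ← lintegral_const_mul' _ _ ENNReal.ofReal_ne_top]
  refine lintegral_congr fun x => ?_
  rw [← ENNReal.ofReal_mul (by positivity), div_mul_eq_mul_div, one_mul]

theorem tendsto_integral_rescaled [IsFiniteMeasure (volume.restrict U)] (hQ : IsCaratheodory U Q)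
    (hconv : IsConvexDensity U Q) (hE₀ : 0 < E₀) (hC : 0 ≤ C) (hg : HasGrowth U Q p c C E₀)
    (hβ : ∀ᵐ x ∂(volume.restrict U), Tendsto (fun E : ℝ => Q x E / E ^ p) atTop (𝓝 (β x)))
    (u : W1 U p) : Tendsto (fun t : ℝ => ∫ x in U, Q x (t * ‖sobGrad u x‖) / t ^ p) atTop
      (𝓝 (pEnergy β u)) := by
  have hp0 : 0 < p := zero_lt_one.trans Fact.out
  refine tendsto_integral_filter_of_dominated_convergence
    (fun x => C / E₀ ^ p * ‖sobGrad u x‖ ^ p + C) ?_ ?_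
    (((integrable_norm_sobGrad_rpow u).const_mul _).add (integrable_const C)) ?_
  · filter_upwards [eventually_gt_atTop 0] with t ht
    exact (integrable_rescaled hQ hconv hE₀ hg ht u).1
  · filter_upwards [eventually_ge_atTop 1] with t ht
    filter_upwards [rescaled_bounds hconv hE₀ hg u] with x hx
    obtain ⟨h1, -, h2⟩ := hx t (by linarith)
    rw [Real.norm_of_nonneg h1]
    have h3 : C * (1 / t ^ p) ≤ C :=
      mul_le_of_le_one_right hC (div_le_one_of_le₀ (Real.one_le_rpow ht hp0.le) (by positivity))
    linarith
  · filter_upwards [hconv, hβ] with x hx hbx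
    exact tendsto_rescaled hp0 (norm_nonneg _) hx.2.2.2 hbx

theorem memLp_of_lintegral_density_ne_top [IsFiniteMeasure (volume.restrict U)]
    {g : Euc n → Euc n} (hgm : AEStronglyMeasurable g (volume.restrict U)) (hc : 0 < c)
    (hE₀ : 0 < E₀) (hg : HasGrowth U Q p c C E₀) {t : ℝ} (ht : 0 < t)
    (h : ∫⁻ x in U, ENNReal.ofReal (Q x (t * ‖g x‖)) ≠ ⊤) :
    MemLp g (ENNReal.ofReal p) (volume.restrict U) := by
  have hp0 : 0 < p := zero_lt_one.trans Fact.out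
  refine memLp_of_lintegral_rpow_ne_top hp0 hgm ?_
  set κ : ℝ := (E₀ / t) ^ p with hκ
  have hκ0 : 0 < κ := by positivity
  have hle : ∫⁻ x in U, ‖g x‖ₑ ^ p ≤
      ∫⁻ x in U, (ENNReal.ofReal (κ / c) * ENNReal.ofReal (Q x (t * ‖g x‖)) + ENNReal.ofReal κ) := by
    refine lintegral_mono_ae ?_
    filter_upwards [hg] with x hx
    have h1 := (hx (t * ‖g x‖) (by positivity)).1
    have h2 : ‖g x‖ ^ p ≤ κ / c * Q x (t * ‖g x‖) + κ := by
      have h3 : κ * (t * ‖g x‖ / E₀) ^ p = ‖g x‖ ^ p := by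
        rw [hκ, ← Real.mul_rpow (by positivity) (by positivity)]
        congr 1
        field_simp
      have h4 := mul_le_mul_of_nonneg_left h1 (show 0 ≤ κ / c by positivity)
      have h5 : κ / c * (c * ((t * ‖g x‖ / E₀) ^ p - 1)) = ‖g x‖ ^ p - κ := by
        rw [← h3]; field_simp
      linarith
    rw [← ofReal_norm, ENNReal.ofReal_rpow_of_nonneg (norm_nonneg _) hp0.le]
    refine (ENNReal.ofReal_le_ofReal h2).trans (ENNReal.ofReal_add_le.trans ?_)
    rw [ENNReal.ofReal_mul (by positivity)]
  refine ne_top_of_le_ne_top ?_ hle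
  rw [lintegral_add_right _ measurable_const, lintegral_const_mul' _ _ ENNReal.ofReal_ne_top,
    lintegral_const]
  exact ENNReal.add_ne_top.2 ⟨ENNReal.mul_ne_top ENNReal.ofReal_ne_top h,
    ENNReal.mul_ne_top ENNReal.ofReal_ne_top (measure_ne_top _ _)⟩

end RescaledEnergy

section Main

variable {n : ℕ} {Ω A : Set (Euc n)} {q p : ℝ} [Fact (1 < q)] [Fact (1 < p)]
  {QB QA : Euc n → ℝ → ℝ} {β : Euc n → ℝ} {c C E₀ : ℝ}

theorem volume_outer_ne_top (hgeo : IsAdmissibleGeometry Ω A) : volume (Ω \ closure A) ≠ ⊤ :=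
  (hgeo.isBounded.subset sdiff_subset).measure_lt_top.ne

/-- The energies of a fixed competitor with gradient in `L^p(Ω \ closure A)`. -/
theorem exists_normalizedEnergy_le (hgeo : IsAdmissibleGeometry Ω A)
    (hQ : IsCaratheodory (Ω \ closure A) QB) (hconv : IsConvexDensity (Ω \ closure A) QB)
    (hC : 0 ≤ C) (hE₀ : 0 < E₀) (hgB : HasGrowth (Ω \ closure A) QB p c C E₀)
    (hgA : HasGrowth A QA q c C E₀) {zq : W1 Ω q} {zB : W1 (Ω \ closure A) p}
    (hz : sobGrad zB =ᵐ[volume.restrict (Ω \ closure A)] sobGrad zq) :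
    ∃ a b : ℝ, ∀ t : ℝ, 0 < t → normalizedEnergy A QB QA p t zq ≤
      ENNReal.ofReal (∫ x in Ω \ closure A, QB x (t * ‖sobGrad zB x‖) / t ^ p) +
        ENNReal.ofReal (a * t ^ (q - p) + b * t ^ (-p)) := by
  have hfin : IsFiniteMeasure (volume.restrict (Ω \ closure A)) :=
    ⟨by simpa using (volume_outer_ne_top hgeo).lt_top⟩
  have hAΩ : A ⊆ Ω := subset_closure.trans hgeo.closure_subset
  obtain ⟨a, b, H⟩ := exists_lintegral_rescaled_le (p := p)
    ((hgeo.isBounded.subset hAΩ).measure_lt_top.ne) hAΩ hC hE₀ hgA zq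
  refine ⟨a, b, fun t ht => ?_⟩
  rw [normalizedEnergy, mul_add, ofReal_integral_rescaled hQ hconv hE₀ hgB ht]
  refine add_le_add (le_of_eq ?_) (H t ht)
  congr 1
  refine lintegral_congr_ae ?_
  filter_upwards [hz] with x hx
  rw [hx]

theorem eventually_normalizedEnergy_le (hgeo : IsAdmissibleGeometry Ω A) (hqp : q < p)
    (hQ : IsCaratheodory (Ω \ closure A) QB) (hconv : IsConvexDensity (Ω \ closure A) QB)
    (hC : 0 ≤ C) (hE₀ : 0 < E₀) (hgB : HasGrowth (Ω \ closure A) QB p c C E₀)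
    (hgA : HasGrowth A QA q c C E₀)
    (hβ : ∀ᵐ x ∂(volume.restrict (Ω \ closure A)),
      Tendsto (fun E : ℝ => QB x E / E ^ p) atTop (𝓝 (β x)))
    {zq : W1 Ω q} {zB : W1 (Ω \ closure A) p}
    (hz : sobGrad zB =ᵐ[volume.restrict (Ω \ closure A)] sobGrad zq) {M : ℝ}
    (hM0 : 0 < M) (hM : pEnergy β zB < M) :
    ∀ᶠ t in atTop, normalizedEnergy A QB QA p t zq ≤ ENNReal.ofReal M := by
  have hp0 : 0 < p := zero_lt_one.trans Fact.out
  have hfin : IsFiniteMeasure (volume.restrict (Ω \ closure A)) :=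
    ⟨by simpa using (volume_outer_ne_top hgeo).lt_top⟩
  obtain ⟨a, b, H⟩ := exists_normalizedEnergy_le hgeo hQ hconv hC hE₀ hgB hgA hz
  have h1 := tendsto_integral_rescaled hQ hconv hE₀ hC hgB hβ zB
  have h2 : Tendsto (fun t : ℝ => a * t ^ (q - p) + b * t ^ (-p)) atTop (𝓝 (a * 0 + b * 0)) := by
    have h3 := tendsto_rpow_neg_atTop (sub_pos.2 hqp)
    rw [neg_sub] at h3
    exact (h3.const_mul a).add ((tendsto_rpow_neg_atTop hp0).const_mul b)
  have h4 := (ENNReal.tendsto_ofReal h1).add (ENNReal.tendsto_ofReal h2)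
  rw [mul_zero, mul_zero, add_zero, ENNReal.ofReal_zero, add_zero] at h4
  filter_upwards [eventually_gt_atTop 0,
    h4.eventually (gt_mem_nhds ((ENNReal.ofReal_lt_ofReal_iff hM0).2 hM))] with t ht htM
  exact (H t ht).trans htM.le

/-- Functions in `W^{1,q}(Ω)` with finite energy restrict to functions in
`W^{1,p}(Ω \ closure A)`. -/
theorem exists_restrict_of_normalizedEnergy_ne_top [Nonempty (Fin n)]
    (hgeo : IsAdmissibleGeometry Ω A) (hc : 0 < c) (hE₀ : 0 < E₀)
    (hgB : HasGrowth (Ω \ closure A) QB p c C E₀) {f : Euc n → ℝ} {fq : W1 Ω q}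
    (hfq : sobFun fq =ᵐ[volume.restrict Ω] f) {fB : W1 (Ω \ closure A) p}
    (hfB : sobFun fB =ᵐ[volume.restrict (Ω \ closure A)] sobFun fq)
    (hfB' : sobGrad fB =ᵐ[volume.restrict (Ω \ closure A)] sobGrad fq)
    {v : W1 Ω q} (hv : EqOnBoundary Ω v f) {t : ℝ} (ht : 0 < t)
    (hE : normalizedEnergy A QB QA p t v ≠ ⊤) :
    ∃ w : W1 (Ω \ closure A) p, w - fB ∈ vanishingOn (Ω \ closure A) Ω p ∧
      sobFun w =ᵐ[volume.restrict (Ω \ closure A)] sobFun v ∧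
      sobGrad w =ᵐ[volume.restrict (Ω \ closure A)] sobGrad v := by
  have hfin : IsFiniteMeasure (volume.restrict (Ω \ closure A)) :=
    ⟨by simpa using (volume_outer_ne_top hgeo).lt_top⟩
  have hle : volume.restrict (Ω \ closure A) ≤ volume.restrict Ω :=
    Measure.restrict_mono sdiff_subset le_rfl
  have habs := hle.absolutelyContinuous
  have h1 : ∫⁻ x in Ω \ closure A, ENNReal.ofReal (QB x (t * ‖sobGrad v x‖)) ≠ ⊤ := by
    intro h
    refine hE ?_
    rw [normalizedEnergy, h, top_add, ENNReal.mul_top]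
    have := Real.rpow_pos_of_pos ht p
    simpa using this
  have h2 := memLp_of_lintegral_density_ne_top ((memLp_sobGrad v).1.mono_measure hle)
    hc hE₀ hgB ht h1
  have h3 : MemLp (sobGrad (v - fq)) (ENNReal.ofReal p) (volume.restrict (Ω \ closure A)) := by
    refine (memLp_congr_ae ?_).2 (h2.sub (memLp_sobGrad fB))
    filter_upwards [habs.ae_le (sobGrad_sub v fq), hfB'] with x hx hfx
    rw [hx, Pi.sub_apply, hfx]
  obtain ⟨u, hu, hu1, hu2⟩ := hgeo.exists_restrict_vanishingOn
    ((eqOnBoundary_iff hgeo.isOpen hfq).1 hv) h3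
  refine ⟨u + fB, by simpa using hu, ?_, ?_⟩
  · filter_upwards [sobFun_add u fB, hu1, hfB, habs.ae_le (sobFun_sub v fq)] with x e1 e2 e3 e4
    rw [e1, e2, e3, e4, sub_add_cancel]
  · filter_upwards [sobGrad_add u fB, hu2, hfB', habs.ae_le (sobGrad_sub v fq)] with x e1 e2 e3 e4
    rw [e1, e2, e3, e4, sub_add_cancel]

/-- The minimization problem on `Ω \ closure A` is uniquely solvable. -/
theorem exists_weightedMinimizer [Nonempty (Fin n)] (hgeo : IsAdmissibleGeometry Ω A)
    {b₀ b₁ : ℝ} (hβ : IsWeight (Ω \ closure A) β b₀ b₁) (fB : W1 (Ω \ closure A) p) :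
    ∃ vB : W1 (Ω \ closure A) p, vB - fB ∈ vanishingOn (Ω \ closure A) Ω p ∧
      (∀ w : W1 (Ω \ closure A) p, w - fB ∈ vanishingOn (Ω \ closure A) Ω p →
        pEnergy β vB ≤ pEnergy β w) ∧
      ∀ v : W1 (Ω \ closure A) p, v - fB ∈ vanishingOn (Ω \ closure A) Ω p →
        (∀ w : W1 (Ω \ closure A) p, w - fB ∈ vanishingOn (Ω \ closure A) Ω p →
          pEnergy β v ≤ pEnergy β w) → v = vB := by
  obtain ⟨K, hK, hP⟩ := hgeo.exists_norm_le_norm_grad (p := p)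
  refine hβ.exists_unique_minimizer
    (S := {u : W1 (Ω \ closure A) p | u - fB ∈ vanishingOn (Ω \ closure A) Ω p})
    (isClosed_vanishingOn.preimage (continuous_id.sub continuous_const)) ⟨fB, ?_⟩ ?_ hK ?_
  · simpa using zero_mem_vanishingOn
  · intro u hu v hv
    have h1 : (1 / 2 : ℝ) • (u + v) - fB = (1 / 2 : ℝ) • ((u - fB) + (v - fB)) := by
      module
    rw [mem_ofPred_eq, h1]
    exact smul_mem_vanishingOn _ (add_mem_vanishingOn hu hv)
  · intro u hu v hv
    refine hP _ ?_
    have h1 : u - v = (u - fB) - (v - fB) := by abel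
    rw [h1]
    exact sub_mem_vanishingOn hu hv

/-- Admissible competitors in `W^{1,q}(Ω)` whose gradients on `Ω \ closure A` are close to that of
a given function. -/
theorem exists_competitor (hgeo : IsAdmissibleGeometry Ω A) {b₀ b₁ : ℝ}
    (hβ : IsWeight (Ω \ closure A) β b₀ b₁) {f : Euc n → ℝ} {fq : W1 Ω q}
    (hfq : sobFun fq =ᵐ[volume.restrict Ω] f) {fB : W1 (Ω \ closure A) p}
    (hfB' : sobGrad fB =ᵐ[volume.restrict (Ω \ closure A)] sobGrad fq)
    {vB : W1 (Ω \ closure A) p} (hvB : vB - fB ∈ vanishingOn (Ω \ closure A) Ω p)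
    {δ : ℝ} (hδ : 0 < δ) :
    ∃ (zq : W1 Ω q) (zB : W1 (Ω \ closure A) p), EqOnBoundary Ω zq f ∧
      sobGrad zB =ᵐ[volume.restrict (Ω \ closure A)] sobGrad zq ∧
      pEnergy β zB < pEnergy β vB + δ := by
  have hle : volume.restrict (Ω \ closure A) ≤ volume.restrict Ω :=
    Measure.restrict_mono sdiff_subset le_rfl
  have habs := hle.absolutelyContinuous
  obtain ⟨ε, hε, H⟩ := Metric.continuous_iff.1 (hβ.continuous_pEnergy (p := p)) vB δ hδ
  obtain ⟨φ, hφ, hc, hs, hd⟩ := exists_test_dist_lt (hgeo.isOpen.sdiff isClosed_closure) hvB hε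
  refine ⟨fq + W1.ofTest Ω q hφ hc, fB + W1.ofTest _ p hφ hc,
    (eqOnBoundary_iff hgeo.isOpen hfq).2 ?_, ?_, ?_⟩
  · simpa using ofTest_mem_vanishingOn hφ hc hs
  · filter_upwards [sobGrad_add fB (W1.ofTest _ p hφ hc), hfB',
      W1.sobGrad_ofTest (U := Ω \ closure A) (p := p) hφ hc,
      habs.ae_le (sobGrad_add fq (W1.ofTest Ω q hφ hc)),
      habs.ae_le (W1.sobGrad_ofTest (U := Ω) (p := q) hφ hc)] with x e1 e2 e3 e4 e5
    rw [e1, e2, e3, e4, e5]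
  · have h1 := H (fB + W1.ofTest _ p hφ hc) (by
      rwa [dist_comm, dist_eq_norm, ← sub_sub, ← dist_eq_norm])
    rw [Real.dist_eq] at h1
    linarith [(abs_lt.1 h1).2]

theorem toWeakSpace_tendsto {ι E : Type*} [NormedAddCommGroup E] [NormedSpace ℝ E] {l : Filter ι}
    {w : ι → E} {v : E} (h : Tendsto w l (𝓝 v)) :
    Tendsto (fun t => toWeakSpace ℝ E (w t)) l (𝓝 (toWeakSpace ℝ E v)) :=
  ((toWeakSpaceCLM ℝ E).continuous.tendsto v).comp h

set_option maxHeartbeats 1000000 in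
/-- Functions whose rescaled energies are asymptotically below the minimum of the weighted energy
converge strongly to the minimizer. -/
theorem tendsto_minimizer [Nonempty (Fin n)] (hgeo : IsAdmissibleGeometry Ω A)
    (hQ : IsCaratheodory (Ω \ closure A) QB) (hconv : IsConvexDensity (Ω \ closure A) QB)
    (hc : 0 < c) (hC : 0 ≤ C) (hE₀ : 0 < E₀) (hgB : HasGrowth (Ω \ closure A) QB p c C E₀)
    (hβ : ∀ᵐ x ∂(volume.restrict (Ω \ closure A)),
      Tendsto (fun E : ℝ => QB x E / E ^ p) atTop (𝓝 (β x)))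
    {vB : W1 (Ω \ closure A) p} {w : ℝ → W1 (Ω \ closure A) p}
    (hw : ∀ t, 0 < t → w t - vB ∈ vanishingOn (Ω \ closure A) Ω p)
    (hcrit : ∀ φ ∈ vanishingOn (Ω \ closure A) Ω p, ∫ x in Ω \ closure A,
      β x * ‖sobGrad vB x‖ ^ (p - 2) * inner ℝ (sobGrad vB x) (sobGrad φ x) = 0)
    (hlim : ∀ δ : ℝ, 0 < δ → ∀ᶠ t in atTop,
      ∫ x in Ω \ closure A, QB x (t * ‖sobGrad (w t) x‖) / t ^ p ≤ pEnergy β vB + δ) :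
    Tendsto w atTop (𝓝 vB) := by
  have hp0 : 0 < p := zero_lt_one.trans Fact.out
  have hfin : IsFiniteMeasure (volume.restrict (Ω \ closure A)) :=
    ⟨by simpa using (volume_outer_ne_top hgeo).lt_top⟩
  have hwt := isWeight_of_growth hQ hc hE₀ hp0 hgB hβ
  obtain ⟨K, hK, hP⟩ := hgeo.exists_norm_le_norm_grad (p := p)
  refine tendsto_of_subseq_tendsto fun ns hns => ?_
  obtain ⟨N, hN⟩ := eventually_atTop.1 (hns.eventually_ge_atTop 1)
  set T : ℕ → ℝ := fun k => ns (k + N) with hT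
  have hT1 : ∀ k, 1 ≤ T k := fun k => hN _ (Nat.le_add_left _ _)
  have hT0 : ∀ k, 0 < T k := fun k => zero_lt_one.trans_le (hT1 k)
  have hTt : Tendsto T atTop atTop := hns.comp (tendsto_add_atTop_nat N)
  obtain ⟨φ, hφ, H⟩ := hwt.exists_subseq_tendsto_norm_grad (u₀ := vB) (w := fun k => w (T k))
    hc.le (s := fun k => 1 / T k ^ p)
    (((tendsto_rpow_atTop hp0).comp hTt).inv_tendsto_atTop.congr fun k => (one_div _).symm)
    (fun k => by have := hT0 k; positivity)
    (fun k => div_le_one_of_le₀ (Real.one_le_rpow (hT1 k) hp0.le) (by have := hT0 k; positivity))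
    (F := fun k x => QB x (T k * ‖sobGrad (w (T k)) x‖) / T k ^ p)
    (fun k => integrable_rescaled hQ hconv hE₀ hgB (hT0 k) _)
    (fun k => (rescaled_bounds hconv hE₀ hgB (w (T k))).mono fun x hx => (hx _ (hT0 k)).1)
    (fun k => (rescaled_bounds hconv hE₀ hgB (w (T k))).mono fun x hx => (hx _ (hT0 k)).2.1)
    (by
      filter_upwards [hconv, hgB, hβ] with x h1 h2 h3
      exact isAsymptoticPower_rescaled hp0 hE₀ (fun E hE => ⟨h1.1 E hE, (h2 E hE).2⟩) hC h3 hTt _)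
    (fun k => hcrit _ (hw _ (hT0 k)))
    (fun δ hδ => hTt.eventually (hlim δ hδ))
  refine ⟨fun k => φ k + N, ?_⟩
  rw [tendsto_iff_norm_sub_tendsto_zero]
  refine squeeze_zero (fun k => norm_nonneg _) (fun k => hP _ (hw _ (hT0 (φ k)))) ?_
  simpa using H.const_mul K

end Main

set_option maxHeartbeats 1000000 in
theorem mainTheorem3 (n : ℕ) (hn : 2 ≤ n) (q p : ℝ) [Fact (1 < q)] [Fact (1 < p)] (hqp : q < p)
    (Ω A : Set (Euc n)) (hgeo : IsAdmissibleGeometry Ω A)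
    (QB QA : Euc n → ℝ → ℝ)
    (hA1B : IsCaratheodory (Ω \ closure A) QB) (hA1A : IsCaratheodory A QA)
    (hA2B : IsConvexDensity (Ω \ closure A) QB) (hA2A : IsConvexDensity A QA)
    (hA3 : ∃ c C E₀ : ℝ, 0 < c ∧ c ≤ C ∧ 0 < E₀ ∧
      HasGrowth (Ω \ closure A) QB p c C E₀ ∧ HasGrowth A QA q c C E₀)
    (β : Euc n → ℝ)
    (hA4 : ∀ᵐ x ∂(volume.restrict (Ω \ closure A)),
      Tendsto (fun E : ℝ => QB x E / E ^ p) atTop (𝓝 (β x)))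
    (f : W1 Ω p)
    (v : ℝ → W1 Ω q)
    (hv : ∀ t : ℝ, 0 < t → IsNormalizedSolution A QB QA p t (sobFun f) (v t)) :
    ∃ vB : W1 (Ω \ closure A) p,
      IsWeightedMinimizer Ω β (sobFun f) vB ∧
      (∀ v' : W1 (Ω \ closure A) p, IsWeightedMinimizer Ω β (sobFun f) v' → v' = vB) ∧
      IsWeakNeumannSolution Ω β (sobFun f) vB ∧
      ∃ w : ℝ → W1 (Ω \ closure A) p,
        (∀ t : ℝ, 0 < t → sobFun (w t) =ᵐ[volume.restrict (Ω \ closure A)] sobFun (v t)) ∧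
        Tendsto (fun t : ℝ => toWeakSpace ℝ (W1 (Ω \ closure A) p) (w t)) atTop
          (𝓝 (toWeakSpace ℝ (W1 (Ω \ closure A) p) vB)) := by
  have hne : Nonempty (Fin n) := ⟨⟨0, by omega⟩⟩
  have hp0 : 0 < p := zero_lt_one.trans Fact.out
  obtain ⟨c, C, E₀, hc, hcC, hE₀, hgB, hgA⟩ := hA3
  have hC : 0 ≤ C := hc.le.trans hcC
  have hBo : IsOpen (Ω \ closure A) := hgeo.isOpen.sdiff isClosed_closure
  have hfin : IsFiniteMeasure (volume.restrict (Ω \ closure A)) :=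
    ⟨by simpa using (volume_outer_ne_top hgeo).lt_top⟩
  have habs : volume.restrict (Ω \ closure A) ≪ volume.restrict Ω :=
    (Measure.restrict_mono sdiff_subset le_rfl).absolutelyContinuous
  have hβ := isWeight_of_growth hA1B hc hE₀ hp0 hgB hA4
  obtain ⟨fB, hfB, hfB'⟩ := exists_W1_restrict hgeo.isOpen.measurableSet
    (sdiff_subset (t := closure A)) f
  obtain ⟨fq, hfq, hfq'⟩ := exists_W1_lower hgeo.isBounded.measure_lt_top.ne hqp.le f
  have hfBq := hfB.trans (habs.ae_eq hfq).symm
  have hfBq' := hfB'.trans (habs.ae_eq hfq').symm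
  have hbd : ∀ u : W1 (Ω \ closure A) p, EqOnBoundary Ω u (sobFun f) ↔
      u - fB ∈ vanishingOn (Ω \ closure A) Ω p := fun u => eqOnBoundary_iff hBo hfB
  obtain ⟨vB, hvB, hmin, huniq⟩ := exists_weightedMinimizer hgeo hβ fB
  have hcrit : ∀ φ ∈ vanishingOn (Ω \ closure A) Ω p, ∫ x in Ω \ closure A,
      β x * ‖sobGrad vB x‖ ^ (p - 2) * inner ℝ (sobGrad vB x) (sobGrad φ x) = 0 :=
    fun φ hφ => hβ.euler_eq_zero fun t => hmin _ (by
      rw [add_sub_right_comm]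
      exact add_mem_vanishingOn hvB (smul_mem_vanishingOn t hφ))
  refine ⟨vB, ⟨(hbd _).2 hvB, fun u hu => ?_⟩, fun v' hv' => huniq v' ((hbd _).1 hv'.1)
    fun u hu => ?_, ⟨(hbd _).2 hvB, fun φ hφ => ⟨hβ.integrable_euler vB φ, hcrit φ hφ⟩⟩, ?_⟩
  · rw [hβ.weightedEnergy_eq, hβ.weightedEnergy_eq]
    exact ENNReal.ofReal_le_ofReal (hmin u ((hbd _).1 hu))
  · have h1 := hv'.2 u ((hbd _).2 hu)
    rw [hβ.weightedEnergy_eq, hβ.weightedEnergy_eq] at h1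
    exact (ENNReal.ofReal_le_ofReal_iff (hβ.pEnergy_nonneg u)).1 h1
  have hex : ∀ t : ℝ, ∃ w : W1 (Ω \ closure A) p, 0 < t →
      w - fB ∈ vanishingOn (Ω \ closure A) Ω p ∧
      sobFun w =ᵐ[volume.restrict (Ω \ closure A)] sobFun (v t) ∧
      sobGrad w =ᵐ[volume.restrict (Ω \ closure A)] sobGrad (v t) := fun t => by
    by_cases ht : 0 < t
    · obtain ⟨a, b, H⟩ := exists_normalizedEnergy_le hgeo hA1B hA2B hC hE₀ hgB hgA hfBq'
      have h1 : EqOnBoundary Ω fq (sobFun f) :=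
        (eqOnBoundary_iff hgeo.isOpen hfq).2 (by rw [sub_self]; exact zero_mem_vanishingOn)
      have h2 := ne_top_of_le_ne_top
        (ENNReal.add_ne_top.2 ⟨ENNReal.ofReal_ne_top, ENNReal.ofReal_ne_top⟩)
        (((hv t ht).2 fq h1).trans (H t ht))
      obtain ⟨w, hw⟩ := exists_restrict_of_normalizedEnergy_ne_top hgeo hc hE₀ hgB hfq hfBq hfBq'
        (hv t ht).1 ht h2
      exact ⟨w, fun _ => hw⟩
    · exact ⟨0, fun h => absurd h ht⟩
  choose w hw using hex
  refine ⟨w, fun t ht => (hw t ht).2.1, toWeakSpace_tendsto ?_⟩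
  refine tendsto_minimizer hgeo hA1B hA2B hc hC hE₀ hgB hA4 (fun t ht => ?_) hcrit fun δ hδ => ?_
  · have h1 : w t - vB = (w t - fB) - (vB - fB) := by abel
    rw [h1]
    exact sub_mem_vanishingOn (hw t ht).1 hvB
  · obtain ⟨zq, zB, hz, hzg, hzE⟩ := exists_competitor hgeo hβ hfq hfBq' hvB hδ
    have hM0 : 0 < pEnergy β vB + δ := by linarith [hβ.pEnergy_nonneg vB]
    filter_upwards [eventually_gt_atTop 0, eventually_normalizedEnergy_le hgeo hqp hA1B hA2B hC hE₀
      hgB hgA hA4 hzg hM0 hzE] with t ht htE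
    rw [← ENNReal.ofReal_le_ofReal_iff hM0.le, ofReal_integral_rescaled hA1B hA2B hE₀ hgB ht]
    refine le_trans ?_ (((hv t ht).2 zq hz).trans htE)
    rw [normalizedEnergy, mul_add]
    refine le_trans (le_of_eq ?_) le_self_add
    congr 1
    refine lintegral_congr_ae ?_
    filter_upwards [(hw t ht).2.2] with x hx
    rw [hx]
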